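/- Let $\Gamma$ be a finite alphabet and let $F\subseteq\Gamma^*$ be an arbitrary language (a filter). *Machines.* A nondeterministic log-space machine with advice from $F$ is a nondeterministic Turing machine $M$ with a two-way read-only input tape (with endmarkers), finitely many read-write work tapes, and a one-way read-only advice tape, which initially contains $y\Lambda^\infty$ for some $y\in F$, where $\Lambda\notin\Gamma$ marks empty cells. In each step $M$ sees the scanned advice symbol and may or may not move the advice head one cell to the right. For some constant $C$ and for all inputs $x$ and all $y\in F$, $M$ uses at most $C(\log(|x|+1)+1)$ work cells along every computation. $M$ accepts $x$ if there is $y\in F$ such that some computation of $M$ on input $x$ with advice $y$ reaches an accepting state at a moment when all letters of $y$ have been processed. Let $\mathrm{CL}(\mathrm{NA}_F\mathrm{logTM})$ be the class of all languages over finite alphabets recognized by such machines, and let $\mathrm{CL}(\mathrm{DA}_F\mathrm{logTM})$ be the class of those recognized by such machines that are deterministic. *Problems.* Let $\mathrm{NRR}(F)$ be the set of descriptions of nondeterministic finite automata $\mathcal A$ over $\Gamma$ ($\varepsilon$-transitions are allowed) with $L(\mathcal A)\cap F\ne\emptyset$, and let $\mathrm{RR}(F)$ be the set of descriptions of deterministic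 finite automata $\mathcal A$ over $\Gamma$ (without $\varepsilon$-transitions, with a partial transition function) with $L(\mathcal A)\cap F\ne\emptyset$. A description of an automaton is a word over a fixed finite alphabet that lists the initial state, the accepting states and the transitions, the states being named by binary words. Write $L\le_{\log}K$ if there is a function $f$, computable by a deterministic log-space transducer, such that $x\in L\iff f(x)\in K$ for all words $x$. **Theorem.** For every filter $F$, $$\mathrm{CL}(\mathrm{NA}_F\mathrm{logTM})=\{L : L\le_{\log}\mathrm{NRR}(F)\},\qquad \mathrm{CL}(\mathrm{DA}_F\mathrm{logTM})=\{L : L\le_{\log}\mathrm{RR}(F)\},$$ where $L$ ranges over the languages over finite alphabets. -/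

import Mathlib

namespace RegReal

/-! ### Turing machines with a read-only input tape and work tapes -/

/-- Head movements. -/
inductive Dir
  | left
  | stay
  | right

/-- What the head on the read-only input tape scans: an input letter or one of the two endmarkers
that delimit the input word. -/
inductive InputCell (A : Type)
  | leftEnd
  | letter (a : A)
  | rightEnd

/-- The input tape holds the left endmarker in cell `0`, the letters of `x` in the cells
`1, …, |x|`, and the right endmarker in cell `|x| + 1`. -/
def readInput {A : Type} (x : List A) : ℕ → InputCell A
  | 0 => .leftEnd
  | p + 1 =>
    match x[p]? with
    | some a => .letter a
    | none => .rightEnd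

/-- Movement of the input head, which stays within the cells `0, …, n + 1`. -/
def Dir.moveInput (n : ℕ) : Dir → ℕ → ℕ
  | .left, p => p - 1
  | .stay, p => p
  | .right, p => min (p + 1) (n + 1)

/-- Movement of a head on a work tape, whose cells are numbered `0, 1, 2, …`; a left move in
cell `0` leaves the head there. -/
def Dir.moveWork : Dir → ℕ → ℕ
  | .left, p => p - 1
  | .stay, p => p
  | .right, p => p + 1

/-- One instruction: the next state, the symbols written on the `k` work tapes, the movements of
the work heads and of the input head, and what is done on the additional one-way tape. -/
structure Instr (State Work : Type) (k : ℕ) (Act : Type) where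
  next : State
  write : Fin k → Work
  workDir : Fin k → Dir
  inputDir : Dir
  act : Act

/-- A (nondeterministic) Turing machine with a two-way read-only input tape over the alphabet `A`,
finitely many read-write work tapes, and an additional one-way tape. The finite control sees a
value of `Obs` on the additional tape and performs an action of `Act` on it. The machine may
execute any instruction in the set given by `trans`; it halts if there is none. -/
structure TM (A Obs Act : Type) where
  State : Type
  finiteState : Finite State
  Work : Type
  finiteWork : Finite Work
  blank : Work
  /-- number of work tapes -/
  k : ℕ
  start : State
  accept : Set State
  trans : State → InputCell A → (Fin k → Work) → Obs → Set (Instr State Work k Act)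

namespace TM

variable {A Obs Act : Type}

/-- A machine is deterministic if in every situation it has at most one possible instruction. -/
def Deterministic (M : TM A Obs Act) : Prop :=
  ∀ q s w o, (M.trans q s w o).Subsingleton

/-- A configuration without the additional one-way tape: the state, the position of the input
head, and the contents and head positions of the work tapes. -/
@[ext]
structure Cfg (M : TM A Obs Act) where
  state : M.State
  inputHead : ℕ
  tape : Fin M.k → ℕ → M.Work
  head : Fin M.k → ℕ

/-- The initial configuration: the input head is on the left endmarker, all work tapes are blank. -/
def init (M : TM A Obs Act) : M.Cfg where
  state := M.start
  inputHead := 0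
  tape := fun _ _ => M.blank
  head := fun _ => 0

/-- The configuration after executing the instruction `m` in the configuration `c`. -/
def exec (M : TM A Obs Act) (x : List A) (c : M.Cfg) (m : Instr M.State M.Work M.k Act) :
    M.Cfg where
  state := m.next
  inputHead := m.inputDir.moveInput x.length c.inputHead
  tape := fun i => Function.update (c.tape i) (c.head i) (m.write i)
  head := fun i => (m.workDir i).moveWork (c.head i)

/-- The instructions that are possible on input `x` in the configuration `c` if `o` is seen on the
additional tape. -/
def enabled (M : TM A Obs Act) (x : List A) (c : M.Cfg) (o : Obs) :
    Set (Instr M.State M.Work M.k Act) :=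
  M.trans c.state (readInput x c.inputHead) (fun i => c.tape i (c.head i)) o

/-- On input `x`, the machine can move from `c` to `c'` while seeing `o` on the additional tape
and performing the action `a` on it. -/
def Step (M : TM A Obs Act) (x : List A) (c : M.Cfg) (o : Obs) (a : Act) (c' : M.Cfg) : Prop :=
  ∃ m ∈ M.enabled x c o, m.act = a ∧ c' = M.exec x c m

/-- In the configuration `c` all work heads are within the first `s + 1` cells. -/
def Cfg.WorkBounded {M : TM A Obs Act} (c : M.Cfg) (s : ℕ) : Prop :=
  ∀ i, c.head i ≤ s

end TM

/-! ### Log-space transducers and log-space reductions -/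

/-- A Turing machine with a one-way write-only output tape over `B`: in each step it appends at
most one symbol to the output. -/
abbrev Transducer (A B : Type) := TM A Unit (Option B)

namespace Transducer

variable {A B : Type}

/-- Moves on pairs (configuration, output written so far). -/
def Move (T : Transducer A B) (x : List A) (p q : TM.Cfg T × List B) : Prop :=
  ∃ b : Option B, TM.Step T x p.1 () b q.1 ∧ q.2 = p.2 ++ b.toList

/-- The pair `p` occurs in the computation of `T` on `x`. -/
def Reaches (T : Transducer A B) (x : List A) (p : TM.Cfg T × List B) : Prop :=
  Relation.ReflTransGen (T.Move x) (TM.init T, []) p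

/-- `T` uses logarithmic space on its work tapes. -/
def LogSpace (T : Transducer A B) : Prop :=
  ∃ C : ℕ, ∀ x p, T.Reaches x p → p.1.WorkBounded (C * (Nat.log 2 x.length + 1))

/-- On every input `x` the machine `T` halts with output `f x`. -/
def Computes (T : Transducer A B) (f : List A → List B) : Prop :=
  ∀ x, ∃ c : TM.Cfg T, T.Reaches x (c, f x) ∧ TM.enabled T x c () = ∅

end Transducer

/-- Functions computable by deterministic log-space transducers. -/
def LogSpaceComputable {A B : Type} (f : List A → List B) : Prop :=
  ∃ T : Transducer A B, TM.Deterministic T ∧ T.LogSpace ∧ T.Computes f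

/-- The deterministic log-space many-one reduction. -/
def LogReduces {A B : Type} (L : Language A) (K : Language B) : Prop :=
  ∃ f : List A → List B, LogSpaceComputable f ∧ ∀ x, x ∈ L ↔ f x ∈ K

/-! ### Log-space machines with an advice tape -/

/-- A Turing machine with a one-way read-only advice tape over `Γ`. It sees the scanned advice
symbol, where `none` is the symbol `Λ` of the empty cells, and the action tells whether the advice
head moves one cell to the right (`true`) or stays (`false`). -/
abbrev AdviceTM (A Γ : Type) := TM A (Option Γ) Bool

namespace AdviceTM

variable {A Γ : Type}

/-- Moves on pairs (configuration, unprocessed part of the advice word). -/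
def Move (M : AdviceTM A Γ) (x : List A) (p q : TM.Cfg M × List Γ) : Prop :=
  ∃ adv : Bool, TM.Step M x p.1 p.2.head? adv q.1 ∧ q.2 = if adv then p.2.tail else p.2

/-- The pair `p` is reachable on input `x` and advice `y`. -/
def Reaches (M : AdviceTM A Γ) (x : List A) (y : List Γ) (p : TM.Cfg M × List Γ) : Prop :=
  Relation.ReflTransGen (M.Move x) (TM.init M, y) p

/-- `M` uses logarithmic space on its work tapes, for every advice word of `F` and along every
computation path. -/
def LogSpace (M : AdviceTM A Γ) (F : Language Γ) : Prop :=
  ∃ C : ℕ, ∀ x, ∀ y ∈ F, ∀ p, M.Reaches x y p →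
    p.1.WorkBounded (C * (Nat.log 2 x.length + 1))

/-- `M` accepts `x` if for some advice word of `F` it can reach an accepting state with the whole
advice word processed. -/
def Accepts (M : AdviceTM A Γ) (F : Language Γ) (x : List A) : Prop :=
  ∃ y ∈ F, ∃ c : TM.Cfg M, M.Reaches x y (c, []) ∧ c.state ∈ TM.accept M

/-- The language recognized by `M` with advice from `F`. -/
def language (M : AdviceTM A Γ) (F : Language Γ) : Language A :=
  {x | M.Accepts F x}

end AdviceTM

/-- The languages over `A` recognized by nondeterministic log-space machines with advice
from `F`. -/
def CLNA (A : Type) {Γ : Type} (F : Language Γ) : Set (Language A) :=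
  {L | ∃ M : AdviceTM A Γ, M.LogSpace F ∧ M.language F = L}

/-- The languages over `A` recognized by deterministic log-space machines with advice
from `F`. -/
def CLDA (A : Type) {Γ : Type} (F : Language Γ) : Set (Language A) :=
  {L | ∃ M : AdviceTM A Γ, TM.Deterministic M ∧ M.LogSpace F ∧ M.language F = L}

/-! ### Descriptions of finite automata -/

/-- A transition of a finite automaton over `Γ`; the label `none` is the empty word. States are
named by binary words. -/
structure Edge (Γ : Type) where
  src : List Bool
  label : Option Γ
  dst : List Bool

/-- A nondeterministic finite automaton over `Γ`, given by its initial state, the list of its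
accepting states and the list of its transitions. -/
structure FA (Γ : Type) where
  start : List Bool
  accept : List (List Bool)
  edges : List (Edge Γ)

namespace FA

variable {Γ : Type}

/-- The automaton as an `εNFA`. -/
def toεNFA (𝒜 : FA Γ) : εNFA Γ (List Bool) where
  step q o := {r | Edge.mk q o r ∈ 𝒜.edges}
  start := {𝒜.start}
  accept := {q | q ∈ 𝒜.accept}

/-- The language recognized by the automaton. -/
def language (𝒜 : FA Γ) : Language Γ := 𝒜.toεNFA.accepts

/-- The automaton is deterministic: there are no `ε`-transitions, and the transitions form a
partial function. -/
def IsDFA (𝒜 : FA Γ) : Prop :=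
  (∀ e ∈ 𝒜.edges, e.label ≠ none) ∧
  ∀ e ∈ 𝒜.edges, ∀ f ∈ 𝒜.edges, e.src = f.src → e.label = f.label → e.dst = f.dst

end FA

/-- The alphabet of descriptions of automata. -/
inductive Tok (Γ : Type)
  | bit (b : Bool)
  | startMark
  | acceptMark
  | edgeMark
  | label (o : Option Γ)

/-- `edgeMark`, source, label, target. -/
def Edge.encode {Γ : Type} (e : Edge Γ) : List (Tok Γ) :=
  Tok.edgeMark :: (e.src.map Tok.bit ++ Tok.label e.label :: e.dst.map Tok.bit)

/-- The description of an automaton as a word: the initial state, the accepting states, and the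
transitions, each preceded by its mark. -/
def FA.encode {Γ : Type} (𝒜 : FA Γ) : List (Tok Γ) :=
  Tok.startMark :: (𝒜.start.map Tok.bit ++
    (𝒜.accept.flatMap (fun q => Tok.acceptMark :: q.map Tok.bit) ++
      𝒜.edges.flatMap Edge.encode))

/-- The nondeterministic regular realizability problem: the descriptions of nondeterministic
finite automata whose language meets the filter `F`. -/
def NRR {Γ : Type} (F : Language Γ) : Language (Tok Γ) :=
  {w | ∃ 𝒜 : FA Γ, w = 𝒜.encode ∧ ∃ y ∈ F, y ∈ 𝒜.language}

/-- The regular realizability problem: the descriptions of deterministic finite automata whose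
language meets the filter `F`. -/
def RR {Γ : Type} (F : Language Γ) : Language (Tok Γ) :=
  {w | ∃ 𝒜 : FA Γ, 𝒜.IsDFA ∧ w = 𝒜.encode ∧ ∃ y ∈ F, y ∈ 𝒜.language}

/-! Descriptions are unambiguous. -/

/-- The words that are empty or start with a symbol that is not a bit. -/
def NoBit {Γ : Type} : List (Tok Γ) → Prop
  | Tok.bit _ :: _ => False
  | _ => True

theorem bits_append_inj {Γ : Type} {s t : List (Tok Γ)} (hs : NoBit s) (ht : NoBit t) :
    ∀ {u v : List Bool}, u.map Tok.bit ++ s = v.map Tok.bit ++ t → u = v ∧ s = t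
  | [], [], h => ⟨rfl, by simpa using h⟩
  | [], b :: v, h => by simp only [List.map_nil, List.nil_append] at h; subst h; exact hs.elim
  | b :: u, [], h => by simp only [List.map_nil, List.nil_append] at h; subst h; exact ht.elim
  | b :: u, c :: v, h => by
    simp only [List.map_cons, List.cons_append, List.cons.injEq, Tok.bit.injEq] at h
    obtain ⟨h1, h2⟩ := bits_append_inj hs ht h.2
    exact ⟨by rw [h.1, h1], h2⟩

theorem noBit_edges {Γ : Type} (es : List (Edge Γ)) : NoBit (es.flatMap Edge.encode) := by
  cases es <;> simp [NoBit, Edge.encode]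

theorem edges_encode_inj {Γ : Type} :
    ∀ {es fs : List (Edge Γ)}, es.flatMap Edge.encode = fs.flatMap Edge.encode → es = fs
  | [], [], _ => rfl
  | [], f :: fs, h => by simp [Edge.encode] at h
  | e :: es, [], h => by simp [Edge.encode] at h
  | ⟨a, o, b⟩ :: es, ⟨a₁, o₁, b₁⟩ :: fs, h => by
    simp only [List.flatMap_cons, Edge.encode, List.cons_append, List.append_assoc,
      List.cons.injEq, true_and] at h
    obtain ⟨h1, h2⟩ := bits_append_inj (by simp [NoBit]) (by simp [NoBit]) h
    simp only [List.cons.injEq, Tok.label.injEq] at h2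
    obtain ⟨h3, h4⟩ := bits_append_inj (noBit_edges es) (noBit_edges fs) h2.2
    rw [edges_encode_inj h4, h1, h2.1, h3]

theorem noBit_tail {Γ : Type} (l : List (List Bool)) (es : List (Edge Γ)) :
    NoBit (l.flatMap (fun q => Tok.acceptMark :: q.map Tok.bit) ++ es.flatMap Edge.encode) := by
  cases l
  · simpa using noBit_edges es
  · simp [NoBit]

theorem tail_encode_inj {Γ : Type} {es fs : List (Edge Γ)} :
    ∀ {l m : List (List Bool)},
      l.flatMap (fun q => Tok.acceptMark :: q.map Tok.bit) ++ es.flatMap Edge.encode =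
        m.flatMap (fun q => Tok.acceptMark :: q.map Tok.bit) ++ fs.flatMap Edge.encode →
      l = m ∧ es = fs
  | [], [], h => ⟨rfl, edges_encode_inj (by simpa using h)⟩
  | [], q :: m, h => by cases es <;> simp [Edge.encode] at h
  | q :: l, [], h => by cases fs <;> simp [Edge.encode] at h
  | q :: l, r :: m, h => by
    simp only [List.flatMap_cons, List.cons_append, List.append_assoc, List.cons.injEq,
      true_and] at h
    obtain ⟨h1, h2⟩ := bits_append_inj (noBit_tail l es) (noBit_tail m fs) h
    obtain ⟨h3, h4⟩ := tail_encode_inj h2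
    exact ⟨by rw [h1, h3], h4⟩

theorem FA.encode_injective {Γ : Type} : Function.Injective (FA.encode (Γ := Γ)) := by
  rintro ⟨s, l, es⟩ ⟨t, m, fs⟩ h
  simp only [FA.encode, List.cons.injEq, true_and] at h
  obtain ⟨h1, h2⟩ := bits_append_inj (noBit_tail l es) (noBit_tail m fs) h
  obtain ⟨h3, h4⟩ := tail_encode_inj h2
  rw [h1, h3, h4]

end RegReal

/-! ### From structured programs to Turing machines -/

namespace RegReal

open Relation

/-! ### Structured programs -/

/-! All machines are obtained from structured programs in three layers: pointer programs,
implemented by register programs, implemented by programs whose primitives are single machine steps.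
`run_bind_forward` and `run_bind_backward` carry runs from layer to layer, and
`compile_reach_accept` turns the lowest layer into a machine. Registers hold numbers below `(c + 2)
^ size (|x| + 1)`, a polynomial in `|x|`, each written in base `c + 2` on its own work tape of `size
(|x| + 1)` digits; `toTM_workBounded` gives the logarithmic space bound along every computation
path.

From machines to automata: a configuration of a log-space machine is a state, an input position and,
for each work tape, the two halves of its content read as numbers. Such a tuple of polynomially
bounded numbers is called a bank (`Coding.Rep.step`, `breach_of_preach`, `preach_of_breach`). There
are polynomially many banks, so a log-space transducer can run through all of them and print an
automaton whose states are banks (`logSpaceComputable_bankFA`). In the nondeterministic case every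
machine step becomes an ε-transition, and a state also records the letter under the advice head or
the guess that the advice is exhausted. A premature guess is harmless, because no letter can be read
after it (`AdvSys.accepts_of_acc`). A deterministic automaton has no ε-transitions, so its
transition for a letter jumps over the whole computation up to the next move of the advice head.
This computation is unique, and by the pigeonhole principle it either ends within as many steps as
there are reachable banks or never; the transducer can therefore run it with a step counter
(`iterate_eq_of_card`, `Stepper.acc_of_accepts`). This gives `logReduces_NRR` and `logReduces_RR`.

From automata to machines: given a reduction `f`, an advice machine has to run the automaton
described by `f x` on the advice without storing `f x`. A pointer into `f x` is represented by a
configuration of the transducer; to advance the pointer is to resume the transducer until it writes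
its next symbol (`adviceTM_of_pointer`). With finitely many pointers one checks the syntax of `f x`
and, in the deterministic case, that the automaton is deterministic. Then the description is scanned
cyclically, the current state being a pointer to an occurrence of its name. A matching transition is
taken or skipped by choice for a nondeterministic automaton; for a deterministic one the target is
unique and the transition is simply taken (`run_main_iff`). Inputs are rejected by not terminating
or by not using up the advice. -/

/-- Structured programs over primitive operations `P` and tests `T`. -/
inductive Prog (P T : Type)
  | skip
  | prim (a : P)
  | seq (p q : Prog P T)
  | ite (t : T) (p q : Prog P T)
  | loop (t : T) (p : Prog P T)
  | choice (p q : Prog P T)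

/-- An interpretation of primitive operations and tests on the states `σ`. -/
structure Sem (P T σ : Type) where
  prim : P → σ → σ → Prop
  test : T → σ → Prop

namespace Prog

variable {P T P' T' σ σ' : Type}

/-- `p.Run S s s'`: some terminating run of `p` leads from `s` to `s'`. -/
def Run (S : Sem P T σ) : Prog P T → σ → σ → Prop
  | skip, s, s' => s' = s
  | prim a, s, s' => S.prim a s s'
  | seq p q, s, s' => ∃ m, p.Run S s m ∧ q.Run S m s'
  | ite t p q, s, s' => (S.test t s ∧ p.Run S s s') ∨ (¬ S.test t s ∧ q.Run S s s')
  | loop t p, s, s' => ReflTransGen (fun a b => S.test t a ∧ p.Run S a b) s s' ∧ ¬ S.test t s'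
  | choice p q, s, s' => p.Run S s s' ∨ q.Run S s s'

/-- Programs without nondeterministic choice. -/
def Det : Prog P T → Prop
  | skip => True
  | prim _ => True
  | seq p q => p.Det ∧ q.Det
  | ite _ p q => p.Det ∧ q.Det
  | loop _ p => p.Det
  | choice _ _ => False

/-- All primitive operations of the program satisfy `Q`. -/
def AllPrims (Q : P → Prop) : Prog P T → Prop
  | skip => True
  | prim a => Q a
  | seq p q => p.AllPrims Q ∧ q.AllPrims Q
  | ite _ p q => p.AllPrims Q ∧ q.AllPrims Q
  | loop _ p => p.AllPrims Q
  | choice p q => p.AllPrims Q ∧ q.AllPrims Q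

/-- Replacement of the primitive operations by programs and of the tests by tests. -/
def bind (f : P → Prog P' T') (g : T → T') : Prog P T → Prog P' T'
  | skip => skip
  | prim a => f a
  | seq p q => seq (p.bind f g) (q.bind f g)
  | ite t p q => ite (g t) (p.bind f g) (q.bind f g)
  | loop t p => loop (g t) (p.bind f g)
  | choice p q => choice (p.bind f g) (q.bind f g)

/-- Sequential composition of a list of programs. -/
def seqs : List (Prog P T) → Prog P T
  | [] => skip
  | p :: l => seq p (seqs l)

section Semantics

variable {S : Sem P T σ}

theorem Run.ite_pos {t : T} {p q : Prog P T} {s s' : σ} (ht : S.test t s) (h : p.Run S s s') :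
    (ite t p q).Run S s s' := Or.inl ⟨ht, h⟩

theorem Run.ite_neg {t : T} {p q : Prog P T} {s s' : σ} (ht : ¬ S.test t s) (h : q.Run S s s') :
    (ite t p q).Run S s s' := Or.inr ⟨ht, h⟩

theorem Run.loop_done {t : T} {p : Prog P T} {s : σ} (ht : ¬ S.test t s) :
    (loop t p).Run S s s := ⟨.refl, ht⟩

theorem Run.loop_cons {t : T} {p : Prog P T} {s m s' : σ} (ht : S.test t s) (h : p.Run S s m)
    (h' : (loop t p).Run S m s') : (loop t p).Run S s s' := ⟨.head ⟨ht, h⟩ h'.1, h'.2⟩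

/-- Partial correctness of loops: a property preserved by the body holds at the exit. -/
theorem Run.loop_inv {t : T} {p : Prog P T} {s s' : σ} (I : σ → Prop)
    (hI : ∀ a b, I a → S.test t a → p.Run S a b → I b) (h : (loop t p).Run S s s') (hs : I s) :
    I s' ∧ ¬ S.test t s' := by
  refine ⟨?_, h.2⟩
  obtain ⟨h, -⟩ := h
  induction h with
  | refl => exact hs
  | tail _ hb ih => exact hI _ _ ih hb.1 hb.2

/-- Two traces of a loop agree step by step, and neither can stop earlier than the other, since the
test fails at the exit and nowhere before. -/
theorem Det.run_unique (hS : ∀ a s s₁ s₂, S.prim a s s₁ → S.prim a s s₂ → s₁ = s₂) :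
    ∀ {p : Prog P T}, p.Det → ∀ {s s₁ s₂ : σ}, p.Run S s s₁ → p.Run S s s₂ → s₁ = s₂
  | skip, _, _, _, _, h₁, h₂ => h₁.trans h₂.symm
  | prim a, _, _, _, _, h₁, h₂ => hS a _ _ _ h₁ h₂
  | seq p q, hd, s, s₁, s₂, ⟨m₁, h₁, h₁'⟩, ⟨m₂, h₂, h₂'⟩ => by
    obtain rfl := run_unique hS hd.1 h₁ h₂
    exact run_unique hS hd.2 h₁' h₂'
  | ite t p q, hd, s, s₁, s₂, h₁, h₂ => by
    rcases h₁ with ⟨t₁, h₁⟩ | ⟨t₁, h₁⟩ <;> rcases h₂ with ⟨t₂, h₂⟩ | ⟨t₂, h₂⟩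
    · exact run_unique hS hd.1 h₁ h₂
    · exact absurd t₁ t₂
    · exact absurd t₂ t₁
    · exact run_unique hS hd.2 h₁ h₂
  | loop t p, hd, s, s₁, s₂, ⟨h₁, e₁⟩, ⟨h₂, e₂⟩ => by
    induction h₁ using ReflTransGen.head_induction_on with
    | refl =>
      rcases h₂.cases_head with rfl | ⟨m, hm, _⟩
      · rfl
      · exact absurd hm.1 e₁
    | head ha hb ih =>
      rcases h₂.cases_head with rfl | ⟨m, hm, hm'⟩
      · exact absurd ha.1 e₂
      · obtain rfl := run_unique (p := p) hS hd ha.2 hm.2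
        exact ih hm'

/-- Forward simulation. -/
theorem run_bind_forward {S' : Sem P' T' σ'} {R : σ → σ' → Prop} {f : P → Prog P' T'} {g : T → T'}
    (hf : ∀ a s s' t, S.prim a s s' → R s t → ∃ t', (f a).Run S' t t' ∧ R s' t')
    (hg : ∀ b s t, R s t → (S.test b s ↔ S'.test (g b) t)) :
    ∀ {p : Prog P T} {s s' : σ} {t : σ'}, p.Run S s s' → R s t →
      ∃ t', (p.bind f g).Run S' t t' ∧ R s' t'
  | skip, s, s', t, h, hR => ⟨t, rfl, by obtain rfl := h; exact hR⟩
  | prim a, s, s', t, h, hR => hf a s s' t h hR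
  | seq p q, s, s', t, ⟨m, h, h'⟩, hR => by
    obtain ⟨u, hu, hR'⟩ := run_bind_forward hf hg h hR
    obtain ⟨v, hv, hR''⟩ := run_bind_forward hf hg h' hR'
    exact ⟨v, ⟨u, hu, hv⟩, hR''⟩
  | ite b p q, s, s', t, h, hR => by
    rcases h with ⟨hb, h⟩ | ⟨hb, h⟩ <;> obtain ⟨u, hu, hR'⟩ := run_bind_forward hf hg h hR
    · exact ⟨u, Or.inl ⟨(hg _ _ _ hR).1 hb, hu⟩, hR'⟩
    · exact ⟨u, Or.inr ⟨fun h => hb ((hg _ _ _ hR).2 h), hu⟩, hR'⟩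
  | loop b p, s, s', t, ⟨h, e⟩, hR => by
    have : ∃ t', ReflTransGen (fun a c => S'.test (g b) a ∧ (p.bind f g).Run S' a c) t t' ∧
        R s' t' := by
      clear e
      induction h with
      | refl => exact ⟨t, .refl, hR⟩
      | tail _ hm ih =>
        obtain ⟨u, hu, hR'⟩ := ih
        obtain ⟨v, hv, hR''⟩ := run_bind_forward hf hg hm.2 hR'
        exact ⟨v, hu.tail ⟨(hg _ _ _ hR').1 hm.1, hv⟩, hR''⟩
    obtain ⟨t', h', hR'⟩ := this
    exact ⟨t', ⟨h', fun h => e ((hg _ _ _ hR').2 h)⟩, hR'⟩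
  | choice p q, s, s', t, h, hR => by
    rcases h with h | h <;> obtain ⟨u, hu, hR'⟩ := run_bind_forward hf hg h hR
    · exact ⟨u, Or.inl hu, hR'⟩
    · exact ⟨u, Or.inr hu, hR'⟩

/-- Backward simulation. -/
theorem run_bind_backward {S' : Sem P' T' σ'} {R : σ → σ' → Prop} {f : P → Prog P' T'}
    {g : T → T'}
    (hf : ∀ a s t t', (f a).Run S' t t' → R s t → ∃ s', S.prim a s s' ∧ R s' t')
    (hg : ∀ b s t, R s t → (S.test b s ↔ S'.test (g b) t)) :
    ∀ {p : Prog P T} {s : σ} {t t' : σ'}, (p.bind f g).Run S' t t' → R s t →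
      ∃ s', p.Run S s s' ∧ R s' t'
  | skip, s, t, t', h, hR => ⟨s, rfl, by obtain rfl := h; exact hR⟩
  | prim a, s, t, t', h, hR => hf a s t t' h hR
  | seq p q, s, t, t', ⟨m, h, h'⟩, hR => by
    obtain ⟨u, hu, hR'⟩ := run_bind_backward hf hg h hR
    obtain ⟨v, hv, hR''⟩ := run_bind_backward hf hg h' hR'
    exact ⟨v, ⟨u, hu, hv⟩, hR''⟩
  | ite b p q, s, t, t', h, hR => by
    rcases h with ⟨hb, h⟩ | ⟨hb, h⟩ <;> obtain ⟨u, hu, hR'⟩ := run_bind_backward hf hg h hR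
    · exact ⟨u, Or.inl ⟨(hg _ _ _ hR).2 hb, hu⟩, hR'⟩
    · exact ⟨u, Or.inr ⟨fun h => hb ((hg _ _ _ hR).1 h), hu⟩, hR'⟩
  | loop b p, s, t, t', ⟨h, e⟩, hR => by
    have : ∃ s', ReflTransGen (fun a c => S.test b a ∧ p.Run S a c) s s' ∧ R s' t' := by
      clear e
      induction h with
      | refl => exact ⟨s, .refl, hR⟩
      | tail _ hm ih =>
        obtain ⟨u, hu, hR'⟩ := ih
        obtain ⟨v, hv, hR''⟩ := run_bind_backward hf hg hm.2 hR'
        exact ⟨v, hu.tail ⟨(hg _ _ _ hR').2 hm.1, hv⟩, hR''⟩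
    obtain ⟨s', h', hR'⟩ := this
    exact ⟨s', ⟨h', fun h => e ((hg _ _ _ hR').1 h)⟩, hR'⟩
  | choice p q, s, t, t', h, hR => by
    rcases h with h | h <;> obtain ⟨u, hu, hR'⟩ := run_bind_backward hf hg h hR
    · exact ⟨u, Or.inl hu, hR'⟩
    · exact ⟨u, Or.inr hu, hR'⟩

end Semantics

theorem det_bind {f : P → Prog P' T'} {g : T → T'} (hf : ∀ a, (f a).Det) :
    ∀ {p : Prog P T}, p.Det → (p.bind f g).Det
  | skip, _ => trivial
  | prim a, _ => hf a
  | seq _ _, h => ⟨det_bind hf h.1, det_bind hf h.2⟩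
  | ite _ _ _, h => ⟨det_bind hf h.1, det_bind hf h.2⟩
  | loop _ p, h => det_bind (p := p) hf h

theorem allPrims_bind {Q : P' → Prop} {f : P → Prog P' T'} {g : T → T'}
    (hf : ∀ a, (f a).AllPrims Q) : ∀ p : Prog P T, (p.bind f g).AllPrims Q
  | skip => trivial
  | prim a => hf a
  | seq p q => ⟨allPrims_bind hf p, allPrims_bind hf q⟩
  | ite _ p q => ⟨allPrims_bind hf p, allPrims_bind hf q⟩
  | loop _ p => allPrims_bind hf p
  | choice p q => ⟨allPrims_bind hf p, allPrims_bind hf q⟩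

theorem det_seqs {l : List (Prog P T)} (h : ∀ p ∈ l, p.Det) : (seqs l).Det := by
  induction l with
  | nil => trivial
  | cons p l ih => exact ⟨h p (by simp), ih fun q hq => h q (by simp [hq])⟩

/-- The programs that may remain to be executed after some steps of a program. -/
def residuals : Prog P T → Set (Prog P T)
  | skip => {skip}
  | prim a => {prim a, skip}
  | seq p q => (fun p' => seq p' q) '' p.residuals ∪ q.residuals
  | ite t p q => {ite t p q} ∪ p.residuals ∪ q.residuals
  | loop t p => {loop t p, skip} ∪ (fun p' => seq p' (loop t p)) '' p.residuals
  | choice p q => {choice p q} ∪ p.residuals ∪ q.residuals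

theorem self_mem_residuals : ∀ p : Prog P T, p ∈ p.residuals
  | skip => by simp [residuals]
  | prim _ => by simp [residuals]
  | seq p q => Or.inl ⟨p, self_mem_residuals p, rfl⟩
  | ite _ p q => by simp [residuals]
  | loop _ p => by simp [residuals]
  | choice p q => by simp [residuals]

/-- Residuals are the control states of the compiled machine, whose number has to be finite. -/
theorem finite_residuals : ∀ p : Prog P T, p.residuals.Finite
  | skip => Set.finite_singleton _
  | prim _ => (Set.finite_singleton _).insert _
  | seq p q => ((finite_residuals p).image _).union (finite_residuals q)
  | ite _ p q => ((Set.finite_singleton _).union (finite_residuals p)).union (finite_residuals q)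
  | loop _ p => ((Set.finite_singleton _).insert _).union ((finite_residuals p).image _)
  | choice p q => ((Set.finite_singleton _).union (finite_residuals p)).union (finite_residuals q)

end Prog

/-! ### Programs with one Turing machine step per primitive operation -/

/-- What a machine does with its additional one-way tape, whose content is described by `E`: it
observes `obs e` and performs actions, one of which is idle. -/
structure Port (Obs Act E : Type) where
  obs : E → Obs
  app : Act → E → E
  idle : Act
  app_idle : ∀ e, app idle e = e

/-- The one-way write-only output tape. -/
def outPort (B : Type) : Port Unit (Option B) (List B) where
  obs _ := ()
  app b e := e ++ b.toList
  idle := none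
  app_idle e := by simp

/-- The one-way read-only advice tape. -/
def advPort (Γ : Type) : Port (Option Γ) Bool (List Γ) where
  obs e := e.head?
  app a e := if a then e.tail else e
  idle := false
  app_idle e := by simp

/-- What a machine sees, apart from the program it executes. -/
structure View (V A W : Type) (k : ℕ) (Obs : Type) where
  v : V
  cell : InputCell A
  sym : Fin k → W
  obs : Obs

/-- The state of a machine apart from the program it executes: a finite memory, the input head, the
work tapes with their heads, and the additional one-way tape. -/
@[ext]
structure LState (V W : Type) (k : ℕ) (E : Type) where
  v : V
  pos : ℕ
  tape : Fin k → ℕ → W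
  head : Fin k → ℕ
  port : E

/-- Programs whose primitive operations are single machine steps. -/
abbrev LProg (V A W : Type) (k : ℕ) (Obs Act : Type) :=
  Prog (View V A W k Obs → Instr V W k Act) (View V A W k Obs → Prop)

section Compile

variable {A V W Obs Act E : Type} {k : ℕ} (π : Port Obs Act E) (x : List A)

def LState.view (s : LState V W k E) : View V A W k Obs :=
  ⟨s.v, readInput x s.pos, fun i => s.tape i (s.head i), π.obs s.port⟩

def LState.apply (s : LState V W k E) (m : Instr V W k Act) : LState V W k E where
  v := m.next
  pos := m.inputDir.moveInput x.length s.pos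
  tape := fun i => Function.update (s.tape i) (s.head i) (m.write i)
  head := fun i => (m.workDir i).moveWork (s.head i)
  port := π.app m.act s.port

/-- The instruction that changes nothing. -/
def nopInstr (w : View V A W k Obs) : Instr V W k Act :=
  ⟨w.v, w.sym, fun _ => .stay, .stay, π.idle⟩

theorem LState.apply_nop (s : LState V W k E) : s.apply π x (nopInstr π (s.view π x)) = s := by
  ext <;> simp [LState.apply, nopInstr, LState.view, Dir.moveInput, Dir.moveWork, π.app_idle]

/-- The semantics of single steps, restricted to steps after which `Bd` holds. -/
def LSem (Bd : LState V W k E → Prop) :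
    Sem (View V A W k Obs → Instr V W k Act) (View V A W k Obs → Prop) (LState V W k E) where
  prim a s s' := s' = s.apply π x (a (s.view π x)) ∧ Bd s'
  test t s := t (s.view π x)

/-- Small steps: the remaining program and the executed instruction. -/
inductive Delta (w : View V A W k Obs) :
    LProg V A W k Obs Act → LProg V A W k Obs Act → Instr V W k Act → Prop
  | prim (a) : Delta w (.prim a) .skip (a w)
  | seq {p p' m} (q) : Delta w p p' m → Delta w (.seq p q) (.seq p' q) m
  | seq_skip (q) : Delta w (.seq .skip q) q (nopInstr π w)
  | ite_pos {t} (p q) : t w → Delta w (.ite t p q) p (nopInstr π w)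
  | ite_neg {t} (p q) : ¬ t w → Delta w (.ite t p q) q (nopInstr π w)
  | loop_pos {t} (p) : t w → Delta w (.loop t p) (.seq p (.loop t p)) (nopInstr π w)
  | loop_neg {t} (p) : ¬ t w → Delta w (.loop t p) .skip (nopInstr π w)
  | choice_left (p q) : Delta w (.choice p q) p (nopInstr π w)
  | choice_right (p q) : Delta w (.choice p q) q (nopInstr π w)

variable {π x}

/-- Execution never leaves the finite set of residuals: the body of a loop is always followed by the
same loop, so unfolding it creates no further programs. -/
theorem Delta.mem_residuals {w : View V A W k Obs} {p p' : LProg V A W k Obs Act}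
    {m : Instr V W k Act} (h : Delta π w p p' m) :
    ∀ {P : LProg V A W k Obs Act}, p ∈ P.residuals → p' ∈ P.residuals
  | .skip, hp => by cases hp; cases h
  | .prim a, hp => by
    rcases hp with rfl | rfl
    · cases h; simp [Prog.residuals]
    · cases h
  | .seq p₁ q, hp => by
    rcases hp with ⟨p₂, hp, rfl⟩ | hp
    · cases h with
      | seq _ h => exact Or.inl ⟨_, h.mem_residuals hp, rfl⟩
      | seq_skip => exact Or.inr (Prog.self_mem_residuals _)
    · exact Or.inr (h.mem_residuals hp)
  | .ite t p₁ q, hp => by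
    rcases hp with (rfl | hp) | hp
    · cases h
      · exact Or.inl (Or.inr (Prog.self_mem_residuals _))
      · exact Or.inr (Prog.self_mem_residuals _)
    · exact Or.inl (Or.inr (h.mem_residuals hp))
    · exact Or.inr (h.mem_residuals hp)
  | .loop t p₁, hp => by
    rcases hp with (rfl | rfl) | ⟨p₂, hp, rfl⟩
    · cases h
      · exact Or.inr ⟨_, Prog.self_mem_residuals _, rfl⟩
      · exact Or.inl (Or.inr rfl)
    · cases h
    · cases h with
      | seq _ h => exact Or.inr ⟨_, h.mem_residuals hp, rfl⟩
      | seq_skip => exact Or.inl (Or.inl rfl)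
  | .choice p₁ q, hp => by
    rcases hp with (rfl | hp) | hp
    · cases h
      · exact Or.inl (Or.inr (Prog.self_mem_residuals _))
      · exact Or.inr (Prog.self_mem_residuals _)
    · exact Or.inl (Or.inr (h.mem_residuals hp))
    · exact Or.inr (h.mem_residuals hp)

theorem Delta.det {w : View V A W k Obs} {p : LProg V A W k Obs Act} (hp : p.Det) :
    ∀ {p₁ p₂ : LProg V A W k Obs Act} {m₁ m₂ : Instr V W k Act}, Delta π w p p₁ m₁ →
      Delta π w p p₂ m₂ → p₁ = p₂ ∧ m₁ = m₂ := by
  induction p with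
  | skip => intro _ _ _ _ h; cases h
  | prim a => intro _ _ _ _ h h'; cases h; cases h'; exact ⟨rfl, rfl⟩
  | seq p q ih _ =>
    intro _ _ _ _ h h'
    cases h with
    | seq _ h =>
      cases h' with
      | seq _ h' => obtain ⟨rfl, rfl⟩ := ih hp.1 h h'; exact ⟨rfl, rfl⟩
      | seq_skip => cases h
    | seq_skip =>
      cases h' with
      | seq _ h' => cases h'
      | seq_skip => exact ⟨rfl, rfl⟩
  | ite t p q =>
    intro _ _ _ _ h h'
    cases h <;> cases h' <;> first | exact ⟨rfl, rfl⟩ | contradiction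
  | loop t p =>
    intro _ _ _ _ h h'
    cases h <;> cases h' <;> first | exact ⟨rfl, rfl⟩ | contradiction
  | choice p q => exact hp.elim

theorem Delta.det_residual {w : View V A W k Obs} {p p' : LProg V A W k Obs Act}
    {m : Instr V W k Act} (h : Delta π w p p' m) : p.Det → p'.Det := by
  induction h with
  | prim => intro _; trivial
  | seq q _ ih => exact fun h => ⟨ih h.1, h.2⟩
  | seq_skip => exact fun h => h.2
  | ite_pos => exact fun h => h.1
  | ite_neg => exact fun h => h.2
  | loop_pos => exact fun h => ⟨h, h⟩
  | loop_neg => intro _; trivial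
  | choice_left => exact fun h => h.elim
  | choice_right => exact fun h => h.elim

theorem Delta.allPrims {w : View V A W k Obs} {p p' : LProg V A W k Obs Act}
    {m : Instr V W k Act} {Q} (h : Delta π w p p' m) : p.AllPrims Q → p'.AllPrims Q := by
  induction h with
  | prim => intro _; trivial
  | seq q _ ih => exact fun h => ⟨ih h.1, h.2⟩
  | seq_skip => exact fun h => h.2
  | ite_pos => exact fun h => h.1
  | ite_neg => exact fun h => h.2
  | loop_pos => exact fun h => ⟨h, h⟩
  | loop_neg => intro _; trivial
  | choice_left => exact fun h => h.1
  | choice_right => exact fun h => h.2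

variable (π x)

/-- Small steps on pairs (program, state). -/
def SStep (a b : LProg V A W k Obs Act × LState V W k E) : Prop :=
  ∃ m, Delta π (a.2.view π x) a.1 b.1 m ∧ b.2 = a.2.apply π x m

variable {π x}

/-- A run of the remaining program can be preceded by the step that led to it; `run_of_sstep`
iterates this from the end. Control steps execute `nopInstr` and so do not change the state. -/
theorem SStep.run {a b : LProg V A W k Obs Act × LState V W k E} (h : SStep π x a b) :
    ∀ {s}, b.1.Run (LSem π x fun _ => True) b.2 s → a.1.Run (LSem π x fun _ => True) a.2 s := by
  obtain ⟨p, s₀⟩ := a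
  obtain ⟨p', s₁⟩ := b
  obtain ⟨m, h, hs⟩ := h
  simp only at h hs
  generalize hw : s₀.view π x = w at h
  subst hs
  induction h with
  | prim a => subst hw; intro s h; exact ⟨h, trivial⟩
  | seq q h ih => rintro s ⟨m, h₁, h₂⟩; exact ⟨m, ih h₁, h₂⟩
  | seq_skip q =>
    subst hw; intro s h; simp only [LState.apply_nop] at h; exact ⟨s₀, rfl, h⟩
  | ite_pos p q ht =>
    subst hw; intro s h; simp only [LState.apply_nop] at h; exact Or.inl ⟨ht, h⟩
  | ite_neg p q ht =>
    subst hw; intro s h; simp only [LState.apply_nop] at h; exact Or.inr ⟨ht, h⟩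
  | loop_pos p ht =>
    subst hw
    rintro s ⟨m, h₁, h₂⟩
    simp only [LState.apply_nop] at h₁
    exact Prog.Run.loop_cons ht h₁ h₂
  | loop_neg p ht =>
    subst hw; intro s h; simp only [LState.apply_nop] at h; obtain rfl := h
    exact Prog.Run.loop_done ht
  | choice_left p q =>
    subst hw; intro s h; simp only [LState.apply_nop] at h; exact Or.inl h
  | choice_right p q =>
    subst hw; intro s h; simp only [LState.apply_nop] at h; exact Or.inr h

theorem run_of_sstep {p : LProg V A W k Obs Act} {s s' : LState V W k E}
    (h : ReflTransGen (SStep π x) (p, s) (.skip, s')) :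
    p.Run (LSem π x fun _ => True) s s' := by
  generalize ha : (p, s) = a at h
  have key : a.1.Run (LSem π x fun _ => True) a.2 s' := by
    clear ha
    induction h using ReflTransGen.head_induction_on with
    | refl => rfl
    | head h _ ih => exact h.run ih
  subst ha
  exact key

/-- Small steps within the states that satisfy `Bd`. -/
def BStep (π : Port Obs Act E) (x : List A) (Bd : LState V W k E → Prop)
    (a b : LProg V A W k Obs Act × LState V W k E) : Prop := SStep π x a b ∧ Bd b.2

theorem BStep.seq {Bd : LState V W k E → Prop} {a b : LProg V A W k Obs Act × LState V W k E}
    (q) (h : ReflTransGen (BStep π x Bd) a b) :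
    ReflTransGen (BStep π x Bd) (.seq a.1 q, a.2) (.seq b.1 q, b.2) := by
  induction h with
  | refl => exact .refl
  | tail _ h ih =>
    obtain ⟨⟨m, h, h'⟩, hb⟩ := h
    exact ih.tail ⟨⟨m, .seq q h, h'⟩, hb⟩

theorem BStep.nop {Bd : LState V W k E → Prop} {p p' : LProg V A W k Obs Act}
    {s : LState V W k E} (hs : Bd s) (h : Delta π (s.view π x) p p' (nopInstr π (s.view π x))) :
    BStep π x Bd (p, s) (p', s) :=
  ⟨⟨_, h, (LState.apply_nop π x s).symm⟩, hs⟩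

theorem bd_of_run {Bd : LState V W k E → Prop} : ∀ {p : LProg V A W k Obs Act}
    {s s' : LState V W k E}, p.Run (LSem π x Bd) s s' → Bd s → Bd s'
  | .skip, s, s', h, hs => by obtain rfl := h; exact hs
  | .prim a, s, s', h, _ => h.2
  | .seq p q, s, s', ⟨m, h, h'⟩, hs => bd_of_run h' (bd_of_run h hs)
  | .ite t p q, s, s', h, hs => by
    rcases h with ⟨_, h⟩ | ⟨_, h⟩ <;> exact bd_of_run h hs
  | .loop t p, s, s', ⟨h, e⟩, hs => by
    clear e
    induction h with
    | refl => exact hs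
    | tail _ hb ih => exact bd_of_run hb.2 ih
  | .choice p q, s, s', h, hs => by
    rcases h with h | h <;> exact bd_of_run h hs

/-- The bound is checked by the semantics after each primitive, and control steps leave the state
unchanged; so one big-step run bounds all intermediate states. -/
theorem bstep_of_run {Bd : LState V W k E → Prop} : ∀ {p : LProg V A W k Obs Act}
    {s s' : LState V W k E}, p.Run (LSem π x Bd) s s' → Bd s →
      ReflTransGen (BStep π x Bd) (p, s) (.skip, s')
  | .skip, s, s', h, _ => by obtain rfl := h; exact .refl
  | .prim a, s, s', h, _ => .single ⟨⟨_, .prim a, h.1⟩, h.2⟩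
  | .seq p q, s, s', ⟨m, h, h'⟩, hs =>
    ((BStep.seq q (bstep_of_run h hs)).tail
      (BStep.nop (bd_of_run h hs) (.seq_skip q))).trans (bstep_of_run h' (bd_of_run h hs))
  | .ite t p q, s, s', h, hs => by
    rcases h with ⟨ht, h⟩ | ⟨ht, h⟩
    · exact .head (BStep.nop hs (.ite_pos p q ht)) (bstep_of_run h hs)
    · exact .head (BStep.nop hs (.ite_neg p q ht)) (bstep_of_run h hs)
  | .loop t p, s, s', ⟨h, e⟩, hs => by
    induction h using ReflTransGen.head_induction_on with
    | refl => exact .single (BStep.nop hs (.loop_neg p e))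
    | head h _ ih =>
      have hb := bd_of_run h.2 hs
      exact .head (BStep.nop hs (.loop_pos p h.1))
        (((BStep.seq (.loop t p) (bstep_of_run h.2 hs)).tail
          (BStep.nop hb (.seq_skip _))).trans (ih hb))
  | .choice p q, s, s', h, hs => by
    rcases h with h | h
    · exact .head (BStep.nop hs (.choice_left p q)) (bstep_of_run h hs)
    · exact .head (BStep.nop hs (.choice_right p q)) (bstep_of_run h hs)

theorem sstep_of_run {p : LProg V A W k Obs Act} {s s' : LState V W k E}
    (h : p.Run (LSem π x fun _ => True) s s') : ReflTransGen (SStep π x) (p, s) (.skip, s') :=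
  ReflTransGen.mono (fun _ _ h => h.1) _ _ (bstep_of_run h trivial)

/-- A state reached by a deterministic program that has a run within `Bd` satisfies `Bd`. -/
theorem bd_of_sstep {Bd : LState V W k E → Prop} {p p' : LProg V A W k Obs Act} (hp : p.Det)
    {s s' t : LState V W k E} (h : p.Run (LSem π x Bd) s s') (hs : Bd s)
    (h' : ReflTransGen (SStep π x) (p, s) (p', t)) : Bd t := by
  have h := bstep_of_run h hs
  generalize ha : (p, s) = a at h h'
  have hd : a.1.Det := by rw [← ha]; exact hp
  have hb : Bd a.2 := by rw [← ha]; exact hs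
  clear ha hs hp
  generalize hc : (p', t) = c at h'
  suffices Bd c.2 by rw [← hc] at this; exact this
  clear hc
  induction h' using ReflTransGen.head_induction_on with
  | refl => exact hb
  | head h₁ _ ih =>
    -- By determinism the given computation and the bounded one take the same step; the bounded one
    -- cannot have ended, because `skip` has no successor.
    rcases h.cases_head with rfl | ⟨b, h₂, h₂'⟩
    · obtain ⟨m, h₁, -⟩ := h₁
      cases h₁
    · obtain ⟨m₁, d₁, e₁⟩ := h₁
      obtain ⟨⟨m₂, d₂, e₂⟩, hb'⟩ := h₂
      obtain ⟨hq, hm⟩ := d₁.det hd d₂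
      have : _ = b := Prod.ext hq (by rw [e₁, e₂, hm])
      subst this
      exact ih h₂' (d₁.det_residual hd) hb'

/-- Separates the initialization from the main program in the space analysis: the first component is
left only through `seq_skip`, hence after a complete run of `p`. -/
theorem sstep_seq {p q : LProg V A W k Obs Act} {s : LState V W k E} {c}
    (h : ReflTransGen (SStep π x) (.seq p q, s) c) :
    (∃ p', c.1 = .seq p' q ∧ ReflTransGen (SStep π x) (p, s) (p', c.2)) ∨
      ∃ m, p.Run (LSem π x fun _ => True) s m ∧ ReflTransGen (SStep π x) (q, m) c := by
  induction h with
  | refl => exact Or.inl ⟨p, rfl, .refl⟩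
  | @tail b c _ h ih =>
    rcases ih with ⟨p', hb, h'⟩ | ⟨m, hm, h'⟩
    · obtain ⟨b₁, b₂⟩ := b
      obtain ⟨c₁, c₂⟩ := c
      obtain ⟨m, h, e⟩ := h
      simp only at hb h e h'
      subst hb
      cases h with
      | seq _ h => exact Or.inl ⟨_, rfl, h'.tail ⟨m, h, e⟩⟩
      | seq_skip =>
        rw [LState.apply_nop] at e
        subst e
        exact Or.inr ⟨_, run_of_sstep h', .refl⟩
    · exact Or.inr ⟨m, hm, h'.tail h⟩

/-- The machine that executes a program. -/
def compile (π : Port Obs Act E) [Finite V] [Finite W] (blank : W) (v₀ : V)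
    (P : LProg V A W k Obs Act) : TM A Obs Act where
  State := P.residuals × V
  finiteState := by
    have := P.finite_residuals.to_subtype
    infer_instance
  Work := W
  finiteWork := ‹_›
  blank := blank
  k := k
  start := (⟨P, P.self_mem_residuals⟩, v₀)
  accept := {q | q.1.1 = .skip}
  trans q c w o := {m | Delta π ⟨q.2, c, w, o⟩ q.1.1 m.next.1.1
    ⟨m.next.2, m.write, m.workDir, m.inputDir, m.act⟩}

theorem compile_deterministic [Finite V] [Finite W] {blank : W} {v₀ : V}
    {P : LProg V A W k Obs Act} (hP : P.Det) : (compile π blank v₀ P).Deterministic := by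
  have hdet : ∀ P : LProg V A W k Obs Act, P.Det → ∀ q ∈ P.residuals, q.Det := by
    intro P hP
    induction P with
    | skip => rintro q rfl; trivial
    | prim a => rintro q (rfl | rfl) <;> trivial
    | seq p q ih₁ ih₂ =>
      rintro _ (⟨p', hp, rfl⟩ | h)
      · exact ⟨ih₁ hP.1 _ hp, hP.2⟩
      · exact ih₂ hP.2 _ h
    | ite t p q ih₁ ih₂ =>
      rintro _ ((rfl | h) | h)
      · exact hP
      · exact ih₁ hP.1 _ h
      · exact ih₂ hP.2 _ h
    | loop t p ih =>
      rintro _ ((rfl | rfl) | ⟨p', hp, rfl⟩)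
      · exact hP
      · trivial
      · exact ⟨ih hP _ hp, hP⟩
    | choice p q => exact hP.elim
  rintro ⟨⟨q, hq⟩, v⟩ c w o ⟨⟨⟨q₁, h₁⟩, v₁⟩, w₁, d₁, i₁, a₁⟩ hm₁ ⟨⟨⟨q₂, h₂⟩, v₂⟩, w₂, d₂, i₂, a₂⟩ hm₂
  obtain ⟨h, h'⟩ := Delta.det (hdet P hP q hq) hm₁ hm₂
  cases h
  cases h'
  rfl

section

variable [Finite V] [Finite W] {blank : W} {v₀ : V} {P : LProg V A W k Obs Act}

/-- The program and the state that a configuration of the compiled machine stands for. -/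
def ofCfg (c : (compile π blank v₀ P).Cfg × E) : LProg V A W k Obs Act × LState V W k E :=
  (c.1.state.1.1, ⟨c.1.state.2, c.1.inputHead, c.1.tape, c.1.head, c.2⟩)

/-- Moves of a machine with an additional one-way tape. -/
def PMove (π : Port Obs Act E) (M : TM A Obs Act) (x : List A) (p q : M.Cfg × E) : Prop :=
  ∃ a : Act, M.Step x p.1 (π.obs p.2) a q.1 ∧ q.2 = π.app a p.2

theorem sstep_of_pmove {c d : (compile π blank v₀ P).Cfg × E}
    (h : PMove π (compile π blank v₀ P) x c d) : SStep π x (ofCfg c) (ofCfg d) := by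
  obtain ⟨a, ⟨m, hm, rfl, hc⟩, hd⟩ := h
  refine ⟨⟨m.next.2, m.write, m.workDir, m.inputDir, m.act⟩, ?_, ?_⟩
  · simp only [ofCfg, hc]
    exact hm
  · simp only [ofCfg, hc, hd]
    rfl

theorem pmove_of_sstep {c : (compile π blank v₀ P).Cfg × E} {b}
    (h : SStep π x (ofCfg c) b) :
    ∃ d, ofCfg d = b ∧ PMove π (compile π blank v₀ P) x c d := by
  obtain ⟨p, s⟩ := b
  obtain ⟨m, h, hs⟩ := h
  refine ⟨((compile π blank v₀ P).exec x c.1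
    ⟨(⟨p, h.mem_residuals c.1.state.1.2⟩, m.next), m.write, m.workDir, m.inputDir, m.act⟩,
      π.app m.act c.2), ?_, m.act, ⟨_, ?_, rfl, rfl⟩, rfl⟩
  · exact Prod.ext rfl hs.symm
  · exact h

theorem sstep_of_preach {c d : (compile π blank v₀ P).Cfg × E}
    (h : ReflTransGen (PMove π (compile π blank v₀ P) x) c d) :
    ReflTransGen (SStep π x) (ofCfg c) (ofCfg d) :=
  h.lift _ fun _ _ => sstep_of_pmove

theorem preach_of_sstep {c : (compile π blank v₀ P).Cfg × E} {b}
    (h : ReflTransGen (SStep π x) (ofCfg c) b) :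
    ∃ d, ofCfg d = b ∧ ReflTransGen (PMove π (compile π blank v₀ P) x) c d := by
  induction h with
  | refl => exact ⟨c, rfl, .refl⟩
  | tail _ h ih =>
    obtain ⟨d, rfl, hd⟩ := ih
    obtain ⟨d', rfl, hd'⟩ := pmove_of_sstep h
    exact ⟨d', rfl, hd.tail hd'⟩

/-- The initial state. -/
def LState.init (k : ℕ) (blank : W) (v₀ : V) (e : E) : LState V W k E :=
  ⟨v₀, 0, fun _ _ => blank, fun _ => 0, e⟩

theorem ofCfg_init (e : E) :
    ofCfg ((compile π blank v₀ P).init, e) = (P, LState.init k blank v₀ e) := rfl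

theorem compile_reach_accept {e e' : E} :
    (∃ c, ReflTransGen (PMove π (compile π blank v₀ P) x) ((compile π blank v₀ P).init, e)
      (c, e') ∧ c.state ∈ (compile π blank v₀ P).accept) ↔
    ∃ s, P.Run (LSem π x fun _ => True) (LState.init k blank v₀ e) s ∧ s.port = e' := by
  constructor
  · rintro ⟨c, h, hc⟩
    have h := sstep_of_preach h
    rw [ofCfg_init] at h
    obtain ⟨⟨q, v⟩, p, t, hd⟩ := c
    refine ⟨⟨v, p, t, hd, e'⟩, run_of_sstep ?_, rfl⟩
    have hc : q.1 = .skip := hc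
    rw [← hc]
    exact h
  · rintro ⟨s, h, rfl⟩
    have h := sstep_of_run h
    rw [← ofCfg_init (π := π) (P := P)] at h
    obtain ⟨d, hd, h₂⟩ := preach_of_sstep h
    obtain ⟨c, e'⟩ := d
    obtain ⟨h₁, rfl⟩ := Prod.mk.inj hd
    exact ⟨c, h₂, h₁⟩

end

end Compile

end RegReal

/-! ### Positional arithmetic on work tapes -/

namespace RegReal

open Relation Prog

/-! ### Counters on work tapes -/

/-- The work alphabet: a marker in cell `0`, which also tells whether the number on the tape is zero,
digits, and a marker behind the last digit. -/
inductive Sym (c : ℕ)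
  | blank
  | home (z : Bool)
  | digit (d : Fin (c + 2))
  | endMark

namespace Sym

variable {c : ℕ}

instance : Finite (Sym c) := by
  refine Finite.of_surjective (α := Option (Option (Bool ⊕ Fin (c + 2))))
    (fun
      | none => blank
      | some none => endMark
      | some (some (.inl z)) => home z
      | some (some (.inr d)) => digit d) ?_
  rintro (_ | z | d | _)
  · exact ⟨none, rfl⟩
  · exact ⟨some (some (.inl z)), rfl⟩
  · exact ⟨some (some (.inr d)), rfl⟩
  · exact ⟨some none, rfl⟩

/-- The digit with value `d`. -/
def dig (d : ℕ) : Sym c := digit (Fin.ofNat (c + 2) d)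

theorem dig_inj {d e : ℕ} (hd : d < c + 2) (he : e < c + 2) :
    (dig d : Sym c) = dig e ↔ d = e := by
  simp only [dig, digit.injEq, Fin.ext_iff, Fin.val_ofNat, Nat.mod_eq_of_lt hd,
    Nat.mod_eq_of_lt he]

/-- Change of a digit; other symbols are kept. -/
def mapDigit (f : ℕ → ℕ) : Sym c → Sym c
  | digit d => dig (f d)
  | s => s

theorem mapDigit_dig (f : ℕ → ℕ) {d : ℕ} (hd : d < c + 2) :
    mapDigit f (dig d : Sym c) = dig (f d) := by
  simp [mapDigit, dig, Nat.mod_eq_of_lt hd]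

/-- Setting of the zero flag; other symbols are kept. -/
def setFlag (z : Bool) : Sym c → Sym c
  | home _ => home z
  | s => s

def IsHome : Sym c → Prop
  | home _ => True
  | _ => False

def IsDigit : Sym c → Prop
  | digit _ => True
  | _ => False

/-- A move to the right that does not pass the marker behind the last digit. -/
def right : Sym c → Dir
  | endMark => .stay
  | _ => .right

end Sym

open RegReal.Sym

/-- The tape with the number `r` in `W` digits with respect to the base `β`. -/
def tapeOf (c β W r : ℕ) : ℕ → Sym c
  | 0 => home (decide (r = 0))
  | j + 1 => if j < W then dig (r / β ^ j % β) else if j = W then endMark else blank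

/-- Carry propagation: as long as all lower digits are `β - 1`, the carry arrives at place `m` and
raises the quotient `r / β ^ m` by one. -/
theorem add_one_div_pow {β r : ℕ} (hβ : 0 < β) : ∀ {j : ℕ},
    (∀ m < j, r / β ^ m % β = β - 1) → ∀ m ≤ j, (r + 1) / β ^ m = r / β ^ m + 1
  | _, _, 0, _ => by simp
  | j, h, m + 1, hm => by
    have ih := add_one_div_pow hβ h m (by omega)
    have := h m (by omega)
    rw [pow_succ, ← Nat.div_div_eq_div_mul, ← Nat.div_div_eq_div_mul, ih]
    generalize r / β ^ m = q at *
    have e := Nat.div_add_mod q β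
    have e' : q + 1 = β * (q / β + 1) := by rw [Nat.mul_add, mul_one]; omega
    rw [e', Nat.mul_div_cancel_left _ hβ]

theorem add_one_digit_low {β r j : ℕ} (hβ : 0 < β) (h : ∀ m < j, r / β ^ m % β = β - 1) {m : ℕ}
    (hm : m < j) : (r + 1) / β ^ m % β = 0 := by
  rw [add_one_div_pow hβ h m hm.le]
  have := h m hm
  generalize r / β ^ m = q at *
  have e := Nat.div_add_mod q β
  have e' : q + 1 = β * (q / β + 1) := by rw [Nat.mul_add, mul_one]; omega
  rw [e', Nat.mul_mod_right]

theorem add_one_digit_eq {β r j : ℕ} (hβ : 0 < β) (h : ∀ m < j, r / β ^ m % β = β - 1)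
    (hj : r / β ^ j % β ≠ β - 1) : (r + 1) / β ^ j % β = r / β ^ j % β + 1 := by
  rw [add_one_div_pow hβ h j le_rfl]
  have := Nat.mod_lt (r / β ^ j) hβ
  rw [Nat.add_mod, Nat.mod_eq_of_lt (a := 1) (by omega), Nat.mod_eq_of_lt (by omega)]

theorem add_one_digit_high {β r j : ℕ} (hβ : 0 < β) (h : ∀ m < j, r / β ^ m % β = β - 1)
    (hj : r / β ^ j % β ≠ β - 1) {m : ℕ} (hm : j < m) :
    (r + 1) / β ^ m % β = r / β ^ m % β := by
  obtain ⟨d, rfl⟩ : ∃ d, m = j + 1 + d := ⟨m - (j + 1), by omega⟩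
  have : (r + 1) / β ^ (j + 1) = r / β ^ (j + 1) := by
    rw [pow_succ, ← Nat.div_div_eq_div_mul, ← Nat.div_div_eq_div_mul,
      add_one_div_pow hβ h j le_rfl]
    have := Nat.mod_lt (r / β ^ j) hβ
    generalize r / β ^ j = q at *
    have e := Nat.div_add_mod q β
    have e' : q + 1 = (q % β + 1) + β * (q / β) := by omega
    rw [e', Nat.add_mul_div_left _ _ hβ, Nat.div_eq_of_lt (by omega), zero_add]
  rw [pow_add, ← Nat.div_div_eq_div_mul, ← Nat.div_div_eq_div_mul, this]

/-- The overflow case: the carry passes all `W` places, and the quotient by `β ^ W` changes from `0`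
to `1`. -/
theorem eq_pow_sub_one {β r W : ℕ} (hβ : 0 < β) (h : ∀ m < W, r / β ^ m % β = β - 1)
    (hr : r < β ^ W) : r + 1 = β ^ W := by
  have := add_one_div_pow hβ h W le_rfl
  rw [Nat.div_eq_of_lt hr] at this
  have h1 := Nat.div_mul_le_self (r + 1) (β ^ W)
  rw [this] at h1
  omega

/-- `j` is the place at which the carry stops; `j = W` stands for an overflow. -/
theorem exists_carry (β r W : ℕ) : ∃ j ≤ W, (∀ m < j, r / β ^ m % β = β - 1) ∧
    (j < W → r / β ^ j % β ≠ β - 1) := by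
  classical
  by_cases h : ∃ j, j < W ∧ r / β ^ j % β ≠ β - 1
  · refine ⟨Nat.find h, (Nat.find_spec h).1.le, fun m hm => ?_, fun _ => (Nat.find_spec h).2⟩
    have := Nat.find_min h hm
    have h' := (Nat.find_spec h).1
    by_contra hne
    exact this ⟨by omega, hne⟩
  · push Not at h
    exact ⟨W, le_rfl, h, fun h => absurd h (lt_irrefl _)⟩

section TapeOps

variable {V A Obs Act E : Type} {k c : ℕ}

/-- The state with the tapes in `D` replaced by `t` and their heads by `h`. -/
def LState.on (s : LState V (Sym c) k E) (D : Finset (Fin k)) (t : ℕ → Sym c) (h : ℕ) :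
    LState V (Sym c) k E :=
  { s with
    tape := fun i => if i ∈ D then t else s.tape i
    head := fun i => if i ∈ D then h else s.head i }

variable (π : Port Obs Act E) (x : List A)

/-- The same operation on all tapes in `D`. -/
def tapeOp (D : Finset (Fin k)) (f : Sym c → Sym c) (d : Sym c → Dir) :
    LProg V A (Sym c) k Obs Act :=
  .prim fun w => ⟨w.v, fun i => if i ∈ D then f (w.sym i) else w.sym i,
    fun i => if i ∈ D then d (w.sym i) else .stay, .stay, π.idle⟩

/-- A test of the scanned symbol. -/
def tapeTest (i₀ : Fin k) (φ : Sym c → Prop) : View V A (Sym c) k Obs → Prop :=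
  fun w => φ (w.sym i₀)

def scan (D : Finset (Fin k)) (i₀ : Fin k) (φ : Sym c → Prop) (f : Sym c → Sym c) :
    LProg V A (Sym c) k Obs Act :=
  .loop (tapeTest i₀ φ) (tapeOp π D f right)

def goHome (D : Finset (Fin k)) (i₀ : Fin k) : LProg V A (Sym c) k Obs Act :=
  .loop (tapeTest i₀ fun s => ¬ s.IsHome) (tapeOp π D id fun _ => .left)

/-- Return to cell `0` and set the zero flag. -/
def finish (D : Finset (Fin k)) (i₀ : Fin k) (z : Bool) : LProg V A (Sym c) k Obs Act :=
  .seq (goHome π D i₀) (tapeOp π D (setFlag z) fun _ => .stay)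

/-- Replace the leading digits `β - 1` by `0`. -/
def carry (D : Finset (Fin k)) (i₀ : Fin k) (β : ℕ) : LProg V A (Sym c) k Obs Act :=
  .seq (tapeOp π D id right) (scan π D i₀ (fun s => s = dig (β - 1)) (mapDigit fun _ => 0))

/-- Increment modulo `(c + 2) ^ W`. -/
def incProg (D : Finset (Fin k)) (i₀ : Fin k) : LProg V A (Sym c) k Obs Act :=
  .seq (carry π D i₀ (c + 2)) (.ite (tapeTest i₀ fun s => s = endMark) (finish π D i₀ true)
    (.seq (tapeOp π D (mapDigit (· + 1)) fun _ => .stay) (finish π D i₀ false)))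

/-- Increment of a number in binary, with a new digit if there is an overflow. -/
def growProg (D : Finset (Fin k)) (i₀ : Fin k) : LProg V A (Sym c) k Obs Act :=
  .seq (carry π D i₀ 2) (.seq (.ite (tapeTest i₀ fun s => s = endMark)
    (.seq (tapeOp π D (fun _ => dig 1) fun _ => .right)
      (tapeOp π D (fun _ => endMark) fun _ => .stay))
    (tapeOp π D (mapDigit (· + 1)) fun _ => .stay)) (finish π D i₀ false))

/-- Decrement of a positive number. -/
def decProg (D : Finset (Fin k)) (i₀ : Fin k) : LProg V A (Sym c) k Obs Act :=
  .seq (.seq (tapeOp π D id right) (scan π D i₀ (fun s => s = dig 0) (mapDigit fun _ => c + 1)))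
    (.seq (tapeOp π D (mapDigit (· - 1)) fun _ => .stay) (.seq (goHome π D i₀)
      (.seq (.seq (tapeOp π D id right) (scan π D i₀ (fun s => s = dig 0) id))
        (.ite (tapeTest i₀ fun s => s = endMark) (finish π D i₀ true) (finish π D i₀ false)))))

variable {π x} {Bd : LState V (Sym c) k E → Prop} {D : Finset (Fin k)} {i₀ : Fin k}
  {s : LState V (Sym c) k E}

theorem run_tapeOp {f : Sym c → Sym c} {d : Sym c → Dir} {t t' : ℕ → Sym c} {h h' : ℕ}
    (hb : Bd (s.on D t' h')) (ht : t' = Function.update t h (f (t h)))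
    (hh : h' = (d (t h)).moveWork h) :
    (tapeOp (V := V) (A := A) π D f d).Run (LSem π x Bd) (s.on D t h) (s.on D t' h') := by
  refine ⟨?_, hb⟩
  subst ht hh
  ext i
  · rfl
  · rfl
  · by_cases hi : i ∈ D <;> simp [LState.on, LState.apply, LState.view, hi]
  · by_cases hi : i ∈ D <;> simp [LState.on, LState.apply, LState.view, hi, Dir.moveWork]
  · exact (π.app_idle _).symm

theorem tapeTest_on (hi : i₀ ∈ D) {φ : Sym c → Prop} {t : ℕ → Sym c} {h : ℕ} :
    (LSem (A := A) π x Bd).test (tapeTest i₀ φ) (s.on D t h) ↔ φ (t h) := by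
  simp [LSem, tapeTest, LState.view, LState.on, hi]

/-- All tapes in `D` have the same content and head position, so the tape `i₀` decides for all of
them. The condition `t m ≠ endMark` is needed because `right` does not move on the end marker. -/
theorem run_scan (hi : i₀ ∈ D) {φ : Sym c → Prop} {f : Sym c → Sym c} {t : ℕ → Sym c} {j : ℕ}
    (hb : ∀ t h, h ≤ j → Bd (s.on D t h)) : ∀ {h : ℕ}, h ≤ j →
    (∀ m, h ≤ m → m < j → φ (t m) ∧ t m ≠ endMark) → ¬ φ (t j) →
    (scan (V := V) (A := A) π D i₀ φ f).Run (LSem π x Bd) (s.on D t h)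
      (s.on D (fun m => if h ≤ m ∧ m < j then f (t m) else t m) j) := by
  intro h hh
  obtain ⟨n, hn⟩ : ∃ n, n = j - h := ⟨_, rfl⟩
  induction n generalizing h t with
  | zero =>
    intro _ h₂
    obtain rfl : h = j := by omega
    have : (fun m => if h ≤ m ∧ m < h then f (t m) else t m) = t := by
      ext m; rw [if_neg (by omega)]
    rw [this]
    exact Run.loop_done (mt (tapeTest_on hi).1 h₂)
  | succ n ih =>
    intro h₁ h₂
    have hlt : h < j := by omega
    refine Run.loop_cons ((tapeTest_on hi).2 (h₁ h le_rfl hlt).1)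
      (run_tapeOp (t' := Function.update t h (f (t h))) (h' := h + 1) (hb _ _ (by omega)) rfl ?_) ?_
    · have := (h₁ h le_rfl hlt).2
      revert this
      cases t h <;> simp [Sym.right, Dir.moveWork]
    · have key := ih (t := Function.update t h (f (t h))) (h := h + 1) (by omega) (by omega)
        (fun m hm hm' => by
          rw [Function.update_of_ne (by omega)]
          exact h₁ m (by omega) hm')
        (by rwa [Function.update_of_ne (by omega)])
      have e : (fun m => if h ≤ m ∧ m < j then f (t m) else t m) = fun m =>
          if h + 1 ≤ m ∧ m < j then f (Function.update t h (f (t h)) m)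
          else Function.update t h (f (t h)) m := by
        funext m
        rcases lt_trichotomy m h with hm | rfl | hm
        · rw [if_neg (by omega), if_neg (by omega), Function.update_of_ne (by omega)]
        · rw [if_pos (by omega), if_neg (by omega), Function.update_self]
        · rw [Function.update_of_ne (by omega)]
          exact if_congr (by omega) rfl rfl
      rw [e]
      exact key

theorem run_goHome (hi : i₀ ∈ D) {t : ℕ → Sym c} (h₀ : (t 0).IsHome) : ∀ {h : ℕ},
    (hb : ∀ t m, m ≤ h → Bd (s.on D t m)) → (∀ m, 1 ≤ m → m ≤ h → ¬ (t m).IsHome) →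
    (goHome (V := V) (A := A) π D i₀).Run (LSem π x Bd) (s.on D t h) (s.on D t 0)
  | 0, _, _ => Run.loop_done (mt (tapeTest_on hi).1 (not_not.2 h₀))
  | h + 1, hb, ht => by
    refine Run.loop_cons ((tapeTest_on hi).2 (ht _ (by omega) le_rfl))
      (run_tapeOp (t' := t) (h' := h) (hb _ _ (by omega)) (by simp) rfl) ?_
    exact run_goHome hi h₀ (fun t m hm => hb t m (by omega)) fun m h₁ h₂ => ht m h₁ (by omega)

theorem run_finish (hi : i₀ ∈ D) {t t' : ℕ → Sym c} {h : ℕ} {z y : Bool} (h₀ : t 0 = home y)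
    (hb : ∀ t m, m ≤ h → Bd (s.on D t m)) (ht : ∀ m, 1 ≤ m → m ≤ h → ¬ (t m).IsHome)
    (ht' : t' = Function.update t 0 (home z)) :
    (finish (V := V) (A := A) π D i₀ z).Run (LSem π x Bd) (s.on D t h) (s.on D t' 0) := by
  refine ⟨_, run_goHome hi (by rw [h₀]; trivial) hb ht, run_tapeOp (hb _ _ (by omega)) ?_ rfl⟩
  rw [ht', h₀]
  rfl

theorem tapeOf_succ {β W r j : ℕ} (h : j < W) : tapeOf c β W r (j + 1) = dig (r / β ^ j % β) := by
  simp [tapeOf, h]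

theorem tapeOf_stop {β W r : ℕ} : tapeOf c β W r (W + 1) = endMark := by
  simp [tapeOf]

theorem tapeOf_not_home {β W r m : ℕ} (h : 1 ≤ m) : ¬ (tapeOf c β W r m).IsHome := by
  obtain ⟨m, rfl⟩ : ∃ n, m = n + 1 := ⟨m - 1, by omega⟩
  simp only [tapeOf]
  split_ifs <;> simp [IsHome, dig]

/-- A scan over the digits with the value `d` in the lowest `j` places. -/
theorem run_scan_digits (hi : i₀ ∈ D) {β W r j d : ℕ} {f : Sym c → Sym c} (hβ : 0 < β)
    (hβc : β ≤ c + 2) (hd : d < β) (hjW : j ≤ W) (hj : ∀ m < j, r / β ^ m % β = d)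
    (hj' : j < W → r / β ^ j % β ≠ d) (hb : ∀ t h, h ≤ W + 1 → Bd (s.on D t h)) :
    (Prog.seq (tapeOp (V := V) (A := A) π D id right) (scan π D i₀ (fun s => s = dig d) f)).Run
      (LSem π x Bd) (s.on D (tapeOf c β W r) 0)
      (s.on D (fun m => if 1 ≤ m ∧ m < j + 1 then f (tapeOf c β W r m) else tapeOf c β W r m)
        (j + 1)) := by
  refine ⟨s.on D (tapeOf c β W r) 1, run_tapeOp (hb _ _ (by omega)) (by simp) rfl,
    run_scan hi (fun t h hh => hb _ _ (by omega)) (by omega) ?_ ?_⟩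
  · intro m h₁ h₂
    obtain ⟨m, rfl⟩ : ∃ n, m = n + 1 := ⟨m - 1, by omega⟩
    rw [tapeOf_succ (by omega), hj m (by omega)]
    simp [dig]
  · rcases hjW.lt_or_eq with h | rfl
    · have := Nat.mod_lt (r / β ^ j) hβ
      rw [tapeOf_succ h, dig_inj (by omega) (by omega)]
      exact hj' h
    · rw [tapeOf_stop]
      simp [dig]

/-- Schoolbook increment: the digits below the carry position become `0` and the next one grows by
one. If the end marker is reached instead, there is an overflow and the digits are already those of
`0`. Either way the new zero flag is known without inspecting the result. -/
theorem run_incProg (hi : i₀ ∈ D) {W r : ℕ} (hr : r < (c + 2) ^ W)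
    (hb : ∀ t h, h ≤ W + 1 → Bd (s.on D t h)) :
    (incProg (V := V) (A := A) π D i₀).Run (LSem π x Bd) (s.on D (tapeOf c (c + 2) W r) 0)
      (s.on D (tapeOf c (c + 2) W ((r + 1) % (c + 2) ^ W)) 0) := by
  obtain ⟨j, hjW, hj, hj'⟩ := exists_carry (c + 2) r W
  have hβ : 0 < c + 2 := by omega
  refine ⟨_, run_scan_digits hi hβ le_rfl (by omega) hjW hj hj' hb, ?_⟩
  rcases hjW.lt_or_eq with h | rfl
  · have hne := hj' h
    have hlt := Nat.mod_lt (r / (c + 2) ^ j) hβ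
    -- No overflow: `r = (c + 2) ^ W - 1` would have the digit `c + 1` at the place `j` as well.
    have hr1 : r + 1 < (c + 2) ^ W := by
      by_contra hcon
      obtain rfl : r = (c + 2) ^ W - 1 := by omega
      refine hne ?_
      have h1 : (c + 2) ^ W = (c + 2) ^ j * (c + 2) ^ (W - j) := by rw [← pow_add]; congr 1; omega
      have h2 := add_one_div_pow hβ hj j le_rfl
      have h3 : (c + 2) ^ W - 1 + 1 = (c + 2) ^ j * (c + 2) ^ (W - j) := by omega
      rw [h3, Nat.mul_div_cancel_left _ (by positivity)] at h2
      obtain ⟨w, hw⟩ : ∃ w, W - j = w + 1 := ⟨W - j - 1, by omega⟩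
      rw [hw, pow_succ] at h2
      generalize ((c + 2) ^ W - 1) / (c + 2) ^ j = q at *
      obtain ⟨u, hu⟩ : ∃ u, (c + 2) ^ w = u + 1 :=
        ⟨(c + 2) ^ w - 1, (Nat.sub_add_cancel (Nat.pow_pos (by omega))).symm⟩
      rw [hu] at h2
      have : q = (c + 1) + (c + 2) * u := by linarith
      rw [this, Nat.add_mul_mod_self_left, Nat.mod_eq_of_lt (by omega)]
      omega
    rw [Nat.mod_eq_of_lt hr1]
    refine Run.ite_neg ?_ ⟨_, run_tapeOp (hb _ (j + 1) (by omega)) rfl rfl, ?_⟩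
    · rw [tapeTest_on hi, if_neg (by omega), tapeOf_succ h]
      simp [dig]
    refine run_finish hi (y := decide (r = 0)) ?_ (fun t m hm => hb _ _ (by omega)) ?_ ?_
    · rw [Function.update_of_ne (by omega), if_neg (by omega)]
      rfl
    · intro m h₁ h₂
      by_cases hm : m = j + 1
      · subst hm
        rw [Function.update_self, if_neg (by omega), tapeOf_succ h, mapDigit_dig _ hlt]
        simp [dig, IsHome]
      · obtain ⟨m, rfl⟩ : ∃ n, m = n + 1 := ⟨m - 1, by omega⟩
        have := Nat.mod_lt (r / (c + 2) ^ m) hβ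
        rw [Function.update_of_ne hm, if_pos (by omega), tapeOf_succ (by omega),
          mapDigit_dig _ this]
        simp [dig, IsHome]
    · ext m
      rcases m with _ | m
      · simp [tapeOf]
      · rw [Function.update_of_ne (by omega)]
        rcases lt_trichotomy m j with hm | rfl | hm
        · have := Nat.mod_lt (r / (c + 2) ^ m) hβ
          rw [Function.update_of_ne (by omega), if_pos (by omega), tapeOf_succ (by omega),
            tapeOf_succ (by omega), add_one_digit_low hβ hj hm, mapDigit_dig _ this]
        · rw [Function.update_self, if_neg (by omega), tapeOf_succ h, tapeOf_succ h,
            add_one_digit_eq hβ hj hne, mapDigit_dig _ hlt]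
        · rw [Function.update_of_ne (by omega), if_neg (by omega)]
          simp only [tapeOf, add_one_digit_high hβ hj hne hm]
  · rw [eq_pow_sub_one hβ hj hr, Nat.mod_self]
    refine Run.ite_pos ?_ (run_finish hi (y := decide (r = 0)) ?_
      (fun t m hm => hb _ _ (by omega)) ?_ ?_)
    · rw [tapeTest_on hi, if_neg (by omega), tapeOf_stop]
    · rw [if_neg (by omega)]
      rfl
    · intro m h₁ h₂
      split_ifs with h
      · obtain ⟨m, rfl⟩ : ∃ n, m = n + 1 := ⟨m - 1, by omega⟩
        have := Nat.mod_lt (r / (c + 2) ^ m) hβ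
        rw [tapeOf_succ (by omega), mapDigit_dig _ this]
        simp [dig, IsHome]
      · exact tapeOf_not_home h₁
    · ext m
      rcases m with _ | m
      · simp [tapeOf]
      · rw [Function.update_of_ne (by omega)]
        by_cases hm : m < j
        · have := Nat.mod_lt (r / (c + 2) ^ m) hβ
          rw [if_pos (by omega), tapeOf_succ hm, tapeOf_succ hm, mapDigit_dig _ this]
          simp
        · rw [if_neg (by omega)]
          simp [tapeOf, hm]

/-- The number of binary digits grows exactly if the carry reaches the end marker, that is, if `r +
1 = 2 ^ r.size`. So the length of the tape content stays equal to `Nat.size`. -/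
theorem run_growProg (hi : i₀ ∈ D) {r : ℕ}
    (hb : ∀ t h, h ≤ (r + 1).size + 1 → Bd (s.on D t h)) :
    (growProg (V := V) (A := A) π D i₀).Run (LSem π x Bd) (s.on D (tapeOf c 2 r.size r) 0)
      (s.on D (tapeOf c 2 (r + 1).size (r + 1)) 0) := by
  have hle : r.size ≤ (r + 1).size := Nat.size_le_size (by omega)
  obtain ⟨j, hjW, hj, hj'⟩ := exists_carry 2 r r.size
  have hβ : 0 < 2 := by omega
  have hr : r < 2 ^ r.size := Nat.lt_size_self r
  refine ⟨_, run_scan_digits hi hβ (by omega) (by omega) hjW hj hj' fun t h hh =>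
    hb t h (by omega), ?_⟩
  rcases hjW.lt_or_eq with h | hjr
  · have hne := hj' h
    have hlt := Nat.mod_lt (r / 2 ^ j) hβ
    have hlt' : r / 2 ^ j % 2 < c + 2 := by omega
    have hr1 : (r + 1).size = r.size := by
      refine le_antisymm (Nat.size_le.2 ?_) hle
      by_contra hcon
      have h1 : 2 ^ r.size = 2 ^ j * 2 ^ (r.size - j) := by rw [← pow_add]; congr 1; omega
      have h2 := add_one_div_pow hβ hj j le_rfl
      have h3 : r + 1 = 2 ^ j * 2 ^ (r.size - j) := by omega
      rw [h3, Nat.mul_div_cancel_left _ (by positivity)] at h2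
      obtain ⟨w, hw⟩ : ∃ w, r.size - j = w + 1 := ⟨r.size - j - 1, by omega⟩
      rw [hw, pow_succ] at h2
      omega
    refine ⟨_, Run.ite_neg ?_ (run_tapeOp (hb _ (j + 1) (by omega)) rfl rfl), ?_⟩
    · rw [tapeTest_on hi, if_neg (by omega), tapeOf_succ h]
      simp [dig]
    rw [hr1]
    refine run_finish hi (y := decide (r = 0)) ?_ (fun t m hm => hb _ _ (by omega)) ?_ ?_
    · rw [Function.update_of_ne (by omega), if_neg (by omega)]
      rfl
    · intro m h₁ h₂
      by_cases hm : m = j + 1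
      · subst hm
        rw [Function.update_self, if_neg (by omega), tapeOf_succ h, mapDigit_dig _ hlt']
        simp [dig, IsHome]
      · obtain ⟨m, rfl⟩ : ∃ n, m = n + 1 := ⟨m - 1, by omega⟩
        have := Nat.mod_lt (r / 2 ^ m) hβ
        rw [Function.update_of_ne hm, if_pos (by omega), tapeOf_succ (by omega),
          mapDigit_dig _ (by omega)]
        simp [dig, IsHome]
    · ext m
      rcases m with _ | m
      · simp [tapeOf]
      · rw [Function.update_of_ne (by omega)]
        rcases lt_trichotomy m j with hm | rfl | hm
        · have := Nat.mod_lt (r / 2 ^ m) hβ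
          rw [Function.update_of_ne (by omega), if_pos (by omega), tapeOf_succ (by omega),
            tapeOf_succ (by omega), add_one_digit_low hβ hj hm, mapDigit_dig _ (by omega)]
        · rw [Function.update_self, if_neg (by omega), tapeOf_succ h, tapeOf_succ h,
            add_one_digit_eq hβ hj hne, mapDigit_dig _ hlt']
        · rw [Function.update_of_ne (by omega), if_neg (by omega)]
          simp only [tapeOf, add_one_digit_high hβ hj hne hm]
  · rw [hjr] at hj hj' ⊢
    clear hjr hjW
    have he := eq_pow_sub_one hβ hj hr
    have hs : (r + 1).size = r.size + 1 := by rw [he, Nat.size_pow]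
    rw [hs] at hb
    refine ⟨_, Run.ite_pos ?_ ⟨_, run_tapeOp (hb _ (r.size + 1 + 1) (by omega)) rfl rfl,
      run_tapeOp (hb _ (r.size + 1 + 1) (by omega)) rfl rfl⟩, ?_⟩
    · rw [tapeTest_on hi, if_neg (by omega), tapeOf_stop]
    rw [hs]
    refine run_finish hi (y := decide (r = 0)) ?_ (fun t m hm => hb _ _ (by omega)) ?_ ?_
    · rw [Function.update_of_ne (by omega), Function.update_of_ne (by omega), if_neg (by omega)]
      rfl
    · intro m h₁ h₂
      rcases eq_or_ne m (r.size + 1 + 1) with rfl | hm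
      · rw [Function.update_self]
        simp [IsHome]
      rw [Function.update_of_ne hm]
      rcases eq_or_ne m (r.size + 1) with rfl | hm
      · rw [Function.update_self]
        simp [IsHome, dig]
      · obtain ⟨m, rfl⟩ : ∃ n, m = n + 1 := ⟨m - 1, by omega⟩
        have := Nat.mod_lt (r / 2 ^ m) hβ
        rw [Function.update_of_ne hm, if_pos (by omega), tapeOf_succ (by omega),
          mapDigit_dig _ (by omega)]
        simp [dig, IsHome]
    · ext m
      rcases m with _ | m
      · simp [tapeOf]
      · rw [Function.update_of_ne (by omega)]
        rcases lt_trichotomy m r.size with hm | rfl | hm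
        · have := Nat.mod_lt (r / 2 ^ m) hβ
          rw [Function.update_of_ne (by omega), Function.update_of_ne (by omega),
            if_pos (by omega), tapeOf_succ (by omega), tapeOf_succ (by omega),
            add_one_digit_low hβ hj hm, mapDigit_dig _ (by omega)]
        · rw [Function.update_of_ne (by omega), Function.update_self, tapeOf_succ (by omega), he,
            Nat.div_self (by positivity)]
        · rcases eq_or_ne m (r.size + 1) with rfl | hm'
          · rw [Function.update_self, tapeOf_stop]
          · rw [Function.update_of_ne (by omega), Function.update_of_ne (by omega),
              if_neg (by omega)]
            simp only [tapeOf]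
            rw [if_neg (by omega), if_neg (by omega), if_neg (by omega), if_neg (by omega)]

/-- The borrow is the carry of `r ↦ r + 1` read backwards, so the place `j` found for `r` is the
lowest nonzero digit of `r + 1`. Whether the result is zero cannot be seen locally; a second scan,
over zero digits, determines the flag. -/
theorem run_decProg (hi : i₀ ∈ D) {W r : ℕ} (hr : r + 1 < (c + 2) ^ W)
    (hb : ∀ t h, h ≤ W + 1 → Bd (s.on D t h)) :
    (decProg (V := V) (A := A) π D i₀).Run (LSem π x Bd) (s.on D (tapeOf c (c + 2) W (r + 1)) 0)
      (s.on D (tapeOf c (c + 2) W r) 0) := by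
  obtain ⟨j, hjW, hj, hj'⟩ := exists_carry (c + 2) r W
  have hβ : 0 < c + 2 := by omega
  have h : j < W := by
    refine lt_of_le_of_ne hjW ?_
    rintro rfl
    have := eq_pow_sub_one hβ hj (by omega)
    omega
  have hne := hj' h
  have hlt := Nat.mod_lt (r / (c + 2) ^ j) hβ
  refine ⟨_, run_scan_digits (j := j) hi hβ le_rfl hβ hjW (fun m hm => add_one_digit_low hβ hj hm)
    (fun _ => ?_) hb, ?_⟩
  · rw [add_one_digit_eq hβ hj hne]
    omega
  -- After the borrow the digits are those of `r`, while the flag is still that of `r + 1`, namely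
  -- `false`.
  have ht : Function.update (tapeOf c (c + 2) W r) 0 (home false) =
      Function.update (fun m => if 1 ≤ m ∧ m < j + 1 then
        mapDigit (fun _ => c + 1) (tapeOf c (c + 2) W (r + 1) m)
        else tapeOf c (c + 2) W (r + 1) m) (j + 1) (mapDigit (· - 1)
          (if 1 ≤ j + 1 ∧ j + 1 < j + 1 then
            mapDigit (fun _ => c + 1) (tapeOf c (c + 2) W (r + 1) (j + 1))
            else tapeOf c (c + 2) W (r + 1) (j + 1))) := by
    ext m
    rcases m with _ | m
    · simp [tapeOf]
    · rw [Function.update_of_ne (by omega)]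
      rcases lt_trichotomy m j with hm | rfl | hm
      · have := Nat.mod_lt ((r + 1) / (c + 2) ^ m) hβ
        rw [Function.update_of_ne (by omega), if_pos (by omega), tapeOf_succ (by omega),
          tapeOf_succ (by omega), mapDigit_dig _ this, hj m hm]
        rfl
      · rw [Function.update_self, if_neg (by omega), tapeOf_succ h, tapeOf_succ h,
          add_one_digit_eq hβ hj hne, mapDigit_dig _ (by omega)]
        rfl
      · rw [Function.update_of_ne (by omega), if_neg (by omega)]
        simp only [tapeOf, add_one_digit_high hβ hj hne hm]
  refine ⟨_, run_tapeOp (hb _ (j + 1) (by omega)) ht rfl, ?_⟩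
  have hhome : ∀ m, 1 ≤ m →
      ¬ (Function.update (tapeOf c (c + 2) W r) 0 (home false) m).IsHome := fun m hm => by
    rw [Function.update_of_ne (by omega)]
    exact tapeOf_not_home hm
  refine ⟨_, run_goHome hi (by rw [Function.update_self]; trivial)
    (fun t m hm => hb _ _ (by omega)) fun m hm _ => hhome m hm, ?_⟩
  -- `i` is the place of the lowest nonzero digit of `r`, or `W` if all digits vanish.
  obtain ⟨i, hiW, hi₁, hi₂⟩ : ∃ i ≤ W, (∀ m < i, r / (c + 2) ^ m % (c + 2) = 0) ∧
      (i < W → r / (c + 2) ^ i % (c + 2) ≠ 0) := by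
    classical
    by_cases h : ∃ j, j < W ∧ r / (c + 2) ^ j % (c + 2) ≠ 0
    · refine ⟨Nat.find h, (Nat.find_spec h).1.le, fun m hm => ?_, fun _ => (Nat.find_spec h).2⟩
      have := Nat.find_min h hm
      have h' := (Nat.find_spec h).1
      by_contra hne
      exact this ⟨by omega, hne⟩
    · push Not at h
      exact ⟨W, le_rfl, h, fun h => absurd h (lt_irrefl _)⟩
  have hscan := run_scan (V := V) (A := A) (π := π) (x := x) (Bd := Bd) (s := s) hi
    (φ := fun s => s = dig 0) (f := id)
    (t := Function.update (tapeOf c (c + 2) W r) 0 (home false)) (j := i + 1) (h := 1)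
    (fun t h hh => hb _ _ (by omega)) (by omega) (by
      intro m h₁ h₂
      obtain ⟨m, rfl⟩ : ∃ n, m = n + 1 := ⟨m - 1, by omega⟩
      rw [Function.update_of_ne (by omega), tapeOf_succ (by omega), hi₁ m (by omega)]
      simp [dig]) (by
      rw [Function.update_of_ne (by omega)]
      rcases hiW.lt_or_eq with h | rfl
      · have := Nat.mod_lt (r / (c + 2) ^ i) hβ
        rw [tapeOf_succ h, dig_inj (by omega) (by omega)]
        exact hi₂ h
      · rw [tapeOf_stop]
        simp [dig])
  simp only [id, ite_self] at hscan
  refine ⟨_, ⟨_, run_tapeOp (hb _ 1 (by omega))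
    (Function.update_eq_self 0 _).symm (by simp [Sym.right, Dir.moveWork]), hscan⟩, ?_⟩
  rcases hiW.lt_or_eq with hiW | rfl
  · refine Run.ite_neg ?_ (run_finish hi (Function.update_self ..)
      (fun t m hm => hb _ _ (by omega)) (fun m hm _ => hhome m hm) ?_)
    · rw [tapeTest_on hi, Function.update_of_ne (by omega), tapeOf_succ hiW]
      simp [dig]
    · have : r ≠ 0 := by
        rintro rfl
        exact hi₂ hiW (by simp)
      ext m
      rcases m with _ | m
      · simp [tapeOf, this]
      · simp
  · refine Run.ite_pos ?_ (run_finish hi (Function.update_self ..)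
      (fun t m hm => hb _ _ (by omega)) (fun m hm _ => hhome m hm) ?_)
    · rw [tapeTest_on hi, Function.update_of_ne (by omega), tapeOf_stop]
    · have : r = 0 := by
        have key : ∀ m ≤ i, r % (c + 2) ^ m = 0 := by
          intro m hm
          induction m with
          | zero => simp [Nat.mod_one]
          | succ m ih => rw [Nat.mod_pow_succ, ih (by omega), hi₁ m (by omega)]; simp
        have := key i le_rfl
        rwa [Nat.mod_eq_of_lt (by omega)] at this
      ext m
      rcases m with _ | m
      · simp [tapeOf, this]
      · simp

end TapeOps

end RegReal

/-! ### Register machines with polynomially bounded registers, in logarithmic space -/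

namespace RegReal

open Relation Prog

/-! ### Register machines -/

/-- The state of a register machine: a finite memory, registers, the position of the input head, and
the additional one-way tape. -/
structure RState (V ι E : Type) where
  v : V
  reg : ι → ℕ
  pos : ℕ
  port : E

/-- Increment of a register, decrement of a register, and operations that do not concern the
registers. -/
inductive RPrim (V A ι Obs Act : Type)
  | inc (i : ι)
  | dec (i : ι)
  | loc (f : V → InputCell A → Obs → V × Dir × Act)

/-- What a register machine sees; the predicate `zero` holds for the registers with value `0`. -/
structure RView (V A ι Obs : Type) where
  v : V
  cell : InputCell A
  zero : ι → Prop
  obs : Obs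

abbrev RProg (V A ι Obs Act : Type) := Prog (RPrim V A ι Obs Act) (RView V A ι Obs → Prop)

section RegisterMachine

variable {V A ι Obs Act E : Type} [DecidableEq ι]

def RState.view (π : Port Obs Act E) (x : List A) (s : RState V ι E) : RView V A ι Obs :=
  ⟨s.v, readInput x s.pos, fun i => s.reg i = 0, π.obs s.port⟩

/-- The semantics of register machines with registers modulo `N`. -/
def RSem (π : Port Obs Act E) (x : List A) (N : ℕ) :
    Sem (RPrim V A ι Obs Act) (RView V A ι Obs → Prop) (RState V ι E) where
  prim
    | .inc i, s, s' => s' = { s with reg := Function.update s.reg i ((s.reg i + 1) % N) }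
    | .dec i, s, s' => s' = { s with reg := Function.update s.reg i (s.reg i - 1) }
    | .loc f, s, s' => s' =
        { v := (f s.v (readInput x s.pos) (π.obs s.port)).1
          reg := s.reg
          pos := (f s.v (readInput x s.pos) (π.obs s.port)).2.1.moveInput x.length s.pos
          port := π.app (f s.v (readInput x s.pos) (π.obs s.port)).2.2 s.port }
  test t s := t (s.view π x)

theorem RSem_functional (π : Port Obs Act E) (x : List A) (N : ℕ) (a : RPrim V A ι Obs Act)
    (s s₁ s₂ : RState V ι E) (h₁ : (RSem π x N).prim a s s₁) (h₂ : (RSem π x N).prim a s s₂) :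
    s₁ = s₂ := by
  cases a <;> exact Eq.trans h₁ (Eq.symm h₂)

def RState.init (v₀ : V) (e : E) : RState V ι E := ⟨v₀, fun _ => 0, 0, e⟩

/-! ### Implementation by Turing machines -/

variable {k : ℕ} (π : Port Obs Act E) (c : ℕ) (e : ι ≃ Fin k)

/-- The zero flag guards the decrement, since `decProg` is meant for positive numbers only. -/
def RPrim.toL : RPrim V A ι Obs Act → LProg V A (Sym c) k Obs Act
  | .inc i => incProg π {e i} (e i)
  | .dec i => .ite (tapeTest (e i) fun s => s = .home true) .skip (decProg π {e i} (e i))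
  | .loc f => .prim fun w => ⟨(f w.v w.cell w.obs).1, w.sym, fun _ => .stay,
      (f w.v w.cell w.obs).2.1, (f w.v w.cell w.obs).2.2⟩

/-- Between primitives all heads rest on cell `0`, so the zero flag is the scanned symbol and a
register test is a single lookup. -/
def RTest.toL (t : RView V A ι Obs → Prop) : View V A (Sym c) k Obs → Prop :=
  fun w => t ⟨w.v, w.cell, fun i => w.sym (e i) = .home true, w.obs⟩

/-- The state of the Turing machine that represents a state of the register machine. -/
def RState.toL (W : ℕ) (s : RState V ι E) : LState V (Sym c) k E :=
  ⟨s.v, s.pos, fun j => tapeOf c (c + 2) W (s.reg (e.symm j)), fun _ => 0, s.port⟩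

variable {π c e}

theorem RState.toL_on {W : ℕ} (s : RState V ι E) (i : ι) (r : ℕ) :
    (s.toL c e W).on {e i} (tapeOf c (c + 2) W r) 0 =
      ({ s with reg := Function.update s.reg i r } : RState V ι E).toL c e W := by
  ext j
  · rfl
  · rfl
  · by_cases h : j = e i
    · subst h; simp [LState.on, RState.toL]
    · have : e.symm j ≠ i := fun h' => h (by rw [← h', e.apply_symm_apply])
      simp [LState.on, RState.toL, h, this]
  · simp [LState.on, RState.toL]
  · rfl

theorem RState.toL_on_self {W : ℕ} (s : RState V ι E) (i : ι) :
    (s.toL c e W).on {e i} (tapeOf c (c + 2) W (s.reg i)) 0 = s.toL c e W := by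
  rw [RState.toL_on, Function.update_eq_self]

theorem home_iff {W r : ℕ} : tapeOf c (c + 2) W r 0 = .home true ↔ r = 0 := by
  simp [tapeOf]

theorem RPrim.run_toL {x : List A} {W : ℕ} (a : RPrim V A ι Obs Act) (s : RState V ι E)
    (hs : ∀ i, s.reg i < (c + 2) ^ W) :
    ∃ s', (RSem π x ((c + 2) ^ W)).prim a s s' ∧ (∀ i, s'.reg i < (c + 2) ^ W) ∧
      (a.toL π c e).Run (LSem π x fun _ => True) (s.toL c e W) (s'.toL c e W) := by
  cases a with
  | inc i =>
    refine ⟨_, rfl, fun j => ?_, ?_⟩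
    · by_cases h : j = i
      · subst h; simpa using Nat.mod_lt _ (by positivity)
      · simpa [h] using hs j
    · have := run_incProg (V := V) (A := A) (π := π) (x := x) (Bd := fun _ => True) (s := s.toL c e W)
        (D := {e i}) (i₀ := e i) (by simp) (hs i) fun _ _ _ => trivial
      rwa [RState.toL_on_self, RState.toL_on] at this
  | dec i =>
    refine ⟨_, rfl, fun j => ?_, ?_⟩
    · by_cases h : j = i
      · subst h; simpa using (Nat.sub_le _ _).trans_lt (hs j)
      · simpa [h] using hs j
    · have ht : (LSem (A := A) π x fun _ => True).test (tapeTest (e i) fun s => s = .home true)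
          (s.toL c e W) ↔ s.reg i = 0 := by
        simp [LSem, tapeTest, LState.view, RState.toL, home_iff]
      by_cases h : s.reg i = 0
      · refine Run.ite_pos (ht.2 h) ?_
        rw [h, ← h, Nat.sub_eq_zero_of_le (by omega), ← h, Function.update_eq_self]
        rfl
      · refine Run.ite_neg (mt ht.1 h) ?_
        have := run_decProg (V := V) (A := A) (π := π) (x := x) (Bd := fun _ => True)
          (s := s.toL c e W) (D := {e i}) (i₀ := e i) (W := W) (r := s.reg i - 1) (by simp)
          (by have := hs i; omega) fun _ _ _ => trivial
        rwa [Nat.sub_add_cancel (by omega), RState.toL_on_self, RState.toL_on] at this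
  | loc f =>
    refine ⟨_, rfl, hs, ?_, trivial⟩
    ext <;> simp [LState.apply, RState.toL, LState.view, Dir.moveWork]

theorem RTest.test_toL {x : List A} {W : ℕ} (t : RView V A ι Obs → Prop) (s : RState V ι E) :
    (RSem π x ((c + 2) ^ W)).test t s ↔
      (LSem π x fun _ => True).test (RTest.toL c e t) (s.toL c e W) := by
  have : (fun i => (s.toL c e W).tape (e i) ((s.toL c e W).head (e i)) = .home true) =
      fun i => s.reg i = 0 := by
    funext i
    simp [RState.toL, home_iff]
  simp only [RSem, LSem, RTest.toL, LState.view, this]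
  rfl

omit [DecidableEq ι] in
theorem RPrim.det_toL (a : RPrim V A ι Obs Act) : (a.toL π c e).Det := by
  cases a <;>
    simp [RPrim.toL, Det, incProg, decProg, carry, finish, goHome, scan, tapeOp]

theorem LSem_functional (x : List A) (Bd : LState V (Sym c) k E → Prop)
    (a) (s s₁ s₂ : LState V (Sym c) k E) (h₁ : (LSem (A := A) π x Bd).prim a s s₁)
    (h₂ : (LSem π x Bd).prim a s s₂) : s₁ = s₂ :=
  h₁.1.trans h₂.1.symm

/-- On the way from tapes back to registers it matters that the program of a primitive is
deterministic: the run provided by `RPrim.run_toL` is then its only run. Choices occur only in `p`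
itself. -/
theorem run_toL_iff {x : List A} {W : ℕ} {p : RProg V A ι Obs Act} {s : RState V ι E}
    (hs : ∀ i, s.reg i < (c + 2) ^ W) (z : E) :
    (∃ t, (p.bind (RPrim.toL π c e) (RTest.toL c e)).Run (LSem π x fun _ => True)
      (s.toL c e W) t ∧ t.port = z) ↔
    ∃ s', p.Run (RSem π x ((c + 2) ^ W)) s s' ∧ s'.port = z := by
  let R : RState V ι E → LState V (Sym c) k E → Prop :=
    fun s t => t = s.toL c e W ∧ ∀ i, s.reg i < (c + 2) ^ W
  have hR : R s (s.toL c e W) := ⟨rfl, hs⟩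
  have ht : ∀ (b : RView V A ι Obs → Prop) s t, R s t → ((RSem π x ((c + 2) ^ W)).test b s ↔
      (LSem π x fun _ => True).test (RTest.toL c e b) t) := by
    rintro b s _ ⟨rfl, -⟩
    exact RTest.test_toL b s
  constructor
  · rintro ⟨t, h, rfl⟩
    obtain ⟨s', h', rfl, -⟩ := run_bind_backward (S := RSem π x ((c + 2) ^ W)) (R := R) (by
      rintro a s _ t' h ⟨rfl, hs⟩
      obtain ⟨s', h₁, h₂, h₃⟩ := RPrim.run_toL (π := π) (x := x) (e := e) a s hs
      exact ⟨s', h₁, (RPrim.det_toL a).run_unique (LSem_functional x _) h h₃, h₂⟩) ht h hR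
    exact ⟨s', h', rfl⟩
  · rintro ⟨s', h, rfl⟩
    obtain ⟨t, h', rfl, -⟩ := run_bind_forward (S' := LSem π x fun _ => True) (R := R)
      (f := RPrim.toL π c e) (g := RTest.toL c e) (by
      rintro a s s'' _ h ⟨rfl, hs⟩
      obtain ⟨s', h₁, h₂, h₃⟩ := RPrim.run_toL (π := π) (x := x) (e := e) a s hs
      obtain rfl := RSem_functional π x _ a s _ _ h h₁
      exact ⟨_, h₃, rfl, h₂⟩) ht h hR
    exact ⟨_, h', rfl⟩

/-! ### Initialization of the work tapes -/

theorem readInput_eq_leftEnd {x : List A} {p : ℕ} : readInput x p = .leftEnd ↔ p = 0 := by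
  cases p with
  | zero => simp [readInput]
  | succ p => cases h : x[p]? <;> simp [readInput, h]

theorem readInput_eq_rightEnd {x : List A} {p : ℕ} :
    readInput x p = .rightEnd ↔ x.length + 1 ≤ p := by
  cases p with
  | zero => simp [readInput]
  | succ p =>
    cases h : x[p]? with
    | none => simpa [readInput, h] using List.getElem?_eq_none_iff.1 h
    | some a =>
      have := (List.getElem?_eq_some_iff.1 h).1
      simpa [readInput, h] using this

def moveHead (π : Port Obs Act E) (d : Dir) : LProg V A (Sym c) k Obs Act :=
  .prim fun w => ⟨w.v, w.sym, fun _ => .stay, d, π.idle⟩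

theorem run_moveHead {x : List A} {Bd : LState V (Sym c) k E → Prop} {d : Dir}
    {s s' : LState V (Sym c) k E}
    (hs' : s' = { s with pos := d.moveInput x.length s.pos }) (hb : Bd s') :
    (moveHead (V := V) (A := A) π d).Run (LSem π x Bd) s s' := by
  refine ⟨?_, hb⟩
  subst hs'
  ext <;> simp [LState.apply, LState.view, Dir.moveWork, π.app_idle]

/-- Put zero on all work tapes, with as many binary digits as `|x| + 1` has. -/
def initProg (π : Port Obs Act E) (c : ℕ) (i₀ : Fin k) : LProg V A (Sym c) k Obs Act :=
  .seq (.seq (tapeOp π .univ (fun _ => .home true) fun _ => .right)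
    (.seq (tapeOp π .univ (fun _ => .endMark) fun _ => .stay) (goHome π .univ i₀)))
  (.seq (.loop (fun w => w.cell ≠ .rightEnd) (.seq (growProg π .univ i₀) (moveHead π .right)))
  (.seq (.seq (.seq (tapeOp π .univ id Sym.right)
    (scan π .univ i₀ Sym.IsDigit (Sym.mapDigit fun _ => 0))) (finish π .univ i₀ true))
  (.loop (fun w => w.cell ≠ .leftEnd) (moveHead π .left))))

theorem det_initProg {i₀ : Fin k} : (initProg (V := V) (A := A) π c i₀).Det := by
  simp [initProg, Det, growProg, carry, finish, goHome, scan, tapeOp, moveHead]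

/-- While the input head makes its `|x| + 1` moves to the right endmarker, a binary counter on all
tapes counts along; its final length `size (|x| + 1)` marks off the work space. The digits are then
set to zero, and since zero looks the same in every base, the tapes can henceforth be read in base
`c + 2`. -/
theorem run_initProg {x : List A} {i₀ : Fin k} {v₀ : V} {z : E} :
    (initProg (V := V) (A := A) π c i₀).Run
      (LSem π x fun s => ∀ i, s.head i ≤ (x.length + 1).size + 1) (LState.init k (.blank : Sym c) v₀ z)
      ⟨v₀, 0, fun _ => tapeOf c (c + 2) (x.length + 1).size 0, fun _ => 0, z⟩ := by
  set Bd : LState V (Sym c) k E → Prop := fun s => ∀ i, s.head i ≤ (x.length + 1).size + 1 with hBd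
  have hb : ∀ (s : LState V (Sym c) k E) (t : ℕ → Sym c) h, h ≤ (x.length + 1).size + 1 →
      Bd (s.on .univ t h) := by
    intro s t h hh i
    simpa [LState.on] using hh
  have hi : i₀ ∈ Finset.univ := Finset.mem_univ _
  let st : ℕ → LState V (Sym c) k E := fun p => ⟨v₀, p, fun _ _ => .blank, fun _ => 0, z⟩
  have h₀ : LState.init k (.blank : Sym c) v₀ z = (st 0).on .univ (fun _ => (.blank : Sym c)) 0 := by
    ext <;> simp [LState.init, LState.on, st]
  have hend : (⟨v₀, 0, fun _ => tapeOf c (c + 2) (x.length + 1).size 0, fun _ => 0, z⟩ :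
      LState V (Sym c) k E) = (st 0).on .univ (tapeOf c (c + 2) (x.length + 1).size 0) 0 := by
    ext <;> simp [LState.on, st]
  rw [h₀, hend]
  refine ⟨(st 0).on .univ (tapeOf c 2 0 0) 0, ⟨_, run_tapeOp (hb _ _ 1 (by omega)) rfl rfl, _,
    run_tapeOp (hb _ _ 1 (by omega)) rfl rfl, ?_⟩,
    (st (x.length + 1)).on .univ (tapeOf c 2 (x.length + 1).size (x.length + 1)) 0, ?_,
    (st (x.length + 1)).on .univ (tapeOf c (c + 2) (x.length + 1).size 0) 0, ?_, ?_⟩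
  · have ht : Function.update (Function.update (fun _ => (.blank : Sym c)) 0 (.home true)) 1 .endMark =
        tapeOf c 2 0 0 := by
      funext m
      rcases m with _ | _ | m <;> simp [tapeOf]
    have hg := run_goHome (V := V) (A := A) (π := π) (x := x) (Bd := Bd) (s := st 0) (h := 1) hi
      (t := tapeOf c 2 0 0) trivial (fun t m hm => hb _ _ _ (by omega))
      (fun m hm _ => tapeOf_not_home hm)
    rw [← ht] at hg ⊢
    exact hg
  · have key : ∀ d r : ℕ, r + d = x.length + 1 →
        (Prog.loop (fun w => w.cell ≠ .rightEnd)
          (.seq (growProg π .univ i₀) (moveHead π .right)) : LProg V A (Sym c) k Obs Act).Run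
        (LSem π x Bd) ((st r).on .univ (tapeOf c 2 r.size r) 0)
          ((st (x.length + 1)).on .univ (tapeOf c 2 (x.length + 1).size (x.length + 1)) 0) := by
      intro d
      induction d with
      | zero =>
        rintro r rfl
        exact Run.loop_done (not_not.2 ((readInput_eq_rightEnd (x := x)).2 le_rfl))
      | succ d ih =>
        intro r hr
        have hsz : (r + 1).size ≤ (x.length + 1).size := Nat.size_le_size (by omega)
        refine Run.loop_cons (mt (readInput_eq_rightEnd (x := x) (p := r)).1 (by omega)) ⟨_, run_growProg hi
          (fun t h hh => hb _ _ _ (by omega)), run_moveHead (s' := (st (r + 1)).on .univ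
            (tapeOf c 2 (r + 1).size (r + 1)) 0) ?_ (hb _ _ _ (by omega))⟩ (ih (r + 1) (by omega))
        · ext <;> simp [LState.on, st, Dir.moveInput]
          omega
    simpa using key (x.length + 1) 0 (by simp)
  · have hscan := run_scan (V := V) (A := A) (π := π) (x := x) (Bd := Bd) (s := st (x.length + 1))
      hi (φ := Sym.IsDigit) (f := Sym.mapDigit fun _ => 0)
      (t := tapeOf c 2 (x.length + 1).size (x.length + 1)) (j := (x.length + 1).size + 1) (h := 1)
      (fun t h hh => hb _ _ _ hh) (by omega) (by
        intro m h₁ h₂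
        obtain ⟨m, rfl⟩ : ∃ n, m = n + 1 := ⟨m - 1, by omega⟩
        rw [tapeOf_succ (by omega)]
        simp [Sym.dig, Sym.IsDigit]) (by simp [tapeOf_stop, Sym.IsDigit])
    refine ⟨_, ⟨_, run_tapeOp (hb _ _ 1 (by omega)) (by simp) rfl, hscan⟩,
      run_finish hi (y := decide (x.length + 1 = 0)) ?_ (fun t m hm => hb _ _ _ hm) ?_ ?_⟩
    · rfl
    · intro m h₁ h₂
      split_ifs with h
      · obtain ⟨m, rfl⟩ : ∃ n, m = n + 1 := ⟨m - 1, by omega⟩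
        rw [tapeOf_succ (by omega)]
        simp [Sym.dig, Sym.IsHome, Sym.mapDigit]
      · exact tapeOf_not_home h₁
    · ext m
      rcases m with _ | m
      · simp [tapeOf]
      · rw [Function.update_of_ne (by omega)]
        by_cases hm : m < (x.length + 1).size
        · have := Nat.mod_lt ((x.length + 1) / 2 ^ m) (Nat.zero_lt_two)
          rw [if_pos (by omega), tapeOf_succ hm, tapeOf_succ hm, Sym.mapDigit_dig _ (by omega)]
          simp
        · rw [if_neg (by omega)]
          simp [tapeOf, hm]
  · have key : ∀ r : ℕ,
        (Prog.loop (fun w => w.cell ≠ .leftEnd) (moveHead π .left) :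
          LProg V A (Sym c) k Obs Act).Run (LSem π x Bd)
          ((st r).on .univ (tapeOf c (c + 2) (x.length + 1).size 0) 0)
          ((st 0).on .univ (tapeOf c (c + 2) (x.length + 1).size 0) 0) := by
      intro r
      induction r with
      | zero => exact Run.loop_done (not_not.2 ((readInput_eq_leftEnd (x := x) (p := 0)).2 rfl))
      | succ r ih =>
        refine Run.loop_cons (mt (readInput_eq_leftEnd (x := x) (p := r + 1)).1 (Nat.succ_ne_zero r)) (run_moveHead
          (s' := (st r).on .univ (tapeOf c (c + 2) (x.length + 1).size 0) 0) ?_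
          (hb _ _ _ (by omega))) ih
        ext <;> simp [LState.on, st, Dir.moveInput]
    exact key _

/-! ### Space bounds -/

theorem run_of_run_bd {x : List A} {Bd : LState V (Sym c) k E → Prop}
    {p : LProg V A (Sym c) k Obs Act} {s s' : LState V (Sym c) k E}
    (h : p.Run (LSem π x Bd) s s') (hs : Bd s) : p.Run (LSem π x fun _ => True) s s' :=
  run_of_sstep (ReflTransGen.mono (fun _ _ h => h.1) _ _ (bstep_of_run h hs))


/-- The instruction keeps the markers behind the last digits and does not pass them. -/
def Guarded (a : View V A (Sym c) k Obs → Instr V (Sym c) k Act) : Prop :=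
  ∀ w i, w.sym i = .endMark → (a w).write i = .endMark ∧ (a w).workDir i ≠ .right

omit [DecidableEq ι] in
theorem guarded_toL (a : RPrim V A ι Obs Act) : (a.toL π c e).AllPrims Guarded := by
  have h : ∀ (D : Finset (Fin k)) (f : Sym c → Sym c) d, f .endMark = .endMark → d .endMark ≠ .right →
      (tapeOp (V := V) (A := A) π D f d).AllPrims Guarded := by
    intro D f d h₁ h₂ w i hw
    by_cases hi : i ∈ D <;> simp [hi, hw, h₁, h₂]
  have h1 : ∀ D, (tapeOp (V := V) (A := A) (c := c) (k := k) π D id Sym.right).AllPrims Guarded :=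
    fun D => h _ _ _ rfl (by simp [Sym.right])
  have h2 : ∀ D f, (tapeOp (V := V) (A := A) (c := c) (k := k) π D (Sym.mapDigit f)
      Sym.right).AllPrims Guarded := fun D f => h _ _ _ rfl (by simp [Sym.right])
  have h3 : ∀ D f, (tapeOp (V := V) (A := A) (c := c) (k := k) π D (Sym.mapDigit f)
      fun _ => .stay).AllPrims Guarded := fun D f => h _ _ _ rfl (by simp)
  have h4 : ∀ D, (tapeOp (V := V) (A := A) (c := c) (k := k) π D id
      fun _ => .left).AllPrims Guarded := fun D => h _ _ _ rfl (by simp)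
  have h5 : ∀ D z, (tapeOp (V := V) (A := A) (c := c) (k := k) π D (Sym.setFlag z)
      fun _ => .stay).AllPrims Guarded := fun D f => h _ _ _ rfl (by simp)
  cases a with
  | inc i =>
    simp [RPrim.toL, incProg, AllPrims, carry, finish, goHome, scan, h1, h2, h3, h4, h5]
  | dec i =>
    simp [RPrim.toL, decProg, AllPrims, finish, goHome, scan, h1, h2, h3, h4, h5]
  | loc f =>
    intro w i hw
    simp [hw]

/-- An invariant of single steps instead of complete runs, because the space bound must hold on all
nondeterministic branches, also on those that never end. The marker in cell `H` is neither erased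
nor passed, so no head gets beyond it. -/
theorem guarded_sstep {x : List A} {H : ℕ} {a b : LProg V A (Sym c) k Obs Act × LState V (Sym c) k E}
    (h : ReflTransGen (SStep π x) a b) (ha : a.1.AllPrims Guarded)
    (hs : ∀ i, a.2.head i ≤ H ∧ a.2.tape i H = .endMark) :
    ∀ i, b.2.head i ≤ H ∧ b.2.tape i H = .endMark := by
  suffices b.1.AllPrims Guarded ∧ ∀ i, b.2.head i ≤ H ∧ b.2.tape i H = .endMark from this.2
  induction h with
  | refl => exact ⟨ha, hs⟩
  | @tail b b' _ h ih =>
    obtain ⟨hb, hs⟩ := ih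
    obtain ⟨m, hd, hb'⟩ := h
    refine ⟨hd.allPrims hb, fun i => ?_⟩
    have key : (b.2.view π x).sym i = .endMark → m.write i = .endMark ∧ m.workDir i ≠ .right := by
      generalize b.2.view π x = w at hd
      generalize b.1 = q at hd hb
      generalize b'.1 = q' at hd
      clear hb' hs
      induction hd with
      | prim a => exact hb w i
      | seq q _ ih => exact ih hb.1
      | _ => intro h; exact ⟨h, by simp [nopInstr]⟩
    rw [hb']
    obtain ⟨h₁, h₂⟩ := hs i
    simp only [LState.apply]
    rcases h₁.lt_or_eq with hlt | heq
    · refine ⟨?_, by rw [Function.update_of_ne (by omega)]; exact h₂⟩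
      cases m.workDir i <;> simp only [Dir.moveWork] <;> omega
    · obtain ⟨k₁, k₂⟩ := key (by simp only [LState.view, heq, h₂])
      refine ⟨?_, by rw [heq, Function.update_self]; exact k₁⟩
      revert k₂
      cases m.workDir i <;> simp [Dir.moveWork] <;> omega

/-- `size (n + 1)` is at most `log n + 2`; the factor `3` absorbs this and the cell of the end
marker. -/
theorem size_le_log (n : ℕ) : (n + 1).size + 1 ≤ 3 * (Nat.log 2 n + 1) := by
  have : (n + 1).size ≤ Nat.log 2 n + 2 := by
    rw [Nat.size_le]
    have := Nat.lt_pow_succ_log_self (b := 2) (by omega) n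
    rw [Nat.succ_eq_add_one] at this
    rw [pow_succ]
    omega
  omega

/-- The Turing machine that implements a register machine. -/
def toTM (π : Port Obs Act E) (c : ℕ) (e : ι ≃ Fin k) (i₀ : ι) [Finite V] (v₀ : V)
    (p : RProg V A ι Obs Act) : TM A Obs Act :=
  compile π Sym.blank v₀ (.seq (initProg π c (e i₀)) (p.bind (RPrim.toL π c e) (RTest.toL c e)))

section

variable [Finite V] {i₀ : ι} {v₀ : V} {p : RProg V A ι Obs Act}

omit [DecidableEq ι] in
theorem toTM_deterministic (hp : p.Det) : (toTM π c e i₀ v₀ p).Deterministic :=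
  compile_deterministic ⟨det_initProg, det_bind RPrim.det_toL hp⟩

-- During the initialization the head bound comes from its single bounded run (`bd_of_sstep`).
-- Afterwards the end markers are in place and `guarded_sstep` takes over, whatever choices `p`
-- makes.
omit [DecidableEq ι] in
theorem toTM_workBounded {x : List A} {z : E} {d}
    (h : ReflTransGen (PMove π (toTM π c e i₀ v₀ p) x) ((toTM π c e i₀ v₀ p).init, z) d) :
    d.1.WorkBounded (3 * (Nat.log 2 x.length + 1)) := by
  have h : ReflTransGen (SStep π x) (_, LState.init k (.blank : Sym c) v₀ z) _ := sstep_of_preach h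
  intro i
  refine le_trans ?_ (size_le_log _)
  rcases sstep_seq h with ⟨p', _, h⟩ | ⟨m, hm, h⟩
  · exact bd_of_sstep det_initProg run_initProg (fun i => Nat.zero_le _) h i
  · obtain rfl := det_initProg.run_unique (LSem_functional x _) hm
      (run_of_run_bd run_initProg fun i => Nat.zero_le _)
    refine (guarded_sstep h (allPrims_bind guarded_toL p) (H := (x.length + 1).size + 1)
      (fun i => ⟨Nat.zero_le _, tapeOf_stop⟩) i).1

theorem toTM_reach_accept {x : List A} {z z' : E} :
    (∃ d, ReflTransGen (PMove π (toTM π c e i₀ v₀ p) x) ((toTM π c e i₀ v₀ p).init, z) (d, z') ∧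
      d.state ∈ (toTM π c e i₀ v₀ p).accept) ↔
    ∃ s, p.Run (RSem π x ((c + 2) ^ (x.length + 1).size)) (RState.init v₀ z) s ∧ s.port = z' := by
  rw [toTM, compile_reach_accept, ← run_toL_iff (e := e) (c := c) (fun i => by
    simp only [RState.init]; positivity)]
  have hm' := run_of_run_bd (run_initProg (V := V) (A := A) (E := E) (π := π) (c := c)
    (x := x) (i₀ := e i₀) (v₀ := v₀) (z := z)) fun i => Nat.zero_le _
  constructor
  · rintro ⟨t, ⟨m, h₁, h₂⟩, h⟩
    obtain rfl := det_initProg.run_unique (LSem_functional x _) h₁ hm'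
    exact ⟨t, h₂, h⟩
  · rintro ⟨t, h₂, h⟩
    exact ⟨t, ⟨_, hm', h₂⟩, h⟩

end

end RegisterMachine

/-- A deterministic register program that outputs `f x` shows that `f` is computable in
logarithmic space. -/
theorem logSpaceComputable_of_run {V A B ι : Type} [Finite V] [Finite ι] [Nonempty ι]
    [DecidableEq ι] {f : List A → List B} (c : ℕ) (v₀ : V) (p : RProg V A ι Unit (Option B))
    (hp : p.Det) (h : ∀ x, ∃ s, p.Run (RSem (outPort B) x ((c + 2) ^ (x.length + 1).size))
      (RState.init v₀ []) s ∧ s.port = f x) : LogSpaceComputable f := by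
  obtain ⟨k, ⟨e⟩⟩ := Finite.exists_equiv_fin ι
  have i₀ : ι := Classical.arbitrary ι
  refine ⟨toTM (outPort B) c e i₀ v₀ p, toTM_deterministic hp,
    ⟨3, fun x d hd => toTM_workBounded (π := outPort B) hd⟩, fun x => ?_⟩
  obtain ⟨d, h₁, h₂⟩ := toTM_reach_accept.2 (h x)
  refine ⟨d, h₁, Set.eq_empty_iff_forall_notMem.2 fun m hm => ?_⟩
  have h₂ : d.state.1.1 = .skip := h₂
  have hm : Delta _ _ d.state.1.1 _ _ := hm
  rw [h₂] at hm
  cases hm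

/-- One machine serves all filters, because its space bound depends neither on the advice word nor
on `F`. -/
theorem adviceTM_of_run {V A Γ ι : Type} [Finite V] [Finite ι] [Nonempty ι] [DecidableEq ι]
    (c : ℕ) (v₀ : V) (p : RProg V A ι (Option Γ) Bool) :
    ∃ M : AdviceTM A Γ, (p.Det → TM.Deterministic M) ∧ ∀ F : Language Γ, M.LogSpace F ∧
      ∀ x, x ∈ M.language F ↔ ∃ y ∈ F, ∃ s, p.Run (RSem (advPort Γ) x
        ((c + 2) ^ (x.length + 1).size)) (RState.init v₀ y) s ∧ s.port = [] := by
  obtain ⟨k, ⟨e⟩⟩ := Finite.exists_equiv_fin ι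
  have i₀ : ι := Classical.arbitrary ι
  refine ⟨toTM (advPort Γ) c e i₀ v₀ p, toTM_deterministic, fun F =>
    ⟨⟨3, fun x y _ d hd => toTM_workBounded (π := advPort Γ) hd⟩, fun x => ?_⟩⟩
  exact exists_congr fun y => and_congr_right fun _ => toTM_reach_accept (π := advPort Γ)

end RegReal

/-! ### Arithmetic subroutines of register machines -/

namespace RegReal

open Relation Prog

/-! ### Basic register programs -/

/-- `G l` is the state after the part `l` of the list has been processed; it remains to verify one
element after given predecessors. -/
theorem run_seqs_map {P T σ α : Type} {S : Sem P T σ} {p : α → Prog P T} (G : List α → σ) :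
    ∀ {L : List α}, (∀ l₁ a l₂, L = l₁ ++ a :: l₂ → (p a).Run S (G l₁) (G (l₁ ++ [a]))) →
      (seqs (L.map p)).Run S (G []) (G L) := by
  intro L
  suffices ∀ l₁ l₂, L = l₁ ++ l₂ →
      (∀ l₁ a l₂, L = l₁ ++ a :: l₂ → (p a).Run S (G l₁) (G (l₁ ++ [a]))) →
      (seqs (l₂.map p)).Run S (G l₁) (G L) from this [] L rfl
  intro l₁ l₂ hL h
  induction l₂ generalizing l₁ with
  | nil => rw [hL, List.append_nil]; rfl
  | cons a l₂ ih => exact ⟨_, h _ _ _ hL, ih (l₁ ++ [a]) (by simp [hL])⟩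

namespace RProg

variable {V A ι Obs Act E : Type} [DecidableEq ι]

/-- Change of the value of a register. -/
def _root_.RegReal.RState.set (s : RState V ι E) (i : ι) (r : ℕ) : RState V ι E :=
  { s with reg := Function.update s.reg i r }

def inc (i : ι) : RProg V A ι Obs Act := .prim (.inc i)

def dec (i : ι) : RProg V A ι Obs Act := .prim (.dec i)

/-- Change of the finite memory. -/
def upd (π : Port Obs Act E) (f : V → V) : RProg V A ι Obs Act :=
  .prim (.loc fun v _ _ => (f v, .stay, π.idle))

/-- Change of the finite memory depending on the scanned input symbol. -/
def look (π : Port Obs Act E) (f : V → InputCell A → V) : RProg V A ι Obs Act :=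
  .prim (.loc fun v a _ => (f v a, .stay, π.idle))

def move (π : Port Obs Act E) (d : Dir) : RProg V A ι Obs Act :=
  .prim (.loc fun v _ _ => (v, d, π.idle))

/-- An action on the additional one-way tape. -/
def act (a : V → Act) : RProg V A ι Obs Act :=
  .prim (.loc fun v _ _ => (v, .stay, a v))

/-- Test of the finite memory. -/
def mem (P : V → Prop) : RView V A ι Obs → Prop := fun w => P w.v

/-- Execute `p` as often as the value of the register `i` says, counting down. -/
def drain (i : ι) (p : RProg V A ι Obs Act) : RProg V A ι Obs Act :=
  .loop (fun w => ¬ w.zero i) (.seq (dec i) p)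

def clear (i : ι) : RProg V A ι Obs Act := drain i .skip

/-- Copy the register `i` to `j` with the help of the register `t`. -/
def copy (t i j : ι) : RProg V A ι Obs Act :=
  .seq (clear j) (.seq (drain i (.seq (inc t) (inc j))) (drain t (inc i)))

/-- Add `n` to a register. -/
def incs (i : ι) : ℕ → RProg V A ι Obs Act
  | 0 => .skip
  | n + 1 => .seq (incs i n) (inc i)

/-- Add the minimum of `n` and `g v` to a register. -/
def incMem (i : ι) (g : V → ℕ) : ℕ → RProg V A ι Obs Act
  | 0 => .skip
  | n + 1 => .seq (incMem i g n) (.ite (mem fun v => n < g v) (inc i) .skip)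

/-- Multiply the register `i` by `b` and add `g v`. -/
def push (t i : ι) (b : ℕ) (g : V → ℕ) : RProg V A ι Obs Act :=
  .seq (drain i (inc t)) (.seq (drain t (incs i b)) (incMem i g b))

/-- Store the scanned symbol of the input tape at the position given by the register `i`. -/
def read (π : Port Obs Act E) (t a i : ι) (f : V → InputCell A → V) : RProg V A ι Obs Act :=
  .seq (copy t i a) (.seq (drain a (move π .right)) (.seq (look π f)
    (.loop (fun w => w.cell ≠ .leftEnd) (move π .left))))

variable {π : Port Obs Act E} {x : List A} {N : ℕ} {s : RState V ι E}

theorem run_upd {f : V → V} : (upd π f).Run (RSem (A := A) π x N) s { s with v := f s.v } := by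
  show _ = _
  simp [Dir.moveInput, π.app_idle]

theorem run_look {f : V → InputCell A → V} :
    (look π f).Run (RSem (A := A) π x N) s { s with v := f s.v (readInput x s.pos) } := by
  show _ = _
  simp [Dir.moveInput, π.app_idle]

theorem run_move {d : Dir} : (move π d).Run (RSem (A := A) π x N) s
    { s with pos := d.moveInput x.length s.pos } := by
  show _ = _
  simp [π.app_idle]

theorem run_act {a : V → Act} : (act a).Run (RSem (A := A) π x N) s
    { s with port := π.app (a s.v) s.port } := by
  show _ = _
  simp [Dir.moveInput]

/-- `g n` is the loop state in which the counter still has the value `n`. Applying the lemma amounts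
to writing down the state as a function of the remaining count. -/
theorem run_drain {i : ι} {p : RProg V A ι Obs Act} (g : ℕ → RState V ι E)
    (hg : ∀ n, (g n).reg i = n) : ∀ n, (∀ m < n, p.Run (RSem π x N) ((g (m + 1)).set i m) (g m)) →
      (drain i p).Run (RSem π x N) (g n) (g 0)
  | 0, _ => Run.loop_done (not_not.2 (hg 0))
  | n + 1, hp => by
    refine Run.loop_cons (by simp [RSem, RState.view, hg]) ⟨(g (n + 1)).set i n, ?_, hp n (by omega)⟩
      (run_drain g hg n fun m hm => hp m (by omega))
    show _ = _
    simp [RState.set, hg]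

theorem run_clear {i : ι} : (clear i).Run (RSem (A := A) π x N) s (s.set i 0) := by
  have := run_drain (A := A) (π := π) (x := x) (N := N) (i := i) (p := .skip)
    (fun n => s.set i n) (by simp [RState.set]) (s.reg i) (by
      intro m _
      simp [Run, RState.set])
  simpa [clear, RState.set] using this

theorem run_drain_inc {i j : ι} (hij : i ≠ j) (hN : s.reg i + s.reg j < N) :
    (drain i (inc j)).Run (RSem (A := A) π x N) s
      { s with reg := Function.update (Function.update s.reg i 0) j (s.reg i + s.reg j) } := by
  have := run_drain (A := A) (π := π) (x := x) (N := N) (i := i) (p := inc j)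
    (fun n => { s with
        reg := Function.update (Function.update s.reg i n) j
          (s.reg i - n + s.reg j) }) (by simp [hij]) (s.reg i) (by
      intro m hm
      show _ = _
      simp only [RState.set, RState.mk.injEq, true_and, and_true]
      funext l
      by_cases hj : l = j
      · subst hj
        simp [hij.symm]
        rw [Nat.mod_eq_of_lt (by omega)]
        omega
      · by_cases hi : l = i
        · subst hi; simp [hij]
        · simp [hi, hj])
  simpa using this

/-- Reading a register by counting destroys it; so its value is sent to `j` and `t` simultaneously
and then poured back from `t`. -/
theorem run_copy {t i j : ι} (hij : i ≠ j) (hti : t ≠ i) (htj : t ≠ j) (ht : s.reg t = 0)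
    (hN : s.reg i < N) :
    (copy t i j).Run (RSem (A := A) π x N) s (s.set j (s.reg i)) := by
  refine ⟨_, run_clear, { s with
    reg := Function.update (Function.update (Function.update s.reg i 0) j (s.reg i)) t (s.reg i) },
    ?_, ?_⟩
  · have := run_drain (A := A) (π := π) (x := x) (N := N) (i := i) (p := .seq (inc t) (inc j))
      (fun n => { s with
        reg := Function.update (Function.update (Function.update s.reg i n) j
          (s.reg i - n)) t (s.reg i - n) }) (by simp [hij, hti.symm]) (s.reg i) (by
        intro m hm
        refine ⟨_, rfl, ?_⟩
        show _ = _
        simp only [RState.set, RState.mk.injEq, true_and, and_true]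
        funext l
        by_cases hj : l = j
        · subst hj
          simp [hij.symm, htj.symm]
          rw [Nat.mod_eq_of_lt (by omega)]
          omega
        · by_cases hi : l = i
          · subst hi; simp [hij, hti.symm]
          · by_cases hl : l = t
            · subst hl
              simp [hti, htj]
              rw [Nat.mod_eq_of_lt (by omega)]
              omega
            · simp [hi, hj, hl])
    convert this using 1
    · simp only [RState.set, RState.mk.injEq, true_and, and_true]
      funext l
      by_cases hl : l = t
      · subst hl; simp [htj, ht]
      · by_cases hj : l = j
        · subst hj; simp [hl]
        · simp [hj, hl]
    · simp
  · convert run_drain_inc (A := A) (π := π) (x := x) (N := N) hti _ using 1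
    · simp only [RState.set, RState.mk.injEq, true_and, and_true]
      funext l
      by_cases hi : l = i
      · subst hi; simp [hij, hti.symm]
      · by_cases hl : l = t
        · subst hl; simp [hi, htj, ht]
        · by_cases hj : l = j
          · subst hj; simp [hi, hl]
          · simp [hi, hj, hl]
    · simp [hti.symm, hij]
      omega

theorem run_incs {i : ι} : ∀ {n : ℕ}, s.reg i < N →
    (incs i n).Run (RSem (A := A) π x N) s (s.set i ((s.reg i + n) % N))
  | 0, h => by
    show _ = _
    simp [RState.set, Nat.mod_eq_of_lt h]
  | n + 1, h => by
    refine ⟨_, run_incs h, ?_⟩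
    show _ = _
    simp [RState.set, add_assoc]

theorem run_incMem {i : ι} {g : V → ℕ} : ∀ {n : ℕ}, s.reg i < N →
    (incMem i g n).Run (RSem (A := A) π x N) s (s.set i ((s.reg i + min n (g s.v)) % N))
  | 0, h => by
    show _ = _
    simp [RState.set, Nat.mod_eq_of_lt h]
  | n + 1, h => by
    refine ⟨_, run_incMem h, ?_⟩
    by_cases hn : n < g s.v
    · refine Run.ite_pos hn ?_
      show _ = _
      simp [RState.set, add_assoc, min_eq_left hn.le, min_eq_left (Nat.succ_le_of_lt hn)]
    · refine Run.ite_neg hn ?_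
      show _ = _
      rw [min_eq_right (by omega), min_eq_right (by omega)]

theorem run_push {t i : ι} {b : ℕ} {g : V → ℕ} (hti : t ≠ i) (ht : s.reg t = 0)
    (hN : s.reg i < N) (hg : g s.v ≤ b) :
    (push t i b g).Run (RSem (A := A) π x N) s (s.set i ((s.reg i * b + g s.v) % N)) := by
  refine ⟨_, run_drain_inc hti.symm (by omega), s.set i ((s.reg i * b) % N), ?_, ?_⟩
  · have := run_drain (A := A) (π := π) (x := x) (N := N) (i := t) (p := incs i b)
      (fun n => { s with
        reg := Function.update (Function.update s.reg t n) i
          (((s.reg i - n) * b) % N) }) (by simp [hti]) (s.reg i) (by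
        intro m hm
        convert run_incs _ using 1
        · simp only [RState.set, RState.mk.injEq, true_and, and_true]
          funext l
          by_cases hi : l = i
          · subst hi
            simp [hti.symm]
            congr 1
            rw [← Nat.succ_mul]
            congr 1
            omega
          · by_cases hl : l = t
            · subst hl; simp [hti]
            · simp [hi, hl]
        · simpa [RState.set, hti.symm] using Nat.mod_lt _ (by omega))
    convert this using 1
    · simp only [RState.mk.injEq, true_and, and_true]
      funext l
      by_cases hi : l = i
      · subst hi; simp [hti.symm]
      · by_cases hl : l = t
        · subst hl; simp [hti, ht]
        · simp [hi, hl]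
    · simp only [RState.set, RState.mk.injEq, true_and, and_true]
      funext l
      by_cases hi : l = i
      · subst hi; simp
      · by_cases hl : l = t
        · subst hl; simp [hti, ht]
        · simp [hi, hl]
  · convert run_incMem _ using 1
    · simp [RState.set, min_eq_right hg]
    · simpa [RState.set] using Nat.mod_lt _ (by omega)

/-- The head stops at the right endmarker, and all cells further right also count as endmarkers. So
reading at a register value is correct even if the value exceeds every head position, as it may in a
bank that describes no configuration. -/
theorem readInput_min (p : ℕ) : readInput x (min p (x.length + 1)) = readInput x p := by
  rcases le_total p (x.length + 1) with h | h
  · rw [min_eq_left h]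
  · rw [min_eq_right h, readInput_eq_rightEnd.2 le_rfl, readInput_eq_rightEnd.2 h]

theorem run_rewind : ∀ {p : ℕ} {s : RState V ι E}, s.pos = p →
    (Prog.loop (fun w => w.cell ≠ .leftEnd) (move π .left)).Run (RSem (A := A) π x N) s
      { s with pos := 0 }
  | 0, s, h => by
    have : { s with pos := 0 } = s := by rw [← h]
    rw [this]
    exact Run.loop_done (not_not.2 (readInput_eq_leftEnd.2 h))
  | p + 1, s, h => by
    refine Run.loop_cons (mt readInput_eq_leftEnd.1 (by omega)) run_move
      (run_rewind (p := p) ?_)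
    simp [h, Dir.moveInput]

theorem run_read {t a i : ι} {f : V → InputCell A → V} (hia : i ≠ a) (hti : t ≠ i) (hta : t ≠ a)
    (ht : s.reg t = 0) (ha : s.reg a = 0) (hN : s.reg i < N) (hp : s.pos = 0) :
    (read π t a i f).Run (RSem (A := A) π x N) s
      { s with v := f s.v (readInput x (s.reg i)) } := by
  refine ⟨_, run_copy hia hti hta ht hN, { s with pos := min (s.reg i) (x.length + 1) }, ?_, _,
    run_look, ?_⟩
  · have := run_drain (A := A) (π := π) (x := x) (N := N) (i := a) (p := move π .right)
      (fun n => { s.set a n with pos := min (s.reg i - n) (x.length + 1) })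
      (by simp [RState.set]) (s.reg i) (by
        intro m hm
        convert run_move using 1
        simp [RState.set, Dir.moveInput]
        omega)
    convert this using 1
    · simp [RState.set, hp]
    · simp only [RState.set, ← ha, Function.update_eq_self]
      rw [ha, Nat.sub_zero]
  · convert run_rewind rfl using 1
    simp [hp, readInput_min]

/-! ### Digits -/

variable {d : ℕ}

/-- Divide the register `i` by `d + 2` and store the remainder. -/
def pop (π : Port Obs Act E) (t i : ι) : RProg (Fin (d + 2) × V) A ι Obs Act :=
  .seq (upd π fun v => (0, v.2)) (.seq
    (drain i (.ite (mem fun v => v.1.val = d + 1) (.seq (upd π fun v => (0, v.2)) (inc t))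
      (upd π fun v => (Fin.ofNat (d + 2) (v.1.val + 1), v.2))))
    (drain t (inc i)))

/-- Divide the register `i` by `d + 2` and process the remainder. -/
def popTo (π : Port Obs Act E) (t i : ι) (f : ℕ → V → V) : RProg (Fin (d + 2) × V) A ι Obs Act :=
  .seq (pop π t i) (upd π fun v => (0, f v.1.val v.2))

/-- Division without comparisons: while the register `i` counts down, the finite memory counts
modulo `d + 2`, and each wrap-around adds one to the quotient in `t`. -/
theorem run_pop {s : RState (Fin (d + 2) × V) ι E} {t i : ι} (hti : t ≠ i) (ht : s.reg t = 0)
    (hN : s.reg i < N) :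
    (pop π t i).Run (RSem (A := A) π x N) s
      { s.set i (s.reg i / (d + 2)) with v := (Fin.ofNat (d + 2) (s.reg i % (d + 2)), s.v.2) } := by
  refine ⟨_, run_upd, { s with
    v := (Fin.ofNat (d + 2) (s.reg i % (d + 2)), s.v.2)
    reg := Function.update (Function.update s.reg i 0) t (s.reg i / (d + 2)) }, ?_, ?_⟩
  · have := run_drain (A := A) (π := π) (x := x) (N := N) (i := i)
      (p := .ite (mem fun v => v.1.val = d + 1) (.seq (upd π fun v => (0, v.2)) (inc t))
        (upd π fun v => (Fin.ofNat (d + 2) (v.1.val + 1), v.2)))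
      (fun n => { s with
        v := (Fin.ofNat (d + 2) ((s.reg i - n) % (d + 2)), s.v.2)
        reg := Function.update (Function.update s.reg i n) t ((s.reg i - n) / (d + 2)) })
      (by simp [hti.symm]) (s.reg i) (by
        intro m hm
        obtain ⟨q, hq⟩ : ∃ q, s.reg i = q + (m + 1) := ⟨s.reg i - (m + 1), by omega⟩
        have e1 : s.reg i - (m + 1) = q := by omega
        have e2 : s.reg i - m = q + 1 := by omega
        have hlt := Nat.mod_lt q (show 0 < d + 2 by omega)
        have hqq := Nat.div_add_mod q (d + 2)
        simp only [e1, e2]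
        by_cases h : q % (d + 2) = d + 1
        · have e3 : q + 1 = (d + 2) * (q / (d + 2) + 1) := by rw [Nat.mul_add, mul_one]; omega
          have hdm : (q + 1) % (d + 2) = 0 := by rw [e3, Nat.mul_mod_right]
          have hdd : (q + 1) / (d + 2) = q / (d + 2) + 1 := by
            rw [e3, Nat.mul_div_cancel_left _ (by omega)]
          have hle := Nat.div_le_self (q + 1) (d + 2)
          refine Run.ite_pos ?_ ⟨_, run_upd, ?_⟩
          · show (Fin.ofNat (d + 2) _).val = _
            simpa [Nat.mod_eq_of_lt hlt] using h
          · show _ = _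
            simp only [RState.set, RState.mk.injEq, and_true]
            refine ⟨by simp [hdm], ?_⟩
            funext l
            by_cases hl : l = t
            · subst hl
              simp [hti, hdd]
              rw [Nat.mod_eq_of_lt (by omega)]
            · by_cases hi : l = i
              · subst hi; simp [hl]
              · simp [hi, hl]
        · have e3 : q + 1 = (q % (d + 2) + 1) + (d + 2) * (q / (d + 2)) := by omega
          have hdm : (q + 1) % (d + 2) = q % (d + 2) + 1 := by
            rw [e3, Nat.add_mul_mod_self_left, Nat.mod_eq_of_lt (by omega)]
          have hdd : (q + 1) / (d + 2) = q / (d + 2) := by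
            rw [e3, Nat.add_mul_div_left _ _ (by omega), Nat.div_eq_of_lt (by omega), zero_add]
          refine Run.ite_neg ?_ ?_
          · show ¬ (Fin.ofNat (d + 2) _).val = _
            simpa [Nat.mod_eq_of_lt hlt] using h
          · convert run_upd using 1
            simp only [RState.set, RState.mk.injEq, and_true]
            refine ⟨by simp [hdm], ?_⟩
            funext l
            by_cases hl : l = t
            · subst hl
              simp [hti, hdd]
            · by_cases hi : l = i
              · subst hi; simp [hl]
              · simp [hi, hl])
    convert this using 1
    · simp only [RState.mk.injEq, and_true]
      refine ⟨by simp, ?_⟩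
      funext l
      by_cases hl : l = t
      · subst hl; simp [ht]
      · simp [hl]
    · simp
  · have hle := Nat.div_le_self (s.reg i) (d + 2)
    convert run_drain_inc hti _ using 1
    · simp only [RState.set, RState.mk.injEq, true_and, and_true]
      funext l
      by_cases hi : l = i
      · subst hi; simp [hti.symm]
      · by_cases hl : l = t
        · subst hl; simp [hi, ht]
        · simp [hi, hl]
    · simp [hti.symm]
      omega

theorem run_popTo {s : RState (Fin (d + 2) × V) ι E} {t i : ι} {f : ℕ → V → V} (hti : t ≠ i)
    (ht : s.reg t = 0) (hN : s.reg i < N) :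
    (popTo π t i f).Run (RSem (A := A) π x N) s
      { s.set i (s.reg i / (d + 2)) with v := (0, f (s.reg i % (d + 2)) s.v.2) } := by
  refine ⟨_, run_pop hti ht hN, ?_⟩
  convert run_upd using 1
  simp

omit [DecidableEq ι] in
theorem det_drain {i : ι} {p : RProg V A ι Obs Act} (h : p.Det) : (drain i p).Det := ⟨trivial, h⟩

omit [DecidableEq ι] in
theorem det_copy {t i j : ι} : (copy t i j : RProg V A ι Obs Act).Det := by
  simp [copy, clear, drain, inc, dec, Det]

omit [DecidableEq ι] in
theorem det_incs {i : ι} : ∀ {n}, (incs i n : RProg V A ι Obs Act).Det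
  | 0 => trivial
  | _ + 1 => ⟨det_incs, trivial⟩

omit [DecidableEq ι] in
theorem det_incMem {i : ι} {g : V → ℕ} : ∀ {n}, (incMem i g n : RProg V A ι Obs Act).Det
  | 0 => trivial
  | _ + 1 => ⟨det_incMem, trivial, trivial⟩

omit [DecidableEq ι] in
theorem det_push {t i : ι} {b : ℕ} {g : V → ℕ} : (push t i b g : RProg V A ι Obs Act).Det :=
  ⟨⟨trivial, trivial⟩, ⟨trivial, det_incs⟩, det_incMem⟩

omit [DecidableEq ι] in
theorem det_read {t a i : ι} {f : V → InputCell A → V} :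
    (read π t a i f : RProg V A ι Obs Act).Det :=
  ⟨det_copy, ⟨trivial, trivial⟩, trivial, trivial⟩

omit [DecidableEq ι] in
theorem det_popTo {t i : ι} {f : ℕ → V → V} :
    (popTo π t i f : RProg (Fin (d + 2) × V) A ι Obs Act).Det := by
  simp [popTo, pop, drain, inc, dec, upd, Det]

end RProg

end RegReal

/-! ### Configurations as tuples of numbers, and the simulation of one step -/

namespace RegReal

open Relation Prog RProg

/-! ### Representation of configurations by numbers -/

/-- The numbers that describe a configuration of a machine with `k` work tapes: the state, the
position of the input head, and for each work tape the contents to the left of the head and from the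
head on. -/
inductive Slot (k : ℕ)
  | state
  | pos
  | left (i : Fin k)
  | right (i : Fin k)
  deriving DecidableEq

instance (k : ℕ) : Finite (Slot k) := by
  refine Finite.of_surjective (α := Bool ⊕ Bool × Fin k)
    (fun
      | .inl false => .state
      | .inl true => .pos
      | .inr (false, i) => .left i
      | .inr (true, i) => .right i) ?_
  rintro (_ | _ | i | i)
  exacts [⟨.inl false, rfl⟩, ⟨.inl true, rfl⟩, ⟨.inr (false, i), rfl⟩, ⟨.inr (true, i), rfl⟩]

/-- Banks of registers for configurations, and auxiliary registers. -/
inductive Reg (K : Type) (k : ℕ)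
  | bank (κ : K) (j : Slot k)
  | aux
  | tmp
  | cnt
  deriving DecidableEq

instance (K : Type) [Finite K] (k : ℕ) : Finite (Reg K k) := by
  refine Finite.of_surjective (α := K × Slot k ⊕ Fin 3)
    (fun
      | .inl (κ, j) => .bank κ j
      | .inr 0 => .aux
      | .inr 1 => .tmp
      | .inr 2 => .cnt) ?_
  rintro (⟨κ, j⟩ | _ | _ | _)
  exacts [⟨.inl (κ, j), rfl⟩, ⟨.inr 0, rfl⟩, ⟨.inr 1, rfl⟩, ⟨.inr 2, rfl⟩]

instance (K : Type) (k : ℕ) : Nonempty (Reg K k) := ⟨.aux⟩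

/-- The distinguished element gets the code `0`. For the blank symbol this turns the unused part of
a tape into leading zeros; with the start state also coded by `0`, the initial configuration is
represented by zeros only. -/
theorem exists_coding (α : Type) [Finite α] (a : α) :
    ∃ (n : ℕ) (f : α → ℕ) (g : ℕ → α), (∀ y, g (f y) = y) ∧ (∀ y, f y < n) ∧ f a = 0 := by
  obtain ⟨n, ⟨e⟩⟩ := Finite.exists_equiv_fin α
  classical
  let e' := (Equiv.swap a (e.symm ⟨0, (e a).pos⟩)).trans e
  refine ⟨n, fun y => e' y, fun m => if h : m < n then e'.symm ⟨m, h⟩ else a, fun y => ?_,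
    fun y => (e' y).2, ?_⟩
  · simp
  · simp [e']

/-- A coding of work symbols and states by digits. -/
structure Coding {A Obs Act : Type} (M : TM A Obs Act) where
  d : ℕ
  encW : M.Work → ℕ
  decW : ℕ → M.Work
  dec_encW : ∀ w, decW (encW w) = w
  -- One less than the largest value allowed by the base `d + 2`: left of the head symbols are
  -- stored as `encW w + 1`, so that the number `0` there means that the head is in cell `0`.
  encW_lt : ∀ w, encW w < d + 1
  encW_blank : encW M.blank = 0
  encQ : M.State → ℕ
  decQ : ℕ → M.State
  dec_encQ : ∀ q, decQ (encQ q) = q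
  encQ_lt : ∀ q, encQ q < d + 2
  encQ_start : encQ M.start = 0

theorem Coding.exists {A Obs Act : Type} (M : TM A Obs Act) : Nonempty (Coding M) := by
  have := M.finiteState
  have := M.finiteWork
  obtain ⟨n, f, g, h₁, h₂, h₃⟩ := exists_coding M.Work M.blank
  obtain ⟨n', f', g', h₁', h₂', h₃'⟩ := exists_coding M.State M.start
  exact ⟨⟨n + n', f, g, h₁, fun w => (h₂ w).trans_le (by omega), h₃, f', g', h₁',
    fun w => (h₂' w).trans_le (by omega), h₃'⟩⟩

section Bank

variable {A Obs Act : Type} {M : TM A Obs Act} (cd : Coding M)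

/-- The new contents to the left of the head if the digit `w` is written. -/
def newLeft (N b l w : ℕ) : Dir → ℕ
  | .left => l / b
  | .stay => l
  | .right => (l * b + (w + 1)) % N

/-- The new contents from the head on if the digit `w` is written; here `r` stands for the contents
to the right of the head. -/
def newRight (N b l r w : ℕ) : Dir → ℕ
  | .left => if l = 0 then (r * b + w) % N else ((r * b + w) % N * b + (l % b - 1)) % N
  | .stay => (r * b + w) % N
  | .right => r

/-- The bank after reading the state and the scanned symbols. -/
def Coding.loadB (β : Slot M.k → ℕ) : Slot M.k → ℕ
  | .state => β .state / (cd.d + 2)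
  | .pos => β .pos
  | .left i => β (.left i)
  | .right i => β (.right i) / (cd.d + 2)

/-- The bank after execution of an instruction. -/
noncomputable def Coding.execB (N : ℕ) (β : Slot M.k → ℕ) (m : Instr M.State M.Work M.k Act)
    (a : InputCell A) : Slot M.k → ℕ
  | .state => (β .state * (cd.d + 2) + cd.encQ m.next) % N
  | .pos => open Classical in match m.inputDir with
    | .left => β .pos - 1
    | .stay => β .pos
    | .right => if a = .rightEnd then β .pos else (β .pos + 1) % N
  | .left i => newLeft N (cd.d + 2) (β (.left i)) (cd.encW (m.write i)) (m.workDir i)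
  | .right i => newRight N (cd.d + 2) (β (.left i)) (β (.right i)) (cd.encW (m.write i))
      (m.workDir i)

def Coding.state (β : Slot M.k → ℕ) : M.State := cd.decQ (β .state % (cd.d + 2))

def Coding.syms (β : Slot M.k → ℕ) (i : Fin M.k) : M.Work := cd.decW (β (.right i) % (cd.d + 2))

/-- The bank after one step. -/
noncomputable def Coding.stepB (N : ℕ) (x : List A) (β : Slot M.k → ℕ) (m : Instr M.State M.Work M.k Act) :
    Slot M.k → ℕ :=
  cd.execB N (cd.loadB β) m (readInput x (β .pos))

/-- The bank represents the configuration. -/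
structure Coding.Rep (β : Slot M.k → ℕ) (c : M.Cfg) : Prop where
  state : β .state = cd.encQ c.state
  pos : β .pos = c.inputHead
  left : ∀ i, ∀ j < c.head i,
    β (.left i) / (cd.d + 2) ^ j % (cd.d + 2) = cd.encW (c.tape i (c.head i - 1 - j)) + 1
  left_end : ∀ i, β (.left i) / (cd.d + 2) ^ c.head i = 0
  right : ∀ i j, β (.right i) / (cd.d + 2) ^ j % (cd.d + 2) = cd.encW (c.tape i (c.head i + j))

/-- Only the first `S + 1` cells have been used. -/
def TM.Cfg.Tight (c : M.Cfg) (S : ℕ) : Prop :=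
  ∀ i, c.head i ≤ S ∧ ∀ j, S < j → c.tape i j = M.blank

/-- A number that is at least `b ^ m` has its leading digit, which is nonzero, at a place `j ≥ m`.
-/
theorem lt_pow_of_digits {b r m : ℕ} (hb : 2 ≤ b) (h : ∀ j, m ≤ j → r / b ^ j % b = 0) :
    r < b ^ m := by
  by_contra hcon
  have hr : r ≠ 0 := by
    rintro rfl
    exact hcon (by positivity)
  have h₁ := Nat.pow_log_le_self b hr
  have h₂ := Nat.lt_pow_succ_log_self (show 1 < b by omega) r
  have h₃ : m ≤ Nat.log b r := Nat.le_log_of_pow_le (by omega) (by omega)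
  have h₄ := h _ h₃
  have h₅ : r / b ^ Nat.log b r < b := by
    rw [Nat.div_lt_iff_lt_mul (by positivity), ← pow_succ']
    exact h₂
  have h₆ : 0 < r / b ^ Nat.log b r := Nat.div_pos h₁ (by positivity)
  rw [Nat.mod_eq_of_lt h₅] at h₄
  omega

variable {cd}

theorem Coding.Rep.cfg_state {β : Slot M.k → ℕ} {c : M.Cfg} (h : cd.Rep β c) :
    cd.state β = c.state := by
  rw [Coding.state, h.state, Nat.mod_eq_of_lt (cd.encQ_lt _), cd.dec_encQ]

theorem Coding.Rep.cfg_syms {β : Slot M.k → ℕ} {c : M.Cfg} (h : cd.Rep β c) (i : Fin M.k) :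
    cd.syms β i = c.tape i (c.head i) := by
  have := h.right i 0
  rw [pow_zero, Nat.div_one, Nat.add_zero] at this
  rw [Coding.syms, this, cd.dec_encW, add_zero]

theorem Coding.Rep.right_lt {β : Slot M.k → ℕ} {c : M.Cfg} {S : ℕ} (h : cd.Rep β c)
    (hc : c.Tight S) (i : Fin M.k) : β (.right i) < (cd.d + 2) ^ (S + 1) := by
  refine lt_pow_of_digits (by omega) fun j hj => ?_
  rw [h.right, (hc i).2 _ (by omega), cd.encW_blank]

theorem Coding.Rep.left_lt {β : Slot M.k → ℕ} {c : M.Cfg} {S : ℕ} (h : cd.Rep β c)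
    (hc : c.Tight S) (i : Fin M.k) : β (.left i) < (cd.d + 2) ^ (S + 1) := by
  have := h.left_end i
  rw [Nat.div_eq_zero_iff] at this
  have := this.resolve_left (by positivity)
  exact this.trans_le (Nat.pow_le_pow_right (by omega) (by have := (hc i).1; omega))

theorem Coding.rep_init : cd.Rep (fun _ => 0) M.init where
  state := cd.encQ_start.symm
  pos := rfl
  left i j hj := by simp [TM.init] at hj
  left_end i := by simp
  right i j := by simp [TM.init, cd.encW_blank]

theorem TM.Cfg.Tight.exec {c : M.Cfg} {S : ℕ} {x : List A} {m : Instr M.State M.Work M.k Act}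
    (h : c.Tight S) (h' : (M.exec x c m).WorkBounded S) : (M.exec x c m).Tight S := fun i =>
  ⟨h' i, fun j hj => by
    simp only [TM.exec]
    rw [Function.update_of_ne (by have := (h i).1; omega)]
    exact (h i).2 j hj⟩

theorem push_div {b r a j : ℕ} (ha : a < b) : (r * b + a) / b ^ (j + 1) = r / b ^ j := by
  rw [pow_succ', ← Nat.div_div_eq_div_mul, mul_comm r b, Nat.mul_add_div (by omega),
    Nat.div_eq_of_lt ha, add_zero]

theorem push_mod {b r a : ℕ} (ha : a < b) : (r * b + a) % b = a := by
  rw [mul_comm, Nat.mul_add_mod, Nat.mod_eq_of_lt ha]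

/-- The two halves of a tape are stacks that meet at the head, so a head move transfers one symbol
between two numbers. The space bound keeps both stacks below `(d + 2) ^ (S + 1) ≤ N`, and therefore
no reduction modulo `N` takes effect. -/
theorem Coding.Rep.step {β : Slot M.k → ℕ} {c : M.Cfg} {S N : ℕ} {x : List A}
    {m : Instr M.State M.Work M.k Act} (h : cd.Rep β c) (hc : c.Tight S)
    (h' : (M.exec x c m).WorkBounded S) (hN : (cd.d + 2) ^ (S + 1) ≤ N) (hx : x.length + 1 < N)
    (hp : c.inputHead ≤ x.length + 1) : cd.Rep (cd.stepB N x β m) (M.exec x c m) := by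
  set b := cd.d + 2 with hb
  have hexec := hc.exec h'
  have hw : ∀ i, cd.encW (m.write i) < b := fun i => (cd.encW_lt _).trans (by omega)
  -- the contents from the head on, after writing
  have hR : ∀ i j, (β (.right i) / b * b + cd.encW (m.write i)) / b ^ j % b =
      cd.encW (Function.update (c.tape i) (c.head i) (m.write i) (c.head i + j)) := by
    intro i j
    cases j with
    | zero => rw [pow_zero, Nat.div_one, push_mod (hw i), add_zero, Function.update_self]
    | succ j =>
      rw [push_div (hw i), Function.update_of_ne (by omega), ← h.right i (j + 1),
        Nat.div_div_eq_div_mul, ← pow_succ']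
  have hR' : ∀ i, β (.right i) / b * b + cd.encW (m.write i) < N := fun i => by
    refine lt_of_lt_of_le (lt_pow_of_digits (m := S + 1) (by omega) fun j hj => ?_) hN
    rw [hR, Function.update_of_ne (by omega), (hc i).2 _ (by omega), cd.encW_blank]
  refine ⟨?_, ?_, fun i => ?_, fun i => ?_, fun i => ?_⟩
  · have h1 := cd.encQ_lt c.state
    have h2 := cd.encQ_lt m.next
    have h3 : b ≤ N := le_trans (by rw [pow_succ]; exact Nat.le_mul_of_pos_left _ (by positivity)) hN
    show (β .state / b * b + cd.encQ m.next) % N = cd.encQ m.next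
    rw [h.state, Nat.div_eq_of_lt h1, zero_mul, zero_add, Nat.mod_eq_of_lt (by omega)]
  · simp only [Coding.stepB, Coding.execB, Coding.loadB, TM.exec, h.pos]
    cases m.inputDir with
    | left => rfl
    | stay => rfl
    | right =>
      simp only [Dir.moveInput]
      by_cases he : readInput x (β .pos) = .rightEnd
      · rw [if_pos he]
        rw [readInput_eq_rightEnd, h.pos] at he
        omega
      · rw [if_neg he]
        rw [readInput_eq_rightEnd, h.pos] at he
        rw [Nat.mod_eq_of_lt (by omega)]
        omega
  · have hl := h.left i
    have hle := h.left_end i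
    have hhd := hexec i
    revert hhd
    simp only [Coding.stepB, Coding.execB, Coding.loadB, TM.exec]
    cases m.workDir i with
    | left =>
      intro hhd j hj
      simp only [Dir.moveWork, newLeft] at hj ⊢
      rw [Nat.div_div_eq_div_mul, ← pow_succ', hl _ (by omega),
        Function.update_of_ne (by omega)]
      congr 3
      omega
    | stay =>
      intro hhd j hj
      simp only [Dir.moveWork, newLeft] at hj ⊢
      rw [hl _ (by omega), Function.update_of_ne (by omega)]
    | right =>
      intro hhd j hj
      simp only [Dir.moveWork, newLeft] at hj hhd ⊢
      have hwi : cd.encW (m.write i) + 1 < b := by have := cd.encW_lt (m.write i); omega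
      -- The head is still within `S` after the move, so before it the left stack has at most `S`
      -- digits, and there is room for one more.
      have hlt : β (.left i) * b + (cd.encW (m.write i) + 1) < N := by
        have h1 : β (.left i) < b ^ S := by
          rw [Nat.div_eq_zero_iff] at hle
          exact (hle.resolve_left (by positivity)).trans_le
            (Nat.pow_le_pow_right (by omega) (by omega))
        rw [pow_succ] at hN
        have := Nat.mul_le_mul_right b (Nat.succ_le_of_lt h1)
        rw [Nat.succ_mul] at this
        omega
      rw [Nat.mod_eq_of_lt hlt]
      cases j with
      | zero =>
        rw [pow_zero, Nat.div_one, push_mod hwi]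
        simp
      | succ j =>
        rw [push_div hwi, hl _ (by omega), Function.update_of_ne (by omega)]
        congr 3
        omega
  · have hle := h.left_end i
    have hhd := hexec i
    revert hhd
    simp only [Coding.stepB, Coding.execB, Coding.loadB, TM.exec]
    cases m.workDir i with
    | left =>
      intro hhd
      simp only [Dir.moveWork, newLeft]
      cases hh : c.head i with
      | zero =>
        rw [hh, pow_zero, Nat.div_one] at hle
        simp [hle]
      | succ j =>
        rw [hh] at hle
        rw [Nat.div_div_eq_div_mul, ← pow_succ']
        exact hle
    | stay => exact fun _ => hle
    | right =>
      intro hhd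
      simp only [Dir.moveWork, newLeft] at hhd ⊢
      have hwi : cd.encW (m.write i) + 1 < b := by have := cd.encW_lt (m.write i); omega
      have hlt : β (.left i) * b + (cd.encW (m.write i) + 1) < N := by
        have h1 : β (.left i) < b ^ S := by
          rw [Nat.div_eq_zero_iff] at hle
          exact (hle.resolve_left (by positivity)).trans_le
            (Nat.pow_le_pow_right (by omega) (by omega))
        rw [pow_succ] at hN
        have := Nat.mul_le_mul_right b (Nat.succ_le_of_lt h1)
        rw [Nat.succ_mul] at this
        omega
      rw [Nat.mod_eq_of_lt hlt, push_div hwi]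
      exact hle
  · intro j
    have hl := h.left i
    have hle := h.left_end i
    simp only [Coding.stepB, Coding.execB, Coding.loadB, TM.exec]
    cases m.workDir i with
    | left =>
      simp only [Dir.moveWork, newRight]
      rw [Nat.mod_eq_of_lt (hR' i)]
      cases hh : c.head i with
      | zero =>
        rw [hh, pow_zero, Nat.div_one] at hle
        rw [if_pos hle, hR, hh]
      | succ n =>
        have hl0 := hl 0 (by omega)
        rw [pow_zero, Nat.div_one, hh] at hl0
        -- The left stack is not zero, because its lowest digit is a code plus one.
        rw [if_neg (by intro h0; rw [h0, Nat.zero_mod] at hl0; omega)]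
        have hd := cd.encW_lt (c.tape i n)
        have hl0 : β (.left i) % b - 1 = cd.encW (c.tape i n) := by rw [hl0]; simp
        rw [hl0]
        set q := β (.right i) / b * b + cd.encW (m.write i) with hq
        have key : ∀ j, (q * b + cd.encW (c.tape i n)) / b ^ j % b =
            cd.encW (Function.update (c.tape i) (c.head i) (m.write i) (n + j)) := by
          intro j
          cases j with
          | zero =>
            rw [pow_zero, Nat.div_one, push_mod (by omega), Function.update_of_ne (by omega),
              add_zero]
          | succ j =>
            rw [push_div (by omega), hq, hR, hh]
            congr 2
            omega
        have hlt : q * b + cd.encW (c.tape i n) < N := by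
          refine lt_of_lt_of_le (lt_pow_of_digits (m := S + 1) (by omega) fun j hj => ?_) hN
          rw [key, Function.update_of_ne (by have := (hc i).1; omega), (hc i).2 _ (by omega),
            cd.encW_blank]
        rw [Nat.mod_eq_of_lt hlt, key, hh]
        simp
    | stay =>
      simp only [Dir.moveWork, newRight]
      rw [Nat.mod_eq_of_lt (hR' i), hR]
    | right =>
      simp only [Dir.moveWork, newRight]
      rw [Nat.div_div_eq_div_mul, ← pow_succ', h.right, Function.update_of_ne (by omega)]
      congr 2
      omega

theorem Coding.loadB_lt {N : ℕ} {β : Slot M.k → ℕ} (h : ∀ j, β j < N) (j : Slot M.k) :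
    cd.loadB β j < N := by
  cases j with
  | state => exact (Nat.div_le_self _ _).trans_lt (h _)
  | pos => exact h _
  | left i => exact h _
  | right i => exact (Nat.div_le_self _ _).trans_lt (h _)

/-- The enumeration of banks also meets tuples that describe no configuration; the reductions modulo
`N` keep a step within the register range for these as well. -/
theorem Coding.execB_lt {N : ℕ} {β : Slot M.k → ℕ} {m a} (h : ∀ j, β j < N) (j : Slot M.k) :
    cd.execB N β m a j < N := by
  have hN : 0 < N := (Nat.zero_le _).trans_lt (h .state)
  cases j with
  | state => exact Nat.mod_lt _ hN
  | pos =>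
    have := h .pos
    simp only [Coding.execB]
    split
    · omega
    · exact this
    · split_ifs
      · exact this
      · exact Nat.mod_lt _ hN
  | left i =>
    have := h (.left i)
    simp only [Coding.execB]
    cases m.workDir i
    · exact (Nat.div_le_self _ _).trans_lt this
    · exact this
    · exact Nat.mod_lt _ hN
  | right i =>
    have := h (.right i)
    simp only [Coding.execB]
    cases m.workDir i
    · simp only [newRight]
      split_ifs <;> exact Nat.mod_lt _ hN
    · exact Nat.mod_lt _ hN
    · exact this

end Bank

/-! ### Simulation of single steps -/

/-- The finite memory of a simulating machine: a part `u` for other purposes, and what is known about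
the simulated machine. -/
structure SimV {A Obs Act : Type} (M : TM A Obs Act) (U : Type) where
  u : U
  cell : InputCell A
  q : M.State
  w : Fin M.k → M.Work
  m : Instr M.State M.Work M.k Act

instance {A : Type} [Finite A] : Finite (InputCell A) := by
  refine Finite.of_surjective (α := Option (Option A))
    (fun
      | none => .leftEnd
      | some none => .rightEnd
      | some (some a) => .letter a) ?_
  rintro (_ | a | _)
  exacts [⟨none, rfl⟩, ⟨some (some a), rfl⟩, ⟨some none, rfl⟩]

instance : Finite Dir := by
  refine Finite.of_surjective (α := Option Bool)
    (fun
      | none => .stay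
      | some false => .left
      | some true => .right) ?_
  rintro (_ | _ | _)
  exacts [⟨some false, rfl⟩, ⟨none, rfl⟩, ⟨some true, rfl⟩]

instance {Q W Act : Type} {k : ℕ} [Finite Q] [Finite W] [Finite Act] :
    Finite (Instr Q W k Act) :=
  Finite.of_injective (fun m => (m.next, m.write, m.workDir, m.inputDir, m.act)) (by
    rintro ⟨⟩ ⟨⟩ h
    simpa using h)

instance {A Obs Act U : Type} [Finite A] [Finite Act] [Finite U] (M : TM A Obs Act) :
    Finite (SimV M U) :=
  have := M.finiteState
  have := M.finiteWork
  Finite.of_injective (fun v => (v.u, v.cell, v.q, v.w, v.m)) (by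
    rintro ⟨⟩ ⟨⟩ h
    simpa using h)

section Sim

variable {A Obs' Act' Obs Act E U K : Type} [DecidableEq K] {M : TM A Obs' Act'} (cd : Coding M)
  (π : Port Obs Act E)

abbrev SimMem (cd : Coding M) (U : Type) := Fin (cd.d + 2) × SimV M U

abbrev SimState (cd : Coding M) (U K E : Type) := RState (SimMem cd U) (Reg K M.k) E

abbrev SimProg (cd : Coding M) (U K Obs Act : Type) := RProg (SimMem cd U) A (Reg K M.k) Obs Act

variable {cd}

def SimState.bank (s : SimState cd U K E) (κ : K) : Slot M.k → ℕ := fun j => s.reg (.bank κ j)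

def setBank {k : ℕ} (reg : Reg K k → ℕ) (κ : K) (β : Slot k → ℕ) : Reg K k → ℕ
  | .bank κ' j => if κ' = κ then β j else reg (.bank κ' j)
  | r => reg r

/-- The auxiliary data have their standard values. -/
structure SimState.Good (N : ℕ) (s : SimState cd U K E) : Prop where
  pos : s.pos = 0
  aux : s.reg .aux = 0
  tmp : s.reg .tmp = 0
  dig : s.v.1 = 0
  lt : ∀ i, s.reg i < N

variable (cd)

/-- Read the state and the scanned symbols of the configuration in a bank. -/
def load (κ : K) : SimProg cd U K Obs Act :=
  .seq (popTo π .tmp (.bank κ .state) fun n v => { v with q := cd.decQ n })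
  (.seq (seqs ((List.finRange M.k).map fun i => popTo π .tmp (.bank κ (.right i))
    fun n v => { v with w := Function.update v.w i (cd.decW n) }))
  (read π .tmp .aux (.bank κ .pos) fun v a => (v.1, { v.2 with cell := a })))

/-- A left move is a write without a move, followed by the transfer of one symbol from the left
stack to the right one. The transfer is omitted if the left stack is empty, in accordance with a
head that stays in cell `0`. Stored digits on the left exceed the code by one, hence `v.1.val - 1`.
-/
def execTape (κ : K) (i : Fin M.k) : SimProg cd U K Obs Act :=
  .ite (mem fun v => v.2.m.workDir i = .right)
    (push .tmp (.bank κ (.left i)) (cd.d + 2) fun v => cd.encW (v.2.m.write i) + 1)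
    (.seq (push .tmp (.bank κ (.right i)) (cd.d + 2) fun v => cd.encW (v.2.m.write i))
      (.ite (fun w => w.v.2.m.workDir i = .left ∧ ¬ w.zero (.bank κ (.left i)))
        (.seq (pop π .tmp (.bank κ (.left i)))
          (.seq (push .tmp (.bank κ (.right i)) (cd.d + 2) fun v => v.1.val - 1)
            (upd π fun v => (0, v.2))))
        .skip))

/-- Execute the stored instruction. -/
def exec (κ : K) : SimProg cd U K Obs Act :=
  .seq (push .tmp (.bank κ .state) (cd.d + 2) fun v => cd.encQ v.2.m.next)
  (.seq (seqs ((List.finRange M.k).map (execTape cd π κ)))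
  (.ite (mem fun v => v.2.m.inputDir = .left) (dec (.bank κ .pos))
    (.ite (mem fun v => v.2.m.inputDir = .right ∧ v.2.cell ≠ .rightEnd) (inc (.bank κ .pos))
      .skip)))

variable {cd π} {x : List A} {N : ℕ} {s : SimState cd U K E} {κ : K}

omit [DecidableEq K] in
theorem det_load : (load cd π κ : SimProg cd U K Obs Act).Det :=
  ⟨det_popTo, det_seqs (by simp only [List.mem_map]; rintro _ ⟨i, -, rfl⟩; exact det_popTo),
    det_read⟩

omit [DecidableEq K] in
theorem det_exec : (exec cd π κ : SimProg cd U K Obs Act).Det := by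
  refine ⟨det_push, det_seqs ?_, trivial, trivial, trivial⟩
  simp only [List.mem_map]
  rintro _ ⟨i, -, rfl⟩
  refine ⟨det_push, det_push, ⟨?_, det_push, trivial⟩, trivial⟩
  simp [pop, drain, Det, upd, inc, dec]

/-- Reading is destructive: extracting a digit divides the register, and `exec` later pushes the new
state and the written symbols in place of the removed digits. -/
theorem run_load (hs : s.Good N) : (load cd π κ : SimProg cd U K Obs Act).Run (RSem π x N) s
    { s with
      v := (0, { s.v.2 with
        cell := readInput x (s.bank κ .pos)
        q := cd.state (s.bank κ)
        w := cd.syms (s.bank κ) })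
      reg := setBank s.reg κ (cd.loadB (s.bank κ)) } := by
  have hb : ∀ j, s.bank κ j < N := fun j => hs.lt _
  refine ⟨_, run_popTo (by simp) hs.tmp (hs.lt _), ?_⟩
  -- The state after the tapes in `l` have been read; their right stacks have lost the top symbol.
  let G : List (Fin M.k) → SimState cd U K E := fun l =>
    { s with
      v := (0, { s.v.2 with
        q := cd.state (s.bank κ)
        w := fun i => if i ∈ l then cd.syms (s.bank κ) i else s.v.2.w i })
      reg := setBank s.reg κ fun
        | .state => s.bank κ .state / (cd.d + 2)
        | .pos => s.bank κ .pos
        | .left i => s.bank κ (.left i)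
        | .right i => if i ∈ l then s.bank κ (.right i) / (cd.d + 2) else s.bank κ (.right i) }
  refine ⟨G (List.finRange M.k), ?_, ?_⟩
  · convert run_seqs_map G (L := List.finRange M.k) ?_ using 1
    · simp only [G, RState.set, RState.mk.injEq, and_true, List.not_mem_nil, if_false]
      refine ⟨rfl, funext fun r => ?_⟩
      rcases r with ⟨κ', j⟩ | _ | _ | _
      · by_cases hκ : κ' = κ
        · subst hκ
          cases j <;> simp [setBank, SimState.bank]
        · simp [setBank, hκ]
      all_goals simp [setBank]
    · intro l₁ a l₂ hl
      have ha : a ∉ l₁ := by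
        have := List.nodup_finRange M.k
        rw [hl, List.nodup_append] at this
        exact fun h => this.2.2 a h a (by simp) rfl
      convert run_popTo (s := G l₁) (t := .tmp) (i := .bank κ (.right a)) (by simp) ?_ ?_ using 1
      · simp only [G, RState.set, RState.mk.injEq, and_true, Prod.mk.injEq, true_and,
          SimV.mk.injEq]
        refine ⟨funext fun i => ?_, funext fun r => ?_⟩
        · by_cases hi : i = a
          · subst hi
            simp [setBank, ha, Coding.syms]
          · simp [hi]
        · rcases r with ⟨κ', j⟩ | _ | _ | _
          · by_cases hκ : κ' = κ
            · subst hκ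
              rcases j with _ | _ | i | i
              · simp [setBank]
              · simp [setBank]
              · simp [setBank]
              · by_cases hi : i = a
                · subst hi; simp [setBank, ha]
                · simp [setBank, hi]
            · simp [setBank, hκ]
          all_goals simp [setBank]
      · exact hs.tmp
      · simpa [G, setBank, ha] using hb _
  · convert run_read (s := G (List.finRange M.k)) (t := .tmp) (a := .aux) (i := .bank κ .pos) ?_ ?_ ?_
      hs.tmp hs.aux ?_ hs.pos using 1
    · simp only [G, RState.mk.injEq, and_true, List.mem_finRange, if_true]
      refine ⟨?_, ?_⟩
      · simp [setBank]
      · congr 1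
    · simp
    · simp
    · simp
    · simpa [G, setBank] using hb _

theorem run_execTape {i : Fin M.k} (hs : s.Good N) :
    (execTape cd π κ i : SimProg cd U K Obs Act).Run (RSem π x N) s
    { s with
      reg := Function.update (Function.update s.reg (.bank κ (.left i))
        (newLeft N (cd.d + 2) (s.bank κ (.left i)) (cd.encW (s.v.2.m.write i))
          (s.v.2.m.workDir i))) (.bank κ (.right i))
        (newRight N (cd.d + 2) (s.bank κ (.left i)) (s.bank κ (.right i))
          (cd.encW (s.v.2.m.write i)) (s.v.2.m.workDir i)) } := by
  have hw := cd.encW_lt (s.v.2.m.write i)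
  have hN : 0 < N := (Nat.zero_le _).trans_lt (hs.lt .aux)
  by_cases hd : s.v.2.m.workDir i = .right
  · refine Run.ite_pos hd ?_
    convert run_push (i := .bank κ (.left i)) (by simp) hs.tmp (hs.lt _) _ using 1
    · simp only [RState.set, hd, newLeft, newRight, SimState.bank, RState.mk.injEq, true_and,
        and_true]
      funext r
      by_cases hr : r = .bank κ (.right i)
      · subst hr; simp
      · simp [hr]
    · omega
  refine Run.ite_neg hd ⟨_, run_push (by simp) hs.tmp (hs.lt _) (by omega), ?_⟩
  by_cases hz : s.v.2.m.workDir i = .left ∧ s.reg (.bank κ (.left i)) ≠ 0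
  · refine Run.ite_pos ⟨hz.1, ?_⟩ ⟨_, run_pop (by simp) ?_ ?_, _, run_push (by simp) ?_ ?_ ?_, ?_⟩
    · simpa [RState.view, RState.set] using hz.2
    · simpa [RState.set] using hs.tmp
    · simpa [RState.set] using hs.lt _
    · simpa [RState.set] using hs.tmp
    · simpa [RState.set] using Nat.mod_lt _ hN
    · simp only [Fin.val_ofNat]
      have := Nat.mod_lt (s.reg (.bank κ (.left i)) % (cd.d + 2)) (show 0 < cd.d + 2 by omega)
      simp [RState.set] at this ⊢
      omega
    · convert run_upd using 1
      simp only [RState.set, hz.1, newLeft, newRight, SimState.bank, RState.mk.injEq, and_true]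
      refine ⟨Prod.ext hs.dig rfl, funext fun r => ?_⟩
      by_cases hr : r = .bank κ (.right i)
      · subst hr; simp [hz.2]
      · by_cases hl : r = .bank κ (.left i)
        · subst hl; simp
        · simp [hr, hl]
  · refine Run.ite_neg ?_ ?_
    · simpa [RState.view, RState.set, RSem] using hz
    · show _ = _
      simp only [RState.set, RState.mk.injEq, true_and, and_true]
      funext r
      have hL : newLeft N (cd.d + 2) (s.bank κ (.left i)) (cd.encW (s.v.2.m.write i))
          (s.v.2.m.workDir i) = s.reg (.bank κ (.left i)) := by
        revert hd hz
        cases s.v.2.m.workDir i with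
        | left =>
          intro _ h
          simp only [true_and, not_not] at h
          simp [newLeft, SimState.bank, h]
        | stay => intro _ _; rfl
        | right => intro h; exact absurd rfl h
      have hR : newRight N (cd.d + 2) (s.bank κ (.left i)) (s.bank κ (.right i))
          (cd.encW (s.v.2.m.write i)) (s.v.2.m.workDir i) =
          (s.reg (.bank κ (.right i)) * (cd.d + 2) + cd.encW (s.v.2.m.write i)) % N := by
        revert hd hz
        cases s.v.2.m.workDir i with
        | left =>
          intro _ h
          simp only [true_and, not_not] at h
          simp [newRight, SimState.bank, h]
        | stay => intro _ _; rfl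
        | right => intro h; exact absurd rfl h
      rw [hL, hR]
      simp

theorem run_exec (hs : s.Good N) : (exec cd π κ : SimProg cd U K Obs Act).Run (RSem π x N) s
    { s with reg := setBank s.reg κ (cd.execB N (s.bank κ) s.v.2.m s.v.2.cell) } := by
  have hN : 0 < N := (Nat.zero_le _).trans_lt (hs.lt .aux)
  refine ⟨_, run_push (by simp) hs.tmp (hs.lt _) (cd.encQ_lt _).le, ?_⟩
  let G : List (Fin M.k) → SimState cd U K E := fun l =>
    { s with
      reg := setBank s.reg κ fun
        | .state => cd.execB N (s.bank κ) s.v.2.m s.v.2.cell .state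
        | .pos => s.bank κ .pos
        | .left i => if i ∈ l then cd.execB N (s.bank κ) s.v.2.m s.v.2.cell (.left i)
            else s.bank κ (.left i)
        | .right i => if i ∈ l then cd.execB N (s.bank κ) s.v.2.m s.v.2.cell (.right i)
            else s.bank κ (.right i) }
  have hb : ∀ j, s.bank κ j < N := fun j => hs.lt _
  have hlt := cd.execB_lt (m := s.v.2.m) (a := s.v.2.cell) hb
  have hG : ∀ l, (G l).Good N := by
    intro l
    refine ⟨hs.pos, hs.aux, hs.tmp, hs.dig, fun r => ?_⟩
    rcases r with ⟨κ', j⟩ | _ | _ | _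
    · by_cases hκ : κ' = κ
      · subst hκ
        rcases j with _ | _ | i | i
        · simpa [G, setBank] using hlt .state
        · simpa [G, setBank] using hb _
        · by_cases hi : i ∈ l
          · simpa [G, setBank, hi] using hlt (.left i)
          · simpa [G, setBank, hi] using hb _
        · by_cases hi : i ∈ l
          · simpa [G, setBank, hi] using hlt (.right i)
          · simpa [G, setBank, hi] using hb _
      · simpa [G, setBank, hκ] using hs.lt _
    all_goals simpa [G, setBank] using hs.lt _
  refine ⟨G (List.finRange M.k), ?_, ?_⟩
  · convert run_seqs_map G (L := List.finRange M.k) ?_ using 1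
    · simp only [G, RState.set, RState.mk.injEq, and_true, true_and, List.not_mem_nil, if_false]
      funext r
      rcases r with ⟨κ', j⟩ | _ | _ | _
      · by_cases hκ : κ' = κ
        · subst hκ
          cases j <;> simp [setBank, SimState.bank, Coding.execB]
        · simp [setBank, hκ]
      all_goals simp [setBank]
    · intro l₁ a l₂ hl
      have ha : a ∉ l₁ := by
        have := List.nodup_finRange M.k
        rw [hl, List.nodup_append] at this
        exact fun h => this.2.2 a h a (by simp) rfl
      convert run_execTape (hG l₁) using 1
      simp only [G, RState.mk.injEq, and_true, true_and]
      funext r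
      rcases r with ⟨κ', j⟩ | _ | _ | _
      · by_cases hκ : κ' = κ
        · subst hκ
          rcases j with _ | _ | i | i
          · simp [setBank]
          · simp [setBank]
          · by_cases hi : i = a
            · subst hi; simp [setBank, ha, Coding.execB, SimState.bank]
            · simp [setBank, hi]
          · by_cases hi : i = a
            · subst hi; simp [setBank, ha, Coding.execB, SimState.bank]
            · simp [setBank, hi]
        · simp [setBank, hκ]
      all_goals simp [setBank]
  · have hpos : ∀ p, p = cd.execB N (s.bank κ) s.v.2.m s.v.2.cell .pos →
        { s with reg := setBank s.reg κ (cd.execB N (s.bank κ) s.v.2.m s.v.2.cell) } =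
        (G (List.finRange M.k)).set (.bank κ .pos) p := by
      rintro p rfl
      simp only [G, RState.set, RState.mk.injEq, and_true, true_and, List.mem_finRange, if_true]
      funext r
      rcases r with ⟨κ', j⟩ | _ | _ | _
      · by_cases hκ : κ' = κ
        · subst hκ
          cases j <;> simp [setBank]
        · simp [setBank, hκ]
      all_goals simp [setBank]
    have hGp : (G (List.finRange M.k)).reg (.bank κ .pos) = s.bank κ .pos := by
      simp [G, setBank]
    by_cases h₁ : s.v.2.m.inputDir = .left
    · rw [hpos (s.bank κ .pos - 1) (by simp [Coding.execB, h₁])]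
      refine Run.ite_pos h₁ ?_
      show _ = _
      rw [hGp]
      rfl
    · refine Run.ite_neg h₁ ?_
      by_cases h₂ : s.v.2.m.inputDir = .right ∧ s.v.2.cell ≠ .rightEnd
      · rw [hpos ((s.bank κ .pos + 1) % N) (by simp [Coding.execB, h₂])]
        refine Run.ite_pos h₂ ?_
        show _ = _
        rw [hGp]
        rfl
      · refine Run.ite_neg h₂ ?_
        show _ = _
        rw [hpos (s.bank κ .pos), ← hGp, RState.set, Function.update_eq_self]
        revert h₁ h₂
        simp only [Coding.execB]
        cases s.v.2.m.inputDir with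
        | left => simp
        | stay => simp
        | right =>
          intro _ h
          simp only [true_and, not_not] at h
          simp [h]

variable (cd π) in
/-- One step of the simulated machine on a bank; `g` determines the instruction from what the
simulated machine sees. -/
def simStep (κ : K) (g : U → M.State → InputCell A → (Fin M.k → M.Work) →
    U × Instr M.State M.Work M.k Act') : SimProg cd U K Obs Act :=
  .seq (load cd π κ) (.seq (upd π fun v => (v.1, { v.2 with
    u := (g v.2.u v.2.q v.2.cell v.2.w).1
    m := (g v.2.u v.2.q v.2.cell v.2.w).2 })) (exec cd π κ))

omit [DecidableEq K] in
theorem det_simStep {g} : (simStep cd π κ g : SimProg cd U K Obs Act).Det :=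
  ⟨det_load, trivial, det_exec⟩

theorem SimState.Good.setBank (hs : s.Good N) {β : Slot M.k → ℕ} (hβ : ∀ j, β j < N)
    {v : SimMem cd U} (hv : v.1 = 0) {e : E} :
    SimState.Good N (⟨v, RegReal.setBank s.reg κ β, s.pos, e⟩ : SimState cd U K E) := by
  refine ⟨hs.pos, hs.aux, hs.tmp, hv, fun r => ?_⟩
  rcases r with ⟨κ', j⟩ | _ | _ | _
  · simp only [RegReal.setBank]
    split_ifs
    · exact hβ j
    · exact hs.lt _
  all_goals exact hs.lt _

omit [DecidableEq K] in
theorem SimState.Good.congr (hs : s.Good N) {v : SimMem cd U} (hv : v.1 = 0) {e : E} :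
    SimState.Good N (⟨v, s.reg, s.pos, e⟩ : SimState cd U K E) :=
  ⟨hs.pos, hs.aux, hs.tmp, hv, hs.lt⟩

theorem setBank_bank {v : SimMem cd U} {reg p} {e : E} {β : Slot M.k → ℕ} :
    SimState.bank (⟨v, setBank reg κ β, p, e⟩ : SimState cd U K E) κ = β := by
  funext j
  simp [SimState.bank, setBank]

theorem setBank_setBank {reg : Reg K M.k → ℕ} {β β' : Slot M.k → ℕ} :
    setBank (setBank reg κ β) κ β' = setBank reg κ β' := by
  funext r
  rcases r with ⟨κ', j⟩ | _ | _ | _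
  · by_cases h : κ' = κ <;> simp [setBank, h]
  all_goals rfl

/-- Of the new memory only the cleared digit and the part `u` are specified; the records about the
simulated machine are overwritten at the next step. -/
theorem run_simStep (hs : s.Good N) (g : U → M.State → InputCell A → (Fin M.k → M.Work) →
    U × Instr M.State M.Work M.k Act') :
    ∃ v : SimMem cd U, v.1 = 0 ∧
      v.2.u = (g s.v.2.u (cd.state (s.bank κ)) (readInput x (s.bank κ .pos))
        (cd.syms (s.bank κ))).1 ∧
      SimState.Good N (⟨v, setBank s.reg κ (cd.stepB N x (s.bank κ)
        (g s.v.2.u (cd.state (s.bank κ)) (readInput x (s.bank κ .pos))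
          (cd.syms (s.bank κ))).2), s.pos, s.port⟩ : SimState cd U K E) ∧
      (simStep cd π κ g : SimProg cd U K Obs Act).Run (RSem π x N) s
      ⟨v, setBank s.reg κ (cd.stepB N x (s.bank κ)
        (g s.v.2.u (cd.state (s.bank κ)) (readInput x (s.bank κ .pos))
          (cd.syms (s.bank κ))).2), s.pos, s.port⟩ := by
  have hb : ∀ j, s.bank κ j < N := fun j => hs.lt _
  have hl := cd.loadB_lt hb
  let v : SimMem cd U := (0, { s.v.2 with
    cell := readInput x (s.bank κ .pos)
    q := cd.state (s.bank κ)
    w := cd.syms (s.bank κ)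
    u := (g s.v.2.u (cd.state (s.bank κ)) (readInput x (s.bank κ .pos)) (cd.syms (s.bank κ))).1
    m := (g s.v.2.u (cd.state (s.bank κ)) (readInput x (s.bank κ .pos)) (cd.syms (s.bank κ))).2 })
  refine ⟨v, rfl, rfl, hs.setBank (fun j => cd.execB_lt hl j) rfl, _, run_load hs, _, run_upd, ?_⟩
  convert run_exec (s := ⟨v, RegReal.setBank s.reg κ (cd.loadB (s.bank κ)), s.pos, s.port⟩)
    (hs.setBank hl rfl) using 1
  simp only [setBank_bank, setBank_setBank]
  rfl

end Sim

end RegReal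

/-! ### Machines as systems on banks, and automata that simulate such systems -/

namespace RegReal

open Relation Prog RProg

/-! ### Computations on banks -/

section BankRun

variable {A Obs Act E : Type} {M : TM A Obs Act} (cd : Coding M) (π : Port Obs Act E)

/-- The instructions that are possible in the configuration stored in a bank. -/
def Coding.instrs (x : List A) (β : Slot M.k → ℕ) (o : Obs) : Set (Instr M.State M.Work M.k Act) :=
  M.trans (cd.state β) (readInput x (β .pos)) (cd.syms β) o

/-- Moves of a machine on banks. -/
def BMove (N : ℕ) (x : List A) (p q : (Slot M.k → ℕ) × E) : Prop :=
  ∃ m ∈ cd.instrs x p.1 (π.obs p.2), q = (cd.stepB N x p.1 m, π.app m.act p.2)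

/-- The bank represents a configuration in which the heads are within their bounds. -/
structure Coding.Corr (S : ℕ) (x : List A) (β : Slot M.k → ℕ) (c : M.Cfg) : Prop where
  rep : cd.Rep β c
  tight : c.Tight S
  head : c.inputHead ≤ x.length + 1

variable {cd π} {N S : ℕ} {x : List A} {β β' : Slot M.k → ℕ} {c c' : M.Cfg} {e e' : E}

theorem Coding.Rep.enabled (h : cd.Rep β c) (o : Obs) : M.enabled x c o = cd.instrs x β o := by
  rw [TM.enabled, Coding.instrs, h.cfg_state, h.pos]
  congr 1
  funext i
  exact (h.cfg_syms i).symm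

theorem Coding.Corr.lt (h : cd.Corr S x β c) (j : Slot M.k) :
    β j < max ((cd.d + 2) ^ (S + 1)) (x.length + 2) := by
  cases j with
  | state =>
    rw [h.rep.state]
    refine lt_max_of_lt_left ((cd.encQ_lt _).trans_le ?_)
    exact Nat.le_self_pow (by omega) _
  | pos =>
    rw [h.rep.pos]
    exact lt_max_of_lt_right (by have := h.head; omega)
  | left i => exact lt_max_of_lt_left (h.rep.left_lt h.tight i)
  | right i => exact lt_max_of_lt_left (h.rep.right_lt h.tight i)

theorem Coding.corr_init : cd.Corr S x (fun _ => 0) M.init :=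
  ⟨Coding.rep_init, fun _ => ⟨Nat.zero_le _, fun _ _ => rfl⟩, Nat.zero_le _⟩

theorem Coding.Corr.exec (h : cd.Corr S x β c) (hN : max ((cd.d + 2) ^ (S + 1)) (x.length + 2) ≤ N)
    {m} (h' : (M.exec x c m).WorkBounded S) : cd.Corr S x (cd.stepB N x β m) (M.exec x c m) := by
  refine ⟨h.rep.step h.tight h' (le_of_max_le_left hN) (le_of_max_le_right hN) h.head,
    h.tight.exec h', ?_⟩
  have := h.head
  simp only [TM.exec]
  cases m.inputDir <;> simp only [Dir.moveInput] <;> omega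

/-- Configurations and banks run in lockstep as long as the heads stay within `S`, which `H`
guarantees for everything reachable. With the converse `preach_of_breach` the machine is replaced by
a system on tuples of bounded numbers. -/
theorem breach_of_preach (hN : max ((cd.d + 2) ^ (S + 1)) (x.length + 2) ≤ N)
    (H : ∀ p, ReflTransGen (PMove π M x) (M.init, e) p → p.1.WorkBounded S) {p : M.Cfg × E}
    (h : ReflTransGen (PMove π M x) (M.init, e) p) :
    ∃ β, ReflTransGen (BMove cd π N x) (fun _ => 0, e) (β, p.2) ∧ cd.Corr S x β p.1 := by
  induction h with
  | refl => exact ⟨_, .refl, Coding.corr_init⟩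
  | tail h hm ih =>
    obtain ⟨β, hβ, hc⟩ := ih
    have hb := H _ (h.tail hm)
    obtain ⟨a, ⟨m, hm, rfl, hm'⟩, he⟩ := hm
    rw [hm'] at hb ⊢
    rw [hc.rep.enabled] at hm
    exact ⟨_, hβ.tail ⟨m, hm, by rw [he]⟩, hc.exec hN hb⟩

theorem preach_of_breach (hN : max ((cd.d + 2) ^ (S + 1)) (x.length + 2) ≤ N)
    (H : ∀ p, ReflTransGen (PMove π M x) (M.init, e) p → p.1.WorkBounded S)
    {p : (Slot M.k → ℕ) × E} (h : ReflTransGen (BMove cd π N x) (fun _ => 0, e) p) :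
    ∃ c, ReflTransGen (PMove π M x) (M.init, e) (c, p.2) ∧ cd.Corr S x p.1 c := by
  induction h with
  | refl => exact ⟨_, .refl, Coding.corr_init⟩
  | tail h hm ih =>
    obtain ⟨c, h₁, h₂⟩ := ih
    obtain ⟨m, hm, rfl⟩ := hm
    rw [← h₂.rep.enabled] at hm
    have := h₁.tail (show PMove π M x _ (M.exec x c m, _) from ⟨m.act, ⟨m, hm, rfl, rfl⟩, rfl⟩)
    exact ⟨_, this, h₂.exec hN (H _ this)⟩

end BankRun

/-! ### Acceptance of words by automata -/

/-- The automaton accepts the word when started in the given state. -/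
inductive FA.Acc {Γ : Type} (𝒜 : FA Γ) : List Bool → List Γ → Prop
  | nil {q} (h : q ∈ 𝒜.accept) : Acc 𝒜 q []
  | cons {q o r w} (h : ⟨q, o, r⟩ ∈ 𝒜.edges) (h' : Acc 𝒜 r w) : Acc 𝒜 q (o.toList ++ w)

theorem FA.mem_language {Γ : Type} {𝒜 : FA Γ} {y : List Γ} :
    y ∈ 𝒜.language ↔ 𝒜.Acc 𝒜.start y := by
  rw [FA.language, εNFA.mem_accepts_iff_exists_path]
  constructor
  · rintro ⟨s, t, w, rfl, ht, rfl, h⟩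
    change 𝒜.toεNFA.IsPath 𝒜.start t w at h
    generalize 𝒜.start = s at h ⊢
    induction h with
    | nil => exact .nil ht
    | cons t s u o w h _ ih =>
      have : (o :: w).reduceOption = o.toList ++ w.reduceOption := by
        cases o <;> simp
      rw [this]
      exact .cons h (ih ht)
  · intro h
    suffices ∀ q, 𝒜.Acc q y → ∃ t w, t ∈ 𝒜.accept ∧ w.reduceOption = y ∧
        𝒜.toεNFA.IsPath q t w by
      obtain ⟨t, w, h₁, h₂, h₃⟩ := this _ h
      exact ⟨_, t, w, rfl, h₁, h₂, h₃⟩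
    clear h
    intro q h
    induction h with
    | nil h => exact ⟨_, [], h, rfl, .nil _⟩
    | @cons q o r w h _ ih =>
      obtain ⟨t, v, h₁, rfl, h₃⟩ := ih
      refine ⟨t, o :: v, h₁, ?_, .cons _ _ _ _ _ h h₃⟩
      cases o <;> simp

/-! ### Automata that simulate transition systems with advice -/

/-- A transition system that reads an advice word: the set `en β o` of the possible instructions, their
effect, and whether they move the advice head. -/
structure AdvSys (Γ B I : Type) where
  en : B → Option Γ → Set I
  nxt : B → I → B
  adv : I → Bool
  acc : Set B

namespace AdvSys

variable {Γ B I : Type} (Y : AdvSys Γ B I)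

def Move (p q : B × List Γ) : Prop :=
  ∃ i ∈ Y.en p.1 p.2.head?, q = (Y.nxt p.1 i, if Y.adv i then p.2.tail else p.2)

/-- The mode after a step while `o` is scanned. -/
def nextMode {Γ : Type} : Bool → Option Γ → Option (Option Γ)
  | true, some _ => none
  | _, o => some o

/-- The transitions out of the states for `β` in the automaton that simulates the system; the mode
`none` means that the scanned letter has not been read yet. -/
inductive NEdge (name : Option (Option Γ) → B → List Bool) (β : B) : Edge Γ → Prop
  | read (γ : Γ) : NEdge name β ⟨name none β, some γ, name (some (some γ)) β⟩
  | halted : NEdge name β ⟨name none β, none, name (some none) β⟩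
  | step (o : Option Γ) (i : I) (h : i ∈ Y.en β o) : NEdge name β ⟨name (some o) β, none,
      name (nextMode (Y.adv i) o) (Y.nxt β i)⟩

variable {Y}

/-- The invariant `hq` says that the system can get to `β` with the letter held by the mode,
followed by `w`, as the remaining advice, unless the end was guessed too early. In the latter case
there are letters left that no transition out of the mode `some none` reads, while acceptance
requires `w = []`. -/
theorem accepts_of_acc {name : Option (Option Γ) → B → List Bool} {𝒜 : FA Γ}
    (hname : ∀ μ β μ' β', name μ β = name μ' β' → μ = μ' ∧ β = β')
    (hacc : ∀ q ∈ 𝒜.accept, ∃ β ∈ Y.acc, q = name (some none) β)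
    (hedges : ∀ e ∈ 𝒜.edges, ∃ β, Y.NEdge name β e) {p : B × List Γ} {q : List Bool} {w : List Γ}
    (h : 𝒜.Acc q w)
    (hq : ∀ μ β, q = name μ β → ReflTransGen Y.Move p (β, (μ.bind id).toList ++ w) ∨
      (μ = some none ∧ w ≠ [])) :
    ∃ β ∈ Y.acc, ReflTransGen Y.Move p (β, []) := by
  induction h with
  | nil h =>
    obtain ⟨β, hβ, rfl⟩ := hacc _ h
    refine ⟨β, hβ, ?_⟩
    simpa using hq _ _ rfl
  | @cons q o r w h _ ih =>
    apply ih
    obtain ⟨β, he⟩ := hedges _ h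
    rintro μ' β' rfl
    generalize hE : (⟨q, o, name μ' β'⟩ : Edge Γ) = E at he
    cases he with
    | read γ =>
      simp only [Edge.mk.injEq] at hE
      obtain ⟨rfl, rfl, hn⟩ := hE
      obtain ⟨rfl, rfl⟩ := hname _ _ _ _ hn
      simpa using hq _ _ rfl
    | halted =>
      simp only [Edge.mk.injEq] at hE
      obtain ⟨rfl, rfl, hn⟩ := hE
      obtain ⟨rfl, rfl⟩ := hname _ _ _ _ hn
      -- The guess that the advice has ended is right exactly if nothing is left to read.
      by_cases hw : w = []
      · simpa [hw] using hq _ _ rfl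
      · exact Or.inr ⟨rfl, hw⟩
    | step o' i hi =>
      simp only [Edge.mk.injEq] at hE
      obtain ⟨rfl, rfl, hn⟩ := hE
      obtain ⟨rfl, rfl⟩ := hname _ _ _ _ hn
      rcases hq _ _ rfl with hr | ⟨ho, hw⟩
      · cases o' with
        | none =>
          by_cases hw : w = []
          · refine Or.inl ?_
            subst hw
            refine hr.tail ⟨i, hi, ?_⟩
            cases Y.adv i <;> simp [nextMode]
          · exact Or.inr ⟨by cases Y.adv i <;> rfl, hw⟩
        | some γ =>
          refine Or.inl (hr.tail ⟨i, hi, ?_⟩)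
          cases Y.adv i <;> simp [nextMode]
      · refine Or.inr ⟨?_, by simpa using hw⟩
        simp only [Option.some.injEq] at ho
        subst ho
        cases Y.adv i <;> rfl

/-- Induction from the end of the accepting computation. The claim is strengthened to the automaton
state in which the scanned letter has already been read, because several steps may take place under
the same letter. Transitions are required only at `D`, which contains everything reachable. -/
theorem acc_of_accepts {name : Option (Option Γ) → B → List Bool} {𝒜 : FA Γ} {D : Set B}
    (hacc : ∀ β ∈ D, β ∈ Y.acc → name (some none) β ∈ 𝒜.accept)
    (hedges : ∀ β ∈ D, ∀ e, Y.NEdge name β e → e ∈ 𝒜.edges) {p r : B × List Γ}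
    (hD : ∀ q, ReflTransGen Y.Move p q → q.1 ∈ D) (h : ReflTransGen Y.Move p r)
    (hr : r.1 ∈ Y.acc) (hr' : r.2 = []) : 𝒜.Acc (name none p.1) p.2 := by
  suffices (∃ γ w, p.2 = γ :: w ∧ 𝒜.Acc (name (some (some γ)) p.1) w) ∨
      (p.2 = [] ∧ 𝒜.Acc (name (some none) p.1) []) by
    have hp := hD p .refl
    rcases this with ⟨γ, w, hw, h⟩ | ⟨hw, h⟩
    · rw [hw]
      exact .cons (hedges _ hp _ (.read γ)) h
    · rw [hw]
      exact .cons (hedges _ hp _ .halted) h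
  induction h using ReflTransGen.head_induction_on with
  | refl => exact Or.inr ⟨hr', .nil (hacc _ (hD _ .refl) hr)⟩
  | @head p q hpq hqr ih =>
    have hp := hD p .refl
    have hq := hD q (.single hpq)
    specialize ih fun z hz => hD z (hz.head hpq)
    obtain ⟨i, hi, hi'⟩ := hpq
    obtain ⟨β, w⟩ := p
    cases w with
    | nil =>
      simp only [List.tail_nil, ite_self] at hi'
      subst hi'
      simp only [reduceCtorEq, false_and, exists_false, false_or, true_and] at ih ⊢
      have := FA.Acc.cons (hedges _ hp _ (.step none i hi)) (w := [])
      have hm : nextMode (Y.adv i) (none : Option Γ) = some none := by cases Y.adv i <;> rfl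
      rw [hm] at this
      exact this ih
    | cons γ w =>
      refine Or.inl ⟨γ, w, rfl, ?_⟩
      have := FA.Acc.cons (hedges _ hp _ (.step (some γ) i hi)) (w := w)
      refine this ?_
      cases ha : Y.adv i with
      | false =>
        simp only [ha, Bool.false_eq_true, if_false] at hi'
        subst hi'
        simpa [nextMode] using ih
      | true =>
        simp only [ha, if_true, List.tail_cons] at hi'
        subst hi'
        simp only [nextMode]
        rcases ih with ⟨γ', w', hw, h⟩ | ⟨hw, h⟩
        · simp only at hw
          subst hw
          exact .cons (hedges _ hq _ (.read γ')) h
        · simp only at hw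
          subst hw
          exact .cons (hedges _ hq _ .halted) h

/-- Iteration of `f` as long as the flag is `none`. -/
def chain (f : B → Option Bool × B) (p : Option Bool × B) : Option Bool × B :=
  if p.1 = none then f p.2 else p

/-- Pigeonhole: if `P` occurred for the first time after more than `D.card` steps, two earlier
iterates would coincide, and cutting out the cycle between them would give an earlier occurrence.
From the first occurrence on the iteration is constant. -/
theorem iterate_eq_of_card {α : Type} {f : α → α} {P : α → Prop} (hf : ∀ a, P a → f a = a)
    {D : Finset α} {a : α} {n N : ℕ} (hn : P (f^[n] a)) (hD : ∀ i, ¬ P (f^[i] a) → f^[i] a ∈ D)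
    (hN : D.card ≤ N) : f^[N] a = f^[n] a := by
  classical
  have hfix : ∀ m j, P (f^[m] a) → f^[m + j] a = f^[m] a := fun m j h => by
    rw [add_comm, Function.iterate_add_apply, Function.iterate_fixed (hf _ h)]
  obtain ⟨m, hm, hmin⟩ : ∃ m, P (f^[m] a) ∧ ∀ j < m, ¬ P (f^[j] a) :=
    
    have h : ∃ n, P (f^[n] a) := ⟨n, hn⟩
    ⟨Nat.find h, Nat.find_spec h, fun j hj => Nat.find_min h hj⟩
  have hmn : m ≤ n := by
    by_contra h
    exact hmin n (by omega) hn
  have hmN : m ≤ N := by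
    by_contra h
    obtain ⟨i, hi, j, hj, hij, he⟩ := Finset.exists_ne_map_eq_of_card_lt_of_maps_to
      (s := Finset.range m) (t := D) (f := fun i => f^[i] a) (by rw [Finset.card_range]; omega)
      (fun i hi => hD i (hmin i (Finset.mem_range.1 hi)))
    rw [Finset.mem_range] at hi hj
    have key : ∀ i j, i < j → j < m → f^[i] a = f^[j] a → False := by
      intro i j hij hj he
      refine hmin (m - j + i) (by omega) ?_
      rw [Function.iterate_add_apply, he, ← Function.iterate_add_apply, Nat.sub_add_cancel hj.le]
      exact hm
    rcases hij.lt_or_gt with h' | h'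
    · exact key i j h' hj he
    · exact key j i h' hi he.symm
  obtain ⟨j, rfl⟩ := Nat.exists_eq_add_of_le hmN
  obtain ⟨l, rfl⟩ := Nat.exists_eq_add_of_le hmn
  rw [hfix _ _ hm, hfix _ _ hm]

/-- `f γ` executes the instruction for the scanned letter `γ` and sets the flag when the advice head
moves; `g` executes the instructions at the end of the advice word and sets the flag in accepting
states. -/
structure Stepper (Y : AdvSys Γ B I) (f : Γ → B → Option Bool × B) (g : B → Option Bool × B) :
    Prop where
  f_none : ∀ γ β, (f γ β).1 = none → ∃ i ∈ Y.en β (some γ), Y.adv i = false ∧ (f γ β).2 = Y.nxt β i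
  f_true : ∀ γ β, (f γ β).1 = some true →
    ∃ i ∈ Y.en β (some γ), Y.adv i = true ∧ (f γ β).2 = Y.nxt β i
  f_en : ∀ γ β, ∀ i ∈ Y.en β (some γ), f γ β = (if Y.adv i then some true else none, Y.nxt β i)
  g_none : ∀ β, (g β).1 = none → ∃ i ∈ Y.en β none, (g β).2 = Y.nxt β i
  g_true : ∀ β, (g β).1 = some true → β ∈ Y.acc
  g_acc : ∀ β ∈ Y.acc, (g β).1 = some true
  g_en : ∀ β, β ∉ Y.acc → ∀ i ∈ Y.en β none, g β = (none, Y.nxt β i)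

section Det

variable {f : Γ → B → Option Bool × B} {g : B → Option Bool × B} (hY : Stepper Y f g)
  {p : B × List Γ}

include hY

/-- Soundness of the accelerated transitions: with the flag `none` the letter is still being
scanned, with `some true` the advice head has just left it. Nothing is claimed for `some false`, the
flag of a failed computation. -/
theorem Stepper.chain_f {β : B} {γ : Γ} {w : List Γ} (h : ReflTransGen Y.Move p (β, γ :: w))
    (n : ℕ) : (((chain (f γ))^[n] (none, β)).1 = none →
        ReflTransGen Y.Move p (((chain (f γ))^[n] (none, β)).2, γ :: w)) ∧
      (((chain (f γ))^[n] (none, β)).1 = some true →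
        ReflTransGen Y.Move p (((chain (f γ))^[n] (none, β)).2, w)) := by
  induction n with
  | zero => simpa using h
  | succ n ih =>
    rw [Function.iterate_succ_apply']
    generalize (chain (f γ))^[n] (none, β) = z at ih
    obtain ⟨u, β'⟩ := z
    by_cases hu : u = none
    · subst hu
      simp only [chain, if_true]
      refine ⟨fun hn => ?_, fun hn => ?_⟩
      · obtain ⟨i, hi, ha, he⟩ := hY.f_none _ _ hn
        exact (ih.1 rfl).tail ⟨i, hi, by simp [ha, he]⟩
      · obtain ⟨i, hi, ha, he⟩ := hY.f_true _ _ hn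
        exact (ih.1 rfl).tail ⟨i, hi, by simp [ha, he]⟩
    · simpa [chain, hu] using ih

theorem Stepper.chain_g {β : B} (h : ReflTransGen Y.Move p (β, [])) (n : ℕ) :
    (((chain g)^[n] (none, β)).1 = none →
        ReflTransGen Y.Move p (((chain g)^[n] (none, β)).2, [])) ∧
      (((chain g)^[n] (none, β)).1 = some true →
        ∃ β' ∈ Y.acc, ReflTransGen Y.Move p (β', [])) := by
  induction n with
  | zero => simpa using h
  | succ n ih =>
    rw [Function.iterate_succ_apply']
    generalize (chain g)^[n] (none, β) = z at ih
    obtain ⟨u, β'⟩ := z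
    by_cases hu : u = none
    · subst hu
      simp only [chain, if_true]
      refine ⟨fun hn => ?_, fun hn => ⟨β', hY.g_true _ hn, ih.1 rfl⟩⟩
      obtain ⟨i, hi, he⟩ := hY.g_none _ hn
      exact (ih.1 rfl).tail ⟨i, hi, by simp [he]⟩
    · simpa [chain, hu] using ih

theorem Stepper.accepts_of_acc {name : B → List Bool} {𝒜 : FA Γ} {N : ℕ}
    (hname : Function.Injective name)
    (hacc : ∀ q ∈ 𝒜.accept, ∃ β, ((chain g)^[N] (none, β)).1 = some true ∧ q = name β)
    (hedges : ∀ e ∈ 𝒜.edges, ∃ β γ, ((chain (f γ))^[N] (none, β)).1 = some true ∧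
      e = ⟨name β, some γ, name ((chain (f γ))^[N] (none, β)).2⟩) {q : List Bool}
    {w : List Γ} (h : 𝒜.Acc q w) (hq : ∀ β, q = name β → ReflTransGen Y.Move p (β, w)) :
    ∃ β ∈ Y.acc, ReflTransGen Y.Move p (β, []) := by
  induction h with
  | nil h =>
    obtain ⟨β, hβ, rfl⟩ := hacc _ h
    exact (hY.chain_g (hq β rfl) N).2 hβ
  | cons h _ ih =>
    obtain ⟨β, γ, hβ, he⟩ := hedges _ h
    simp only [Edge.mk.injEq] at he
    obtain ⟨rfl, rfl, rfl⟩ := he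
    refine ih fun β' hβ' => ?_
    rw [← hname hβ']
    exact (hY.chain_f (hq β rfl) N).2 hβ

/-- The computation up to the next advice move is a chain of some length `n` whose unfinished states
lie in `D`. By `iterate_eq_of_card` the fixed number `N` of iterations gives the same result, so the
transition computed with `N` iterations is the required one. -/
theorem Stepper.acc_of_accepts {name : B → List Bool} {𝒜 : FA Γ} {N : ℕ} {D : Finset B}
    (hacc : ∀ β ∈ D, ((chain g)^[N] (none, β)).1 = some true → name β ∈ 𝒜.accept)
    (hedges : ∀ β ∈ D, ∀ γ, ((chain (f γ))^[N] (none, β)).1 = some true →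
      ⟨name β, some γ, name ((chain (f γ))^[N] (none, β)).2⟩ ∈ 𝒜.edges) (hN : D.card ≤ N)
    {r : B × List Γ} (hD : ∀ q, ReflTransGen Y.Move p q → q.1 ∈ D) (h : ReflTransGen Y.Move p r)
    (hr : r.1 ∈ Y.acc) (hr' : r.2 = []) : 𝒜.Acc (name p.1) p.2 := by
  classical
  have hit : ∀ {F : B → Option Bool × B} {β n}, ((chain F)^[n] (none, β)).1 = some true →
      (∀ i, ((chain F)^[i] (none, β)).1 = none → ((chain F)^[i] (none, β)).2 ∈ D) →
      (chain F)^[N] (none, β) = (chain F)^[n] (none, β) := by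
    intro F β n hn hF
    refine iterate_eq_of_card (f := chain F) (a := (none, β)) (n := n) (P := fun p => p.1 ≠ none)
      (D := D.image fun β => ((none : Option Bool), β)) (fun a ha => if_neg ha) (by simp [hn]) ?_
      (Finset.card_image_le.trans hN)
    intro i hi
    rw [not_not] at hi
    exact Finset.mem_image.2 ⟨_, hF i hi, Prod.ext hi.symm rfl⟩
  -- For the induction the length `n` of the chain is left open: a preceding step under the same
  -- letter turns it into `n + 1`. It is replaced by `N` only when a transition or an acceptance is
  -- completed.
  suffices (∃ γ w n, p.2 = γ :: w ∧ ((chain (f γ))^[n] (none, p.1)).1 = some true ∧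
      𝒜.Acc (name ((chain (f γ))^[n] (none, p.1)).2) w) ∨
      (p.2 = [] ∧ ∃ n, ((chain g)^[n] (none, p.1)).1 = some true) by
    have hp := hD p .refl
    obtain ⟨β, v⟩ := p
    rcases this with ⟨γ, w, n, hw, h₁, h₂⟩ | ⟨hw, n, h₁⟩
    · simp only at hw
      subst hw
      have hh := hit h₁ fun i hi => hD _ ((hY.chain_f .refl i).1 hi)
      refine .cons (hedges _ hp γ ?_) ?_
      · rw [hh]; exact h₁
      · rw [hh]; exact h₂
    · simp only at hw
      subst hw
      have hh := hit h₁ fun i hi => hD _ ((hY.chain_g .refl i).1 hi)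
      exact .nil (hacc _ hp (by rw [hh]; exact h₁))
  induction h using ReflTransGen.head_induction_on with
  | refl => exact Or.inr ⟨hr', 1, by simpa [chain] using hY.g_acc _ hr⟩
  | @head p q hpq hqr ih =>
    have hq := hD q (.single hpq)
    specialize ih fun z hz => hD z (hz.head hpq)
    have hDq : ∀ z, ReflTransGen Y.Move q z → z.1 ∈ D := fun z hz => hD z (hz.head hpq)
    obtain ⟨i, hi, hi'⟩ := hpq
    obtain ⟨β, w⟩ := p
    cases w with
    | nil =>
      simp only [List.tail_nil, ite_self] at hi'
      subst hi'
      simp only [reduceCtorEq, false_and, exists_false, false_or, true_and] at ih ⊢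
      by_cases hβ : β ∈ Y.acc
      · exact ⟨1, by simpa [chain] using hY.g_acc _ hβ⟩
      · obtain ⟨n, hn⟩ := ih
        exact ⟨n + 1, by simpa [chain, hY.g_en _ hβ i hi] using hn⟩
    | cons γ w =>
      refine Or.inl ⟨γ, w, ?_⟩
      have he := hY.f_en γ β i hi
      cases ha : Y.adv i with
      | false =>
        simp only [ha, Bool.false_eq_true, if_false] at hi' he
        subst hi'
        simp only [List.cons.injEq, reduceCtorEq, false_and, or_false] at ih
        obtain ⟨γ', w', n, ⟨rfl, rfl⟩, h₁, h₂⟩ := ih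
        exact ⟨n + 1, rfl, by simpa [chain, he] using h₁, by simpa [chain, he] using h₂⟩
      | true =>
        simp only [ha, if_true, List.tail_cons] at hi' he
        subst hi'
        refine ⟨1, rfl, by simp [chain, he], ?_⟩
        simp only [Function.iterate_one, chain, he, if_true]
        rcases ih with ⟨γ', w', n, hw, h₁, h₂⟩ | ⟨hw, n, h₁⟩
        · simp only at hw
          subst hw
          have hh := hit h₁ fun i hi => hDq _ ((hY.chain_f .refl i).1 hi)
          refine .cons (hedges _ hq γ' ?_) ?_
          · rw [hh]; exact h₁
          · rw [hh]; exact h₂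
        · simp only at hw
          subst hw
          have hh := hit h₁ fun i hi => hDq _ ((hY.chain_g .refl i).1 hi)
          exact .nil (hacc _ hq (by rw [hh]; exact h₁))

end Det

end AdvSys

end RegReal

/-! ### Printing an automaton whose states are banks -/

namespace RegReal

open Relation Prog RProg

/-! ### Enumeration of banks -/

/-- All slots. -/
noncomputable def slots (k : ℕ) : List (Slot k) := (Set.finite_univ (α := Slot k)).toFinset.toList

theorem mem_slots {k : ℕ} (j : Slot k) : j ∈ slots k := by simp [slots]

theorem nodup_slots (k : ℕ) : (slots k).Nodup := Finset.nodup_toList _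

/-- The banks that arise from `β` by entering numbers below `N` into the slots of a list. -/
def banksOf {k : ℕ} (N : ℕ) : List (Slot k) → (Slot k → ℕ) → List (Slot k → ℕ)
  | [], β => [β]
  | j :: l, β => (List.range N).flatMap fun r => banksOf N l (Function.update β j r)

theorem mem_banksOf {k N : ℕ} {β' : Slot k → ℕ} : ∀ {l : List (Slot k)} {β : Slot k → ℕ},
    (∀ j, if j ∈ l then β' j < N else β' j = β j) → β' ∈ banksOf N l β
  | [], β, h => by
    rw [banksOf, List.mem_singleton]
    funext j
    simpa using h j
  | j :: l, β, h => by
    rw [banksOf, List.mem_flatMap]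
    refine ⟨β' j, by simpa using h j, mem_banksOf fun i => ?_⟩
    have := h i
    by_cases hi : i ∈ l
    · simpa [hi] using this
    · by_cases hij : i = j
      · subst hij; simp [hi]
      · simpa [hi, hij] using this

/-- Unary notation with an end mark. -/
def unary (n : ℕ) : List Bool := List.replicate n true ++ [false]

theorem unary_append_inj : ∀ {m n : ℕ} {u v : List Bool}, unary m ++ u = unary n ++ v →
    m = n ∧ u = v
  | 0, 0, _, _, h => by simpa [unary] using h
  | 0, n + 1, _, _, h => by simp [unary, List.replicate_succ] at h
  | m + 1, 0, _, _, h => by simp [unary, List.replicate_succ] at h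
  | m + 1, n + 1, u, v, h => by
    have : unary m ++ u = unary n ++ v := by
      simpa [unary, List.replicate_succ] using h
    obtain ⟨rfl, rfl⟩ := unary_append_inj this
    exact ⟨rfl, rfl⟩

/-- A name for a number and a bank. -/
noncomputable def bankName {k : ℕ} (n : ℕ) (β : Slot k → ℕ) : List Bool :=
  unary n ++ (slots k).flatMap fun j => unary (β j)

/-- Unary blocks with end marks are self-delimiting, so a name can be parsed block by block. Unary
notation is convenient because it is printed by counting a register down. -/
theorem bankName_inj {k n n' : ℕ} {β β' : Slot k → ℕ} (h : bankName n β = bankName n' β') :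
    n = n' ∧ β = β' := by
  rw [bankName, bankName] at h
  obtain ⟨rfl, h'⟩ := unary_append_inj h
  refine ⟨rfl, ?_⟩
  suffices ∀ l : List (Slot k), (l.flatMap fun j => unary (β j)) = (l.flatMap fun j => unary (β' j)) →
      ∀ j ∈ l, β j = β' j from
    funext fun j => this (slots k) h' j (mem_slots j)
  intro l
  induction l with
  | nil => simp
  | cons i l ih =>
    intro h
    rw [List.flatMap_cons, List.flatMap_cons] at h
    obtain ⟨h₁, h₂⟩ := unary_append_inj h
    simpa [h₁] using ih h₂

/-! ### Programs that print automata -/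

namespace RProg

section Cycle

variable {V A ι Obs Act E : Type} [DecidableEq ι] {π : Port Obs Act E} {x : List A} {N : ℕ}

/-- Execute `p` for all values of the register `i`. -/
def cycle (i : ι) (p : RProg V A ι Obs Act) : RProg V A ι Obs Act :=
  .seq p (.seq (inc i) (.loop (fun w => ¬ w.zero i) (.seq p (inc i))))

omit [DecidableEq ι] in
theorem det_cycle {i : ι} {p : RProg V A ι Obs Act} (h : p.Det) : (cycle i p).Det :=
  ⟨h, trivial, h, trivial⟩

/-- The wrap-around modulo `N` signals the end, so the program need not know `N`, and the register
is back at `0` afterwards. `I r` describes the state before round `r`. -/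
theorem run_cycle {i : ι} {p : RProg V A ι Obs Act} (hN : 0 < N) (I : ℕ → RState V ι E → Prop)
    (hp : ∀ r < N, ∀ s, I r s → s.reg i = r → ∃ s', p.Run (RSem π x N) s s' ∧ s'.reg i = r ∧
      I (r + 1) (s'.set i ((r + 1) % N))) {s : RState V ι E} (h : I 0 s) (hs : s.reg i = 0) :
    ∃ s', (cycle i p).Run (RSem π x N) s s' ∧ I N s' := by
  have step : ∀ r < N, ∀ s, I r s → s.reg i = r →
      ∃ s', (Prog.seq p (inc i)).Run (RSem π x N) s s' ∧ s'.reg i = (r + 1) % N ∧ I (r + 1) s' := by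
    intro r hr s hs hi
    obtain ⟨t, h₁, h₂, h₃⟩ := hp r hr s hs hi
    refine ⟨_, ⟨t, h₁, ?_⟩, by simp [RState.set], h₃⟩
    show _ = _
    rw [h₂]
    rfl
  have key : ∀ d r, r + 1 + d = N → ∀ s, I (r + 1) s → s.reg i = (r + 1) % N →
      ∃ s', (Prog.loop (fun w => ¬ w.zero i) (Prog.seq p (inc i))).Run (RSem π x N) s s' ∧
        I N s' := by
    intro d
    induction d with
    | zero =>
      intro r hr s h hi
      rw [add_zero] at hr
      rw [hr, Nat.mod_self] at hi
      rw [hr] at h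
      exact ⟨s, Run.loop_done (not_not.2 hi), h⟩
    | succ d ih =>
      intro r hr s h hi
      rw [Nat.mod_eq_of_lt (by omega)] at hi
      obtain ⟨t, h₁, h₂, h₃⟩ := step (r + 1) (by omega) s h hi
      obtain ⟨s', h₄, h₅⟩ := ih (r + 1) (by omega) t h₃ h₂
      refine ⟨s', Run.loop_cons ?_ h₁ h₄, h₅⟩
      show ¬ s.reg i = 0
      omega
  obtain ⟨t, ⟨m, h₁, h₁'⟩, h₂, h₃⟩ := step 0 hN s h hs
  obtain ⟨s', h₄, h₅⟩ := key (N - 1) 0 (by omega) t h₃ h₂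
  exact ⟨s', ⟨m, h₁, t, h₁', h₄⟩, h₅⟩

end Cycle

section CopyBank

variable {A Obs' Act' Obs Act E U K : Type} [DecidableEq K] {M : TM A Obs' Act'} {cd : Coding M}

noncomputable def copyBank (κ κ' : K) : SimProg cd U K Obs Act :=
  seqs ((slots M.k).map fun j => copy .tmp (.bank κ j) (.bank κ' j))

omit [DecidableEq K] in
theorem det_copyBank {κ κ' : K} : (copyBank κ κ' : SimProg cd U K Obs Act).Det :=
  det_seqs (by simp only [List.mem_map]; rintro _ ⟨i, -, rfl⟩; exact det_copy)

theorem run_copyBank {π : Port Obs Act E} {x : List A} {N : ℕ} {s : SimState cd U K E} {κ κ' : K}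
    (hs : s.Good N) (hκ : κ ≠ κ') : (copyBank κ κ' : SimProg cd U K Obs Act).Run (RSem π x N) s
      { s with reg := setBank s.reg κ' (s.bank κ) } := by
  have := run_seqs_map (S := RSem (A := A) π x N)
    (p := fun j => copy (.tmp : Reg K M.k) (.bank κ j) (.bank κ' j))
    (fun l => (⟨s.v, setBank s.reg κ' fun j => if j ∈ l then s.bank κ j else s.bank κ' j,
      s.pos, s.port⟩ : SimState cd U K E)) (L := slots M.k) fun l₁ t l₂ _ => by
      convert run_copy (s := (⟨s.v, setBank s.reg κ' fun j =>
        if j ∈ l₁ then s.bank κ j else s.bank κ' j, s.pos, s.port⟩ : SimState cd U K E))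
        (t := .tmp) (i := .bank κ t) (j := .bank κ' t) (by simp [hκ]) (by simp) (by simp)
        hs.tmp ?_ using 1
      · simp only [RState.set, RState.mk.injEq, true_and, and_true]
        funext r
        rcases r with ⟨κ₁, j⟩ | _ | _ | _
        · by_cases hκ' : κ₁ = κ'
          · subst hκ'
            by_cases hj : j = t
            · subst hj; simp [setBank, SimState.bank, hκ]
            · simp [setBank, hj]
          · simp [setBank, hκ']
        all_goals simp [setBank]
      · simpa [setBank, hκ] using hs.lt _
  simp only [List.not_mem_nil, if_false, mem_slots, if_true] at this
  have h : setBank s.reg κ' (fun j => s.bank κ' j) = s.reg := by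
    funext r
    rcases r with ⟨κ₁, j⟩ | _ | _ | _
    · by_cases hκ' : κ₁ = κ' <;> simp [setBank, SimState.bank, hκ']
    all_goals rfl
  rwa [h] at this

end CopyBank

section Print

variable {A Γ : Type} {M : AdviceTM A Γ} (cd : Coding M)

abbrev PrintState := SimState cd (Option Bool) Bool (List (Tok Γ))

abbrev PrintProg := SimProg cd (Option Bool) Bool Unit (Option (Tok Γ))

variable {cd}

def outs (l : List (Tok Γ)) : PrintProg cd := seqs (l.map fun t => act fun _ => some t)

def printReg (κ : Bool) (j : Slot M.k) : PrintProg cd :=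
  .seq (copy .tmp (.bank κ j) .aux) (.seq (drain .aux (outs [.bit true])) (outs [.bit false]))

noncomputable def printName (κ : Bool) (n : ℕ) : PrintProg cd :=
  .seq (outs ((unary n).map .bit)) (seqs ((slots M.k).map (printReg κ)))

noncomputable def printEdge (n : ℕ) (o : Option Γ) (κ : Bool) (n' : ℕ) : PrintProg cd :=
  .seq (outs [.edgeMark]) (.seq (printName false n) (.seq (outs [.label o]) (printName κ n')))

theorem det_outs {l : List (Tok Γ)} : (outs l : PrintProg cd).Det :=
  det_seqs (by simp only [List.mem_map]; rintro _ ⟨i, -, rfl⟩; trivial)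

theorem det_printName {κ n} : (printName κ n : PrintProg cd).Det :=
  ⟨det_outs, det_seqs (by
    simp only [List.mem_map]
    rintro _ ⟨i, -, rfl⟩
    exact ⟨det_copy, det_drain det_outs, det_outs⟩)⟩

theorem det_printEdge {n o κ n'} : (printEdge n o κ n' : PrintProg cd).Det :=
  ⟨det_outs, det_printName, det_outs, det_printName⟩

variable {x : List A} {N : ℕ} {s : PrintState cd}

theorem run_outs {l : List (Tok Γ)} : (outs l : PrintProg cd).Run (RSem (outPort _) x N) s
    { s with port := s.port ++ l } := by
  have := run_seqs_map (S := RSem (A := A) (outPort (Tok Γ)) x N) (p := fun t => act fun _ => some t)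
    (fun l => (⟨s.v, s.reg, s.pos, s.port ++ l⟩ : PrintState cd)) (L := l) fun l₁ t l₂ _ => by
      convert run_act using 1
      simp [outPort]
  rwa [List.append_nil] at this

theorem run_printReg {κ : Bool} {j : Slot M.k} (hs : s.Good N) :
    (printReg κ j : PrintProg cd).Run (RSem (outPort _) x N) s
      { s with port := s.port ++ (unary (s.bank κ j)).map .bit } := by
  refine ⟨_, run_copy (by simp) (by simp) (by simp) hs.tmp (hs.lt _),
    { s with port := s.port ++ List.replicate (s.bank κ j) (.bit true) }, ?_, ?_⟩
  · have := run_drain (A := A) (π := outPort (Tok Γ)) (x := x) (N := N) (i := .aux)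
      (p := outs (cd := cd) [.bit true])
      (fun n => { s.set .aux n with
        port := s.port ++ List.replicate (s.bank κ j - n) (.bit true) })
      (by simp [RState.set]) (s.bank κ j) (by
        intro m hm
        convert run_outs using 1
        simp only [RState.set, Function.update_idem, List.append_assoc, RState.mk.injEq, true_and]
        congr 1
        rw [show s.bank κ j - m = s.bank κ j - (m + 1) + 1 by omega, List.replicate_succ'])
    convert this using 1
    · simp [RState.set, SimState.bank]
    · simp only [RState.set, ← hs.aux, Function.update_eq_self]
      simp [hs.aux]
  · convert run_outs using 1
    simp [unary]

theorem run_printName {κ : Bool} {n : ℕ} (hs : s.Good N) :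
    (printName κ n : PrintProg cd).Run (RSem (outPort _) x N) s
      { s with port := s.port ++ (bankName n (s.bank κ)).map .bit } := by
  refine ⟨_, run_outs, ?_⟩
  have := run_seqs_map (S := RSem (A := A) (outPort (Tok Γ)) x N) (p := printReg κ)
    (fun l => (⟨s.v, s.reg, s.pos, s.port ++
      (unary n ++ l.flatMap fun j => unary (s.bank κ j)).map .bit⟩ : PrintState cd))
    (L := slots M.k) fun l₁ t l₂ _ => by
      convert run_printReg (hs.congr hs.dig) using 1
      simp only [List.flatMap_append, List.flatMap_cons, List.flatMap_nil, List.append_nil,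
        List.map_append, List.append_assoc]
      rfl
  rwa [List.flatMap_nil, List.append_nil] at this

theorem run_printEdge {n : ℕ} {o : Option Γ} {κ : Bool} {n' : ℕ} (hs : s.Good N) :
    (printEdge n o κ n' : PrintProg cd).Run (RSem (outPort _) x N) s
      { s with port := s.port ++ Edge.encode ⟨bankName n (s.bank false), o, bankName n' (s.bank κ)⟩ } := by
  refine ⟨_, run_outs, _, run_printName (hs.congr hs.dig), _, run_outs, ?_⟩
  convert run_printName (hs.congr hs.dig) using 1
  simp [Edge.encode]
  rfl

/-- `p` appends a word to the output that depends on the first bank, and leaves this bank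
unchanged. -/
def Prints (x : List A) (N : ℕ) (p : PrintProg cd) (o : (Slot M.k → ℕ) → List (Tok Γ)) : Prop :=
  ∀ s : PrintState cd, s.Good N → s.reg .cnt = 0 → ∃ s' : PrintState cd, p.Run (RSem (outPort _) x N) s s' ∧
    s'.Good N ∧ s'.reg .cnt = 0 ∧ s'.bank false = s.bank false ∧
    s'.port = s.port ++ o (s.bank false)

/-- `p` computes a flag and the second bank from the first bank, and leaves the first bank
unchanged. -/
def Determines (x : List A) (N : ℕ) (p : PrintProg cd)
    (r : (Slot M.k → ℕ) → Option Bool × (Slot M.k → ℕ)) : Prop :=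
  ∀ s : PrintState cd, s.Good N → s.reg .cnt = 0 → ∃ s' : PrintState cd, p.Run (RSem (outPort _) x N) s s' ∧
    s'.Good N ∧ s'.reg .cnt = 0 ∧ s'.bank false = s.bank false ∧ s'.port = s.port ∧
    (s'.v.2.u, s'.bank true) = r (s.bank false)

variable {p q : PrintProg cd} {o o' : (Slot M.k → ℕ) → List (Tok Γ)}

theorem prints_of_run (h : ∀ s : PrintState cd, s.Good N → p.Run (RSem (outPort _) x N) s
    { s with port := s.port ++ o (s.bank false) }) : Prints x N p o := fun s hs hc =>
  ⟨_, h s hs, hs.congr hs.dig, hc, rfl, rfl⟩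

theorem Prints.seq (hp : Prints x N p o) (hq : Prints x N q o') :
    Prints x N (.seq p q) fun β => o β ++ o' β := fun s hs hc => by
  obtain ⟨t, h₁, h₂, h₃, h₄, h₅⟩ := hp s hs hc
  obtain ⟨t', k₁, k₂, k₃, k₄, k₅⟩ := hq t h₂ h₃
  exact ⟨t', ⟨t, h₁, k₁⟩, k₂, k₃, k₄.trans h₄, by rw [k₅, h₅, h₄, List.append_assoc]⟩

theorem Prints.seqs {α : Type} {p : α → PrintProg cd} {o : α → (Slot M.k → ℕ) → List (Tok Γ)}
    (h : ∀ a, Prints x N (p a) (o a)) :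
    ∀ L : List α, Prints x N (seqs (L.map p)) fun β => L.flatMap fun a => o a β
  | [] => prints_of_run fun s _ => by simp [Prog.seqs, Run]
  | a :: L => by
    simp only [List.flatMap_cons]
    exact (h a).seq (Prints.seqs h L)

/-- The pattern for accepting states and for computed transitions: prepare a candidate in the second
bank, and print only if the flag confirms it. -/
theorem Determines.prints {r : (Slot M.k → ℕ) → Option Bool × (Slot M.k → ℕ)}
    {o : (Slot M.k → ℕ) → (Slot M.k → ℕ) → List (Tok Γ)} (hp : Determines x N p r)
    (hq : ∀ s : PrintState cd, s.Good N → q.Run (RSem (outPort _) x N) s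
      { s with port := s.port ++ o (s.bank false) (s.bank true) }) :
    Prints x N (.seq p (.ite (mem fun v => v.2.u = some true) q .skip)) fun β =>
      if (r β).1 = some true then o β (r β).2 else [] := fun s hs hc => by
  obtain ⟨t, h₁, h₂, h₃, h₄, h₅, h₆⟩ := hp s hs hc
  simp only [← h₆]
  by_cases h : t.v.2.u = some true
  · refine ⟨_, ⟨t, h₁, Run.ite_pos h (hq t h₂)⟩, h₂.congr h₂.dig, h₃, h₄, ?_⟩
    simp [h, h₄, h₅]
  · exact ⟨_, ⟨t, h₁, Run.ite_neg h rfl⟩, h₂, h₃, h₄, by simp [h, h₅]⟩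

theorem _root_.RegReal.SimState.Good.set (hs : s.Good N) {i : Reg Bool M.k} (h₁ : i ≠ .aux) (h₂ : i ≠ .tmp) {m : ℕ}
    (hm : m < N) : SimState.Good N (s.set i m : PrintState cd) := by
  refine ⟨hs.pos, ?_, ?_, hs.dig, fun j => ?_⟩
  · simpa [RState.set, h₁.symm] using hs.aux
  · simpa [RState.set, h₂.symm] using hs.tmp
  · by_cases h : j = i
    · subst h; simpa [RState.set] using hm
    · simpa [RState.set, h] using hs.lt j

/-- What a machine does in one step: flag and instruction. -/
abbrev StepFun (M : AdviceTM A Γ) := M.State → InputCell A → (Fin M.k → M.Work) →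
  Option Bool × Instr M.State M.Work M.k Bool

variable (cd) in
noncomputable def stepFun (x : List A) (N : ℕ) (g : StepFun M) (β : Slot M.k → ℕ) :
    Option Bool × (Slot M.k → ℕ) :=
  ((g (cd.state β) (readInput x (β .pos)) (cd.syms β)).1,
    cd.stepB N x β (g (cd.state β) (readInput x (β .pos)) (cd.syms β)).2)

noncomputable def stepProg (g : StepFun M) : PrintProg cd :=
  .seq (copyBank false true) (simStep cd (outPort _) true fun _ => g)

def chainBody (g : StepFun M) : PrintProg cd :=
  .ite (mem fun v => v.2.u = none) (simStep cd (outPort _) true fun _ => g) .skip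

/-- The register `cnt` passes through all its values, which makes exactly `N` rounds; once the flag
is set, the remaining rounds do nothing. -/
noncomputable def chainProg (g : StepFun M) : PrintProg cd :=
  .seq (copyBank false true) (.seq (upd (outPort _) fun v => (v.1, { v.2 with u := none }))
    (cycle .cnt (chainBody g)))

theorem det_stepProg {g : StepFun M} : (stepProg g : PrintProg cd).Det :=
  ⟨det_copyBank, det_simStep⟩

theorem det_chainProg {g : StepFun M} : (chainProg g : PrintProg cd).Det :=
  ⟨det_copyBank, trivial, det_cycle ⟨det_simStep, trivial⟩⟩

theorem setBank_bank_ne {reg : Reg Bool M.k → ℕ} {β : Slot M.k → ℕ} {v : SimMem cd (Option Bool)}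
    {n : ℕ} {e : List (Tok Γ)} :
    SimState.bank (⟨v, setBank reg true β, n, e⟩ : PrintState cd) false =
      fun j => reg (.bank false j) := by
  funext j
  simp [SimState.bank, setBank]

theorem determines_stepProg {g : StepFun M} :
    Determines x N (stepProg g : PrintProg cd) (stepFun cd x N g) := fun s hs hc => by
  have h := run_copyBank (π := outPort (Tok Γ)) (x := x) hs Bool.false_ne_true
  have ht := hs.setBank (κ := true) (β := s.bank false) (fun j => hs.lt _) hs.dig (e := s.port)
  obtain ⟨v, hv, hu, hg, hr⟩ := run_simStep (π := outPort (Tok Γ)) (x := x) (κ := true) ht fun _ => g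
  rw [setBank_bank] at hu hg hr
  refine ⟨_, ⟨_, h, hr⟩, hg, hc, ?_, rfl, ?_⟩
  · rw [setBank_bank_ne]; rfl
  · rw [setBank_bank, hu]; rfl

theorem determines_chainProg {g : StepFun M} (hN : 0 < N) :
    Determines x N (chainProg g : PrintProg cd)
      fun β => (AdvSys.chain (stepFun cd x N g))^[N] (none, β) := fun s hs hc => by
  have h := run_copyBank (π := outPort (Tok Γ)) (x := x) hs Bool.false_ne_true
  have ht := hs.setBank (κ := true) (β := s.bank false) (fun j => hs.lt _)
    (v := (s.v.1, { s.v.2 with u := none })) hs.dig (e := s.port)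
  obtain ⟨s', hr, h₁, h₂, h₃, h₄⟩ := run_cycle (A := A) (π := outPort (Tok Γ)) (x := x)
    (i := (.cnt : Reg Bool M.k))
    (p := chainBody g) hN
    (fun r (t : PrintState cd) => t.Good N ∧ t.reg .cnt = r % N ∧ t.bank false = s.bank false ∧ t.port = s.port ∧
      (t.v.2.u, t.bank true) = (AdvSys.chain (stepFun cd x N g))^[r] (none, s.bank false)) (by
    rintro r hr t ⟨h₁, h₂, h₃, h₄, h₅⟩ h₆
    have hm := Nat.mod_lt (r + 1) hN
    rw [Function.iterate_succ_apply', ← h₅]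
    by_cases hu : t.v.2.u = none
    · obtain ⟨v, -, hv, hg, hr⟩ := run_simStep (π := outPort (Tok Γ)) (x := x) (κ := true) h₁ fun _ => g
      refine ⟨_, Run.ite_pos hu hr, h₆, hg.set (by simp) (by simp) hm, by simp [RState.set], ?_, h₄, ?_⟩
      · rw [← h₃]
        funext j
        simp [SimState.bank, RState.set, setBank]
      · rw [AdvSys.chain, if_pos hu, stepFun, ← hv]
        refine Prod.ext rfl (funext fun j => ?_)
        simp [SimState.bank, RState.set, setBank]
    · refine ⟨t, Run.ite_neg hu rfl, h₆, h₁.set (by simp) (by simp) hm, by simp [RState.set], ?_, h₄, ?_⟩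
      · rw [← h₃]
        funext j
        simp [SimState.bank, RState.set]
      · rw [AdvSys.chain, if_neg hu]
        refine Prod.ext rfl (funext fun j => ?_)
        simp [SimState.bank, RState.set]) (s := ⟨(s.v.1, { s.v.2 with u := none }), setBank s.reg true (s.bank false), s.pos, s.port⟩) (by
    refine ⟨ht, ?_, ?_, rfl, ?_⟩
    · simpa [setBank] using hc
    · rw [setBank_bank_ne]; rfl
    · rw [setBank_bank]; rfl) hc
  refine ⟨s', ⟨_, h, _, run_upd, hr⟩, h₁, ?_, h₃, h₄⟩
  simpa using h₂

/-- Execute `p` for all values of the given slots of the first bank. -/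
def forAll : List (Slot M.k) → PrintProg cd → PrintProg cd
  | [], p => p
  | j :: l, p => cycle (.bank false j) (forAll l p)

theorem det_forAll (hp : p.Det) : ∀ l, (forAll l p).Det
  | [] => hp
  | _ :: l => det_cycle (det_forAll hp l)

/-- Nested cycles, one for each slot. Every cycle leaves its slot at `0` again, so the inner
enumerations always start with zero slots. -/
theorem run_forAll (hp : Prints x N p o) : ∀ {l : List (Slot M.k)}, l.Nodup → ∀ s : PrintState cd,
    s.Good N → s.reg .cnt = 0 → (∀ j ∈ l, s.bank false j = 0) →
    ∃ s' : PrintState cd, (forAll l p).Run (RSem (outPort _) x N) s s' ∧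
      s'.Good N ∧ s'.reg .cnt = 0 ∧ s'.bank false = s.bank false ∧
      s'.port = s.port ++ (banksOf N l (s.bank false)).flatMap o
  | [], _, s, hs, hc, _ => by
    simpa [banksOf, forAll] using hp s hs hc
  | j :: l, hl, s, hs, hc, hz => by
    have hN : 0 < N := (Nat.zero_le _).trans_lt (hs.lt .aux)
    rw [List.nodup_cons] at hl
    obtain ⟨s', hr, h₁, h₂, h₃, h₄⟩ := run_cycle (A := A) (π := outPort (Tok Γ)) (x := x)
      (i := (.bank false j : Reg Bool M.k)) (p := forAll l p) hN
      (fun r (t : PrintState cd) => t.Good N ∧ t.reg .cnt = 0 ∧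
        t.bank false = Function.update (s.bank false) j (r % N) ∧
        t.port = s.port ++ (List.range r).flatMap fun r =>
          (banksOf N l (Function.update (s.bank false) j r)).flatMap o) (by
      rintro r hr t ⟨h₁, h₂, h₃, h₄⟩ h₅
      rw [Nat.mod_eq_of_lt hr] at h₃
      obtain ⟨t', k₁, k₂, k₃, k₄, k₅⟩ := run_forAll hp hl.2 t h₁ h₂ fun i hi => by
        rw [h₃, Function.update_of_ne (by rintro rfl; exact hl.1 hi)]
        exact hz i (by simp [hi])
      refine ⟨t', k₁, ?_, k₂.set (by simp) (by simp) (Nat.mod_lt _ hN), by simpa [RState.set], ?_, ?_⟩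
      · have := congrFun k₄ j
        rw [h₃, Function.update_self] at this
        exact this
      · rw [h₃] at k₄
        funext i
        have := congrFun k₄ i
        by_cases hij : i = j
        · subst hij; simp [SimState.bank, RState.set]
        · simpa [SimState.bank, RState.set, hij] using this
      · rw [List.range_succ, List.flatMap_append, ← List.append_assoc, ← h₄]
        rw [h₃] at k₅
        simpa [RState.set] using k₅) (s := s) (by
      refine ⟨hs, hc, ?_, by simp⟩
      have := hz j (by simp)
      rw [Nat.zero_mod, ← this, Function.update_eq_self]) (hz j (by simp))
    refine ⟨s', hr, h₁, h₂, ?_, ?_⟩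
    · rw [h₃, Nat.mod_self, ← hz j (by simp), Function.update_eq_self]
    · rw [h₄, banksOf, List.flatMap_assoc]

/-- The automaton whose accepting states and transitions are given for every bank. -/
noncomputable def bankFA (k N : ℕ) (acc : (Slot k → ℕ) → List (List Bool))
    (edg : (Slot k → ℕ) → List (Edge Γ)) : FA Γ where
  start := bankName 0 fun _ : Slot k => 0
  accept := (banksOf N (slots k) fun _ => 0).flatMap acc
  edges := (banksOf N (slots k) fun _ => 0).flatMap edg

/-- The first bank is the loop variable of two complete enumerations, one for the accepting states
and one for the transitions. Reachability of banks is never decided; the soundness lemmas for the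
automata do not need it. -/
theorem logSpaceComputable_bankFA [Finite A] (c : ℕ) {pa pe : PrintProg cd} (da : pa.Det) (de : pe.Det)
    {acc : List A → (Slot M.k → ℕ) → List (List Bool)}
    {edg : List A → (Slot M.k → ℕ) → List (Edge Γ)}
    (ha : ∀ x, Prints x ((c + 2) ^ (x.length + 1).size) pa fun β =>
      (acc x β).flatMap fun q => .acceptMark :: q.map .bit)
    (he : ∀ x, Prints x ((c + 2) ^ (x.length + 1).size) pe fun β => (edg x β).flatMap Edge.encode) :
    LogSpaceComputable fun x =>
      (bankFA M.k ((c + 2) ^ (x.length + 1).size) (acc x) (edg x)).encode := by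
  let v₀ : SimMem cd (Option Bool) := (0, ⟨none, .leftEnd, M.start, fun _ => M.blank,
    ⟨M.start, fun _ => M.blank, fun _ => .stay, .stay, false⟩⟩)
  refine logSpaceComputable_of_run c v₀
    (.seq (outs [.startMark]) (.seq (printName false 0)
      (.seq (forAll (slots M.k) pa) (forAll (slots M.k) pe))))
    ⟨det_outs, det_printName, det_forAll da _, det_forAll de _⟩ fun x => ?_
  set N := (c + 2) ^ (x.length + 1).size
  have h₀ : SimState.Good N (RState.init v₀ [] : PrintState cd) :=
    ⟨rfl, rfl, rfl, rfl, fun _ => by simp only [RState.init, N]; positivity⟩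
  obtain ⟨s, h₁, h₂, h₃, h₄, h₅⟩ := run_forAll (ha x) (nodup_slots _) _ (h₀.congr
    (v := v₀) (e := ([] ++ [.startMark]) ++ (bankName 0 fun _ : Slot M.k => 0).map Tok.bit) rfl)
    rfl fun _ _ => rfl
  obtain ⟨s', k₁, k₂, k₃, k₄, k₅⟩ := run_forAll (he x) (nodup_slots _) s h₂ h₃ fun j _ => by
    rw [h₄]; rfl
  refine ⟨s', ⟨_, run_outs, _, run_printName (h₀.congr rfl), s, h₁, k₁⟩, ?_⟩
  rw [k₅, h₄, h₅]
  simp only [bankFA, FA.encode, List.flatMap_assoc, List.nil_append, List.cons_append,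
    List.append_assoc]
  rfl

end Print

end RProg

end RegReal

/-! ### From advice machines to realizability problems -/

namespace RegReal

open Relation Prog RProg

/-! ### Reduction of advice machines to automata -/

theorem encode_mem_NRR {Γ : Type} {F : Language Γ} {𝒜 : FA Γ} :
    𝒜.encode ∈ NRR F ↔ ∃ y ∈ F, 𝒜.Acc 𝒜.start y := by
  simp only [← FA.mem_language]
  constructor
  · rintro ⟨𝒜', h, hy⟩
    rwa [← FA.encode_injective h] at hy
  · exact fun h => ⟨𝒜, rfl, h⟩

theorem encode_mem_RR {Γ : Type} {F : Language Γ} {𝒜 : FA Γ} :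
    𝒜.encode ∈ RR F ↔ 𝒜.IsDFA ∧ ∃ y ∈ F, 𝒜.Acc 𝒜.start y := by
  simp only [← FA.mem_language]
  constructor
  · rintro ⟨𝒜', hd, h, hy⟩
    rw [← FA.encode_injective h] at hy hd
    exact ⟨hd, hy⟩
  · exact fun ⟨hd, h⟩ => ⟨𝒜, hd, rfl, h⟩

/-- Logarithmic space becomes polynomial size: `C * (log n + 1) + 1` is at most `(C + 1) * size (n +
1)`, and the power `K`, later the number of slots, only changes the constant base. -/
theorem pow_bound {b C K n : ℕ} (hb : 2 ≤ b) :
    (max (b ^ (C * (Nat.log 2 n + 1) + 1)) (n + 2)) ^ K ≤ (b ^ ((C + 1) * K)) ^ (n + 1).size := by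
  have h₁ : Nat.log 2 n + 1 ≤ (n + 1).size := by
    rw [Nat.succ_le_iff, Nat.lt_size]
    rcases Nat.eq_zero_or_pos n with rfl | hn
    · simp
    · exact (Nat.pow_log_le_self 2 (by omega)).trans (by omega)
  have h₂ : n + 2 ≤ 2 ^ (n + 1).size := Nat.lt_size_self _
  have h₃ : 1 ≤ (n + 1).size := by omega
  rw [mul_comm (C + 1), pow_mul, ← pow_mul, ← pow_mul, mul_comm K, mul_comm _ K, mul_comm K, pow_mul]
  refine Nat.pow_le_pow_left (max_le (Nat.pow_le_pow_right (by omega) ?_) (h₂.trans ?_)) _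
  · rw [add_mul, one_mul]
    exact Nat.add_le_add (Nat.mul_le_mul_left _ h₁) h₃
  · refine (Nat.pow_le_pow_left hb _).trans (Nat.pow_le_pow_right (by omega) ?_)
    exact Nat.le_mul_of_pos_left _ (by omega)

section Modulus

variable {A Obs Act : Type} {M : TM A Obs Act} (cd : Coding M)

/-- The modulus `(c + 2) ^ size (|x| + 1)` suffices to simulate `M` in space
`C * (log |x| + 1)`. -/
noncomputable def Coding.modulus (C n : ℕ) : ℕ :=
  ((cd.d + 2) ^ ((C + 1) * Nat.card (Slot M.k)) - 2 + 2) ^ (n + 1).size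

variable {cd} {C : ℕ}

/-- Because of the exponent `Nat.card (Slot M.k)` the modulus bounds the number of banks in use and
not only their entries; the deterministic case needs this for counting steps. The form `- 2 + 2`
fits the base `c + 2` of the counters. -/
theorem le_modulus (n : ℕ) :
    (max ((cd.d + 2) ^ (C * (Nat.log 2 n + 1) + 1)) (n + 2)) ^ Nat.card (Slot M.k) ≤
      cd.modulus C n := by
  have : Nonempty (Slot M.k) := ⟨.state⟩
  have hk : 0 < Nat.card (Slot M.k) := Nat.card_pos
  rw [Coding.modulus, Nat.sub_add_cancel]
  · exact pow_bound (by omega)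
  · exact (show 2 ≤ cd.d + 2 by omega).trans (Nat.le_self_pow (by positivity) _)

theorem bound_le_modulus (n : ℕ) :
    max ((cd.d + 2) ^ (C * (Nat.log 2 n + 1) + 1)) (n + 2) ≤ cd.modulus C n := by
  have : Nonempty (Slot M.k) := ⟨.state⟩
  have hk : 0 < Nat.card (Slot M.k) := Nat.card_pos
  exact (Nat.le_self_pow hk.ne' _).trans (le_modulus n)

end Modulus

section Reduction

variable {A Γ : Type} {M : AdviceTM A Γ} (cd : Coding M)

/-- The transition system on banks given by an advice machine. -/
noncomputable def bankSys (x : List A) (N : ℕ) : AdvSys Γ (Slot M.k → ℕ) (Instr M.State M.Work M.k Bool) where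
  en := cd.instrs x
  nxt := cd.stepB N x
  adv m := m.act
  acc := {β | cd.state β ∈ M.accept}

variable {cd} {C N : ℕ} {x : List A} {y : List Γ}

/-- The banks with entries below the bound. -/
noncomputable def boundedBanks (k R : ℕ) : Finset (Slot k → ℕ) :=
  (Set.Finite.pi' fun _ : Slot k => Set.finite_lt_nat R).toFinset

theorem mem_boundedBanks {k R : ℕ} {β : Slot k → ℕ} : β ∈ boundedBanks k R ↔ ∀ j, β j < R := by
  simp [boundedBanks]

theorem card_boundedBanks (k R : ℕ) : (boundedBanks k R).card = R ^ Nat.card (Slot k) := by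
  classical
  have : Fintype (Slot k) := Fintype.ofFinite _
  have h : boundedBanks k R = Fintype.piFinset fun _ => Finset.range R := by
    ext β
    simp [mem_boundedBanks]
  rw [h, Fintype.card_piFinset]
  simp

section

variable (H : ∀ p, M.Reaches x y p → p.1.WorkBounded (C * (Nat.log 2 x.length + 1)))

include H

theorem accepts_iff_bank : (∃ c : M.Cfg, M.Reaches x y (c, []) ∧ c.state ∈ M.accept) ↔
    ∃ β ∈ (bankSys cd x (cd.modulus C x.length)).acc, ReflTransGen
      (bankSys cd x (cd.modulus C x.length)).Move (fun _ => 0, y) (β, []) := by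
  constructor
  · rintro ⟨c, h, hc⟩
    obtain ⟨β, h₁, h₂⟩ := breach_of_preach (π := advPort Γ) (cd := cd) (bound_le_modulus _) H h
    exact ⟨β, by rwa [← h₂.rep.cfg_state] at hc, h₁⟩
  · rintro ⟨β, hβ, h⟩
    obtain ⟨c, h₁, h₂⟩ := preach_of_breach (π := advPort Γ) (cd := cd) (bound_le_modulus _) H h
    refine ⟨c, h₁, ?_⟩
    rw [← h₂.rep.cfg_state]
    exact hβ

theorem mem_boundedBanks_of_reach {q : (Slot M.k → ℕ) × List Γ}
    (h : ReflTransGen (bankSys cd x (cd.modulus C x.length)).Move (fun _ => 0, y) q) :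
    q.1 ∈ boundedBanks M.k
      (max ((cd.d + 2) ^ (C * (Nat.log 2 x.length + 1) + 1)) (x.length + 2)) := by
  obtain ⟨c, h₁, h₂⟩ := preach_of_breach (π := advPort Γ) (cd := cd) (bound_le_modulus _) H h
  exact mem_boundedBanks.2 h₂.lt

end

theorem mem_banks_of_bounded {β : Slot M.k → ℕ} {n : ℕ} (h : β ∈ boundedBanks M.k
    (max ((cd.d + 2) ^ (C * (Nat.log 2 n + 1) + 1)) (n + 2))) :
    β ∈ banksOf (cd.modulus C n) (slots M.k) fun _ => 0 :=
  mem_banksOf fun j => by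
    simpa [mem_slots] using (mem_boundedBanks.1 h j).trans_le (bound_le_modulus n)

end Reduction

section Nondeterministic

variable {A Γ : Type} {M : AdviceTM A Γ} (cd : Coding M)

open Classical in
/-- The flag tells whether the state is accepting. -/
noncomputable def acceptFun (m : Instr M.State M.Work M.k Bool) : StepFun M := fun q _ _ =>
  (if q ∈ M.accept then some true else none, m)

open Classical in
/-- The flag tells whether the instruction `m` is possible. -/
noncomputable def enabledFun (o : Option Γ) (m : Instr M.State M.Work M.k Bool) : StepFun M :=
  fun q a w => (if m ∈ M.trans q a w o then some true else none, m)

open Classical in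
noncomputable def acceptNames (n : ℕ) (β : Slot M.k → ℕ) : List (List Bool) :=
  if cd.state β ∈ M.accept then [bankName n β] else []

open Classical in
/-- The transitions at a bank. -/
noncomputable def bankEdges (lΓ : List Γ) (lm : List (Option Γ × Instr M.State M.Work M.k Bool))
    (f : Option (Option Γ) → ℕ) (x : List A) (N : ℕ) (β : Slot M.k → ℕ) : List (Edge Γ) :=
  lΓ.map (fun γ => ⟨bankName (f none) β, some γ, bankName (f (some (some γ))) β⟩) ++
  (⟨bankName (f none) β, none, bankName (f (some none)) β⟩ ::
  lm.flatMap fun z => if z.2 ∈ cd.instrs x β z.1 then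
    [⟨bankName (f (some z.1)) β, none,
      bankName (f (AdvSys.nextMode z.2.act z.1)) (cd.stepB N x β z.2)⟩] else [])

variable {cd}

noncomputable def printAccept (m : Instr M.State M.Work M.k Bool) (n : ℕ) : PrintProg cd :=
  .seq (stepProg (acceptFun m)) (.ite (mem fun v => v.2.u = some true)
    (.seq (outs [.acceptMark]) (printName false n)) .skip)

open Classical in
noncomputable def printEdges (lΓ : List Γ) (lm : List (Option Γ × Instr M.State M.Work M.k Bool))
    (f : Option (Option Γ) → ℕ) : PrintProg cd :=
  .seq (seqs (lΓ.map fun γ => printEdge (f none) (some γ) false (f (some (some γ)))))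
  (.seq (printEdge (f none) none false (f (some none)))
  (seqs (lm.map fun z => .seq (stepProg (enabledFun z.1 z.2)) (.ite (mem fun v => v.2.u = some true)
    (printEdge (f (some z.1)) none true (f (AdvSys.nextMode z.2.act z.1)))
      .skip))))

theorem run_acceptName {n N : ℕ} {x : List A} {s : PrintState cd} (hs : s.Good N) :
    (Prog.seq (outs [.acceptMark]) (printName false n) : PrintProg cd).Run
      (RSem (outPort _) x N) s
      { s with port := s.port ++ .acceptMark :: (bankName n (s.bank false)).map .bit } := by
  refine ⟨_, run_outs, ?_⟩
  convert run_printName (hs.congr hs.dig) using 1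
  simp
  rfl

theorem prints_printAccept {m : Instr M.State M.Work M.k Bool} {n N : ℕ} {x : List A} :
    Prints x N (printAccept m n : PrintProg cd) fun β =>
      (acceptNames cd n β).flatMap fun q => .acceptMark :: q.map .bit := by
  convert (determines_stepProg (x := x) (N := N) (g := acceptFun m)).prints
    (o := fun β _ => .acceptMark :: (bankName n β).map .bit) fun s hs => run_acceptName hs using 1
  · rfl
  funext β
  by_cases h : cd.state β ∈ M.accept <;> simp [acceptNames, stepFun, acceptFun, h]

theorem prints_printEdges {lΓ : List Γ} {lm : List (Option Γ × Instr M.State M.Work M.k Bool)}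
    {f : Option (Option Γ) → ℕ} {N : ℕ} {x : List A} :
    Prints x N (printEdges lΓ lm f : PrintProg cd) fun β =>
      (bankEdges cd lΓ lm f x N β).flatMap Edge.encode := by
  classical
  convert (Prints.seqs (fun γ => prints_of_run (o := fun β => Edge.encode
    ⟨bankName (f none) β, some γ, bankName (f (some (some γ))) β⟩) fun s hs => run_printEdge hs)
      lΓ).seq ((prints_of_run (o := fun β => Edge.encode
    ⟨bankName (f none) β, none, bankName (f (some none)) β⟩) fun s hs => run_printEdge hs).seq
    (Prints.seqs (fun z => (determines_stepProg (x := x) (N := N) (g := enabledFun z.1 z.2)).prints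
      (o := fun β β' => Edge.encode ⟨bankName (f (some z.1)) β, none,
        bankName (f (AdvSys.nextMode z.2.act z.1)) β'⟩)
      fun s hs => run_printEdge hs) lm)) using 1
  · rfl
  funext β
  simp only [bankEdges, List.flatMap_append, List.flatMap_cons, List.flatMap_map,
    List.flatMap_assoc]
  congr 2
  refine congrArg (List.flatMap · lm) (funext fun z => ?_)
  by_cases h : z.2 ∈ cd.instrs x β z.1
  · have h' : (stepFun cd x N (enabledFun z.1 z.2) β).1 = some true := if_pos h
    rw [if_pos h, if_pos h', List.flatMap_singleton]
    rfl
  · have h' : ¬ (stepFun cd x N (enabledFun z.1 z.2) β).1 = some true := by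
      have : (stepFun cd x N (enabledFun z.1 z.2) β).1 = none := if_neg h
      simp [this]
    rw [if_neg h, if_neg h', List.flatMap_nil]

theorem mem_bankEdges {lΓ : List Γ} {lm : List (Option Γ × Instr M.State M.Work M.k Bool)}
    {f : Option (Option Γ) → ℕ} {x : List A} {N : ℕ} {β : Slot M.k → ℕ} (hΓ : ∀ γ, γ ∈ lΓ)
    (hm : ∀ z, z ∈ lm) {e : Edge Γ} : e ∈ bankEdges cd lΓ lm f x N β ↔
      (bankSys cd x N).NEdge (fun μ β => bankName (f μ) β) β e := by
  classical
  simp only [bankEdges, List.mem_append, List.mem_map, List.mem_cons, List.mem_flatMap]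
  constructor
  · rintro (⟨γ, -, rfl⟩ | rfl | ⟨⟨o, m⟩, -, h⟩)
    · exact .read γ
    · exact .halted
    · split_ifs at h with h'
      · rw [List.mem_singleton] at h
        subst h
        exact AdvSys.NEdge.step (Y := bankSys cd x N) (name := fun μ β => bankName (f μ) β)
          (β := β) o m h'
      · simp at h
  · rintro (γ | _ | ⟨o, m, h⟩)
    · exact .inl ⟨γ, hΓ γ, rfl⟩
    · exact .inr (.inl rfl)
    · refine .inr (.inr ⟨⟨o, m⟩, hm _, ?_⟩)
      rw [if_pos (show m ∈ cd.instrs x β o from h), List.mem_singleton]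
      rfl

/-- The automaton has the transitions `NEdge` at all banks below the modulus, in particular at the
reachable ones. Thus `AdvSys.acc_of_accepts` and `AdvSys.accepts_of_acc` compare it, advice word by
advice word, with the system on banks. -/
theorem logReduces_NRR [Finite A] [Finite Γ] {F : Language Γ} (hM : M.LogSpace F) :
    LogReduces (M.language F) (NRR F) := by
  classical
  obtain ⟨cd⟩ := Coding.exists M
  obtain ⟨C, hC⟩ := hM
  have := M.finiteState
  have := M.finiteWork
  obtain ⟨n, f, g, hf, -, hf₀⟩ := exists_coding (Option (Option Γ)) none
  obtain ⟨lΓ, hΓ⟩ : ∃ l : List Γ, ∀ γ, γ ∈ l :=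
    ⟨(Set.finite_univ (α := Γ)).toFinset.toList, by simp⟩
  obtain ⟨lm, hm⟩ : ∃ l : List (Option Γ × Instr M.State M.Work M.k Bool), ∀ z, z ∈ l :=
    ⟨(Set.finite_univ (α := Option Γ × Instr M.State M.Work M.k Bool)).toFinset.toList, by simp⟩
  let m : Instr M.State M.Work M.k Bool :=
    ⟨M.start, fun _ => M.blank, fun _ => .stay, .stay, false⟩
  refine ⟨_, logSpaceComputable_bankFA (cd := cd)
    ((cd.d + 2) ^ ((C + 1) * Nat.card (Slot M.k)) - 2) (pa := printAccept m (f (some none))) (pe := printEdges lΓ lm f)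
    ⟨det_stepProg, ⟨det_outs, det_printName⟩, trivial⟩
    ⟨det_seqs ?_, det_printEdge, det_seqs ?_⟩ (fun x => prints_printAccept)
    (fun x => prints_printEdges), fun x => ?_⟩
  · simp only [List.mem_map]
    rintro _ ⟨γ, -, rfl⟩
    exact det_printEdge
  · simp only [List.mem_map]
    rintro _ ⟨z, -, rfl⟩
    exact ⟨det_stepProg, det_printEdge, trivial⟩
  rw [encode_mem_NRR]
  refine exists_congr fun y => and_congr_right fun hy => ?_
  have H := hC x y hy
  rw [accepts_iff_bank H (cd := cd)]
  constructor
  · rintro ⟨β, hβ, h⟩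
    have := AdvSys.acc_of_accepts (Y := bankSys cd x (cd.modulus C x.length))
      (name := fun μ β => bankName (f μ) β)
      (𝒜 := bankFA M.k (cd.modulus C x.length) (acceptNames cd (f (some none)))
        (bankEdges cd lΓ lm f x (cd.modulus C x.length)))
      (D := boundedBanks M.k
        (max ((cd.d + 2) ^ (C * (Nat.log 2 x.length + 1) + 1)) (x.length + 2)))
      (fun β hβ hβ' => List.mem_flatMap.2 ⟨β, mem_banks_of_bounded hβ, by
        have hβ' : cd.state β ∈ M.accept := hβ'
        simp [acceptNames, hβ']⟩)
      (fun β hβ e he => List.mem_flatMap.2 ⟨β, mem_banks_of_bounded hβ, (mem_bankEdges hΓ hm).2 he⟩)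
      (fun q hq => mem_boundedBanks_of_reach H hq) h hβ rfl
    -- The mode `none` has the code `0`, so its name at the zero bank is the `start` of `bankFA`.
    rw [hf₀] at this
    exact this
  · intro h
    refine AdvSys.accepts_of_acc (name := fun μ β => bankName (f μ) β) ?_ ?_ ?_ h ?_
    · intro μ β μ' β' h
      obtain ⟨h₁, h₂⟩ := bankName_inj h
      exact ⟨Function.LeftInverse.injective hf h₁, h₂⟩
    · intro q hq
      obtain ⟨β, -, hβ⟩ := List.mem_flatMap.1 hq
      rw [acceptNames] at hβ
      split_ifs at hβ with h'
      · exact ⟨β, h', List.mem_singleton.1 hβ⟩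
      · simp at hβ
    · intro e he
      obtain ⟨β, -, hβ⟩ := List.mem_flatMap.1 he
      exact ⟨β, (mem_bankEdges hΓ hm).1 hβ⟩
    · intro μ β hβ
      obtain ⟨h₁, rfl⟩ := bankName_inj (show bankName 0 _ = _ from hβ)
      rw [← hf₀] at h₁
      obtain rfl := Function.LeftInverse.injective hf h₁
      exact Or.inl .refl

end Nondeterministic

section Deterministic

variable {A Γ : Type} {M : AdviceTM A Γ} (cd : Coding M) (m₀ : Instr M.State M.Work M.k Bool)

open Classical in
/-- Execution of the instruction for the scanned letter `γ`. -/
noncomputable def letterFun (γ : Γ) : StepFun M := fun q a w =>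
  if h : ∃ m, m ∈ M.trans q a w (some γ) then
    (if h.choose.act then some true else none, h.choose) else (some false, m₀)

open Classical in
/-- Execution of the instruction at the end of the advice word. -/
noncomputable def endFun : StepFun M := fun q a w =>
  if q ∈ M.accept then (some true, m₀) else
    if h : ∃ m, m ∈ M.trans q a w none then (none, h.choose) else (some false, m₀)

/-- Determinism enters in `f_en` and `g_en`: the chosen instruction is the only possible one. At the
end of the advice acceptance is tested before a step is made, so an accepting state counts even if
the machine could continue. -/
theorem stepper (hM : M.Deterministic) (x : List A) (N : ℕ) :
    AdvSys.Stepper (bankSys cd x N) (fun γ => stepFun cd x N (letterFun m₀ γ))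
      (stepFun cd x N (endFun m₀)) where
  f_none γ β h := by
    by_cases h' : ∃ m, m ∈ cd.instrs x β (some γ)
    · have e : letterFun m₀ γ (cd.state β) (readInput x (β .pos)) (cd.syms β) =
        (if h'.choose.act then some true else none, h'.choose) := dif_pos h'
      simp only [stepFun, e] at h ⊢
      exact ⟨_, h'.choose_spec, by simpa [bankSys] using h, rfl⟩
    · have e : letterFun m₀ γ (cd.state β) (readInput x (β .pos)) (cd.syms β) =
        (some false, m₀) := dif_neg h'
      simp [stepFun, e] at h
  f_true γ β h := by
    by_cases h' : ∃ m, m ∈ cd.instrs x β (some γ)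
    · have e : letterFun m₀ γ (cd.state β) (readInput x (β .pos)) (cd.syms β) =
        (if h'.choose.act then some true else none, h'.choose) := dif_pos h'
      simp only [stepFun, e] at h ⊢
      exact ⟨_, h'.choose_spec, by simpa [bankSys] using h, rfl⟩
    · have e : letterFun m₀ γ (cd.state β) (readInput x (β .pos)) (cd.syms β) =
        (some false, m₀) := dif_neg h'
      simp [stepFun, e] at h
  f_en γ β i hi := by
    have h' : ∃ m, m ∈ cd.instrs x β (some γ) := ⟨i, hi⟩
    have e : letterFun m₀ γ (cd.state β) (readInput x (β .pos)) (cd.syms β) =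
      (if h'.choose.act then some true else none, h'.choose) := dif_pos h'
    have : h'.choose = i := hM _ _ _ _ h'.choose_spec hi
    simp only [stepFun, e, this]
    rfl
  g_none β h := by
    by_cases ha : cd.state β ∈ M.accept
    · simp [stepFun, endFun, ha] at h
    by_cases h' : ∃ m, m ∈ cd.instrs x β none
    · have e : endFun m₀ (cd.state β) (readInput x (β .pos)) (cd.syms β) =
        (none, h'.choose) := (if_neg ha).trans (dif_pos h')
      simp only [stepFun, e]
      exact ⟨_, h'.choose_spec, rfl⟩
    · have e : endFun m₀ (cd.state β) (readInput x (β .pos)) (cd.syms β) =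
        (some false, m₀) := (if_neg ha).trans (dif_neg h')
      simp [stepFun, e] at h
  g_true β h := by
    by_contra ha
    have ha : cd.state β ∉ M.accept := ha
    simp only [stepFun, endFun, if_neg ha] at h
    split_ifs at h
    all_goals simp at h
  g_acc β h := by
    have h : cd.state β ∈ M.accept := h
    simp [stepFun, endFun, h]
  g_en β ha i hi := by
    have ha : cd.state β ∉ M.accept := ha
    have h' : ∃ m, m ∈ cd.instrs x β none := ⟨i, hi⟩
    have e : endFun m₀ (cd.state β) (readInput x (β .pos)) (cd.syms β) =
      (none, h'.choose) := (if_neg ha).trans (dif_pos h')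
    have : h'.choose = i := hM _ _ _ _ h'.choose_spec hi
    simp only [stepFun, e, this]
    rfl

/-- The result of the computation from a bank until the flag is set. -/
noncomputable def chainRes (g : StepFun M) (x : List A) (N : ℕ) (β : Slot M.k → ℕ) :
    Option Bool × (Slot M.k → ℕ) := (AdvSys.chain (stepFun cd x N g))^[N] (none, β)

noncomputable def detAccept (x : List A) (N : ℕ) (β : Slot M.k → ℕ) : List (List Bool) :=
  if (chainRes cd (endFun m₀) x N β).1 = some true then [bankName 0 β] else []

noncomputable def detEdges (lΓ : List Γ) (x : List A) (N : ℕ) (β : Slot M.k → ℕ) : List (Edge Γ) :=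
  lΓ.flatMap fun γ => if (chainRes cd (letterFun m₀ γ) x N β).1 = some true then
    [⟨bankName 0 β, some γ, bankName 0 (chainRes cd (letterFun m₀ γ) x N β).2⟩] else []

/-- Bank and letter can be recovered from the source and the label of a transition, and they
determine the target; hence the printed automaton is deterministic for every input. -/
theorem logReduces_RR [Finite A] [Finite Γ] {F : Language Γ} (hd : M.Deterministic)
    (hM : M.LogSpace F) : LogReduces (M.language F) (RR F) := by
  classical
  obtain ⟨cd⟩ := Coding.exists M
  obtain ⟨C, hC⟩ := hM
  obtain ⟨lΓ, hΓ⟩ : ∃ l : List Γ, ∀ γ, γ ∈ l :=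
    ⟨(Set.finite_univ (α := Γ)).toFinset.toList, by simp⟩
  let m₀ : Instr M.State M.Work M.k Bool :=
    ⟨M.start, fun _ => M.blank, fun _ => .stay, .stay, false⟩
  have hpos : ∀ x : List A, 0 < cd.modulus C x.length := fun x =>
    (Nat.zero_le _).trans_lt ((show 0 < max _ _ from lt_max_of_lt_right (by omega)).trans_le
      (bound_le_modulus x.length))
  refine ⟨_, logSpaceComputable_bankFA (cd := cd)
    ((cd.d + 2) ^ ((C + 1) * Nat.card (Slot M.k)) - 2)
    (pa := .seq (chainProg (endFun m₀)) (.ite (mem fun v => v.2.u = some true)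
      (.seq (outs [.acceptMark]) (printName false 0)) .skip))
    (pe := seqs (lΓ.map fun γ => .seq (chainProg (letterFun m₀ γ))
      (.ite (mem fun v => v.2.u = some true) (printEdge 0 (some γ) true 0) .skip)))
    (acc := fun x => detAccept cd m₀ x (cd.modulus C x.length))
    (edg := fun x => detEdges cd m₀ lΓ x (cd.modulus C x.length))
    ⟨det_chainProg, ⟨det_outs, det_printName⟩, trivial⟩
    (det_seqs ?_) (fun x => ?_) (fun x => ?_), fun x => ?_⟩
  · simp only [List.mem_map]
    rintro _ ⟨γ, -, rfl⟩
    exact ⟨det_chainProg, det_printEdge, trivial⟩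
  · convert Determines.prints (r := chainRes cd (endFun m₀) x (cd.modulus C x.length))
      (determines_chainProg (x := x) (g := endFun m₀) (hpos x)) (o := fun β _ => .acceptMark :: (bankName 0 β).map .bit) fun s hs => run_acceptName hs using 1
    · rfl
    funext β
    by_cases h : (chainRes cd (endFun m₀) x (cd.modulus C x.length) β).1 = some true
    · rw [detAccept, if_pos h, List.flatMap_singleton, if_pos h]
    · rw [detAccept, if_neg h, List.flatMap_nil, if_neg h]
  · convert Prints.seqs (fun γ => Determines.prints
      (r := chainRes cd (letterFun m₀ γ) x (cd.modulus C x.length))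
      (determines_chainProg (x := x) (g := letterFun m₀ γ) (hpos x)) (o := fun β β' => Edge.encode ⟨bankName 0 β, some γ, bankName 0 β'⟩)
      fun s hs => run_printEdge hs) lΓ using 1
    · rfl
    funext β
    rw [detEdges, List.flatMap_assoc]
    refine congrArg (List.flatMap · lΓ) (funext fun γ => ?_)
    by_cases h : (chainRes cd (letterFun m₀ γ) x (cd.modulus C x.length) β).1 = some true
    · rw [if_pos h, List.flatMap_singleton, if_pos h]
    · rw [if_neg h, List.flatMap_nil, if_neg h]
  change x ∈ M.language F ↔ (bankFA M.k (cd.modulus C x.length)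
    (detAccept cd m₀ x (cd.modulus C x.length))
    (detEdges cd m₀ lΓ x (cd.modulus C x.length))).encode ∈ RR F
  set N := cd.modulus C x.length with hN
  set 𝒜 := bankFA M.k N (detAccept cd m₀ x N) (detEdges cd m₀ lΓ x N) with h𝒜
  have hacc : ∀ q ∈ 𝒜.accept, ∃ β, (chainRes cd (endFun m₀) x N β).1 = some true ∧
      q = bankName 0 β := by
    intro q hq
    obtain ⟨β, -, hβ⟩ := List.mem_flatMap.1 hq
    rw [detAccept] at hβ
    split_ifs at hβ with h'
    · exact ⟨β, h', List.mem_singleton.1 hβ⟩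
    · simp at hβ
  have hedges : ∀ e ∈ 𝒜.edges, ∃ β γ, (chainRes cd (letterFun m₀ γ) x N β).1 = some true ∧
      e = ⟨bankName 0 β, some γ, bankName 0 (chainRes cd (letterFun m₀ γ) x N β).2⟩ := by
    intro e he
    obtain ⟨β, -, hβ⟩ := List.mem_flatMap.1 he
    obtain ⟨γ, -, hγ⟩ := List.mem_flatMap.1 hβ
    split_ifs at hγ with h'
    · exact ⟨β, γ, h', List.mem_singleton.1 hγ⟩
    · simp at hγ
  have hdfa : 𝒜.IsDFA := by
    refine ⟨fun e he => ?_, fun e he e' he' => ?_⟩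
    · obtain ⟨β, γ, -, rfl⟩ := hedges e he
      simp
    · obtain ⟨β, γ, -, rfl⟩ := hedges e he
      obtain ⟨β', γ', -, rfl⟩ := hedges e' he'
      intro h₁ h₂
      obtain ⟨-, rfl⟩ := bankName_inj (show bankName 0 _ = bankName 0 _ from h₁)
      obtain rfl := Option.some.inj (show some _ = some _ from h₂)
      rfl
  rw [encode_mem_RR, and_iff_right hdfa]
  refine exists_congr fun y => and_congr_right fun hy => ?_
  have H := hC x y hy
  rw [accepts_iff_bank H (cd := cd), ← hN]
  constructor
  · rintro ⟨β, hβ, h⟩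
    refine (stepper cd m₀ hd x N).acc_of_accepts (p := (_, y)) (name := bankName 0) (N := N)
      (D := boundedBanks M.k
        (max ((cd.d + 2) ^ (C * (Nat.log 2 x.length + 1) + 1)) (x.length + 2)))
      (fun β hβ hβ' => List.mem_flatMap.2 ⟨β, mem_banks_of_bounded hβ, ?_⟩)
      (fun β hβ γ hγ => List.mem_flatMap.2 ⟨β, mem_banks_of_bounded hβ, List.mem_flatMap.2
        ⟨γ, hΓ γ, ?_⟩⟩) ?_
      (fun q hq => mem_boundedBanks_of_reach H hq) h hβ rfl
    · rw [detAccept, if_pos (show (chainRes cd (endFun m₀) x N β).1 = some true from hβ'), List.mem_singleton]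
    · rw [if_pos (show (chainRes cd (letterFun m₀ γ) x N β).1 = some true from hγ), List.mem_singleton]
      rfl
    -- The reachable banks lie in a set of at most `N` elements, so that `N` iterations suffice.
    · rw [card_boundedBanks]
      exact le_modulus _
  · intro h
    refine (stepper cd m₀ hd x N).accepts_of_acc (name := bankName 0) (N := N) ?_ hacc hedges h ?_
    · exact fun β β' h => (bankName_inj h).2
    · intro β hβ
      obtain ⟨-, rfl⟩ := bankName_inj (show bankName 0 _ = _ from hβ)
      exact .refl

end Deterministic

end RegReal

/-! ### Composition with a transducer whose output is never stored -/

namespace RegReal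

open Relation Prog RProg

/-! ### Pointer machines -/

/-- The state of a pointer machine: a finite memory, pointers to positions in a word, each given by
the rest of the word from this position on, and an additional one-way tape. -/
structure PState (K V B E : Type) where
  v : V
  ptr : K → List B
  ext : E

/-- Read a symbol and advance the pointer, copy a pointer, and change the memory. -/
inductive PPrim (K V B Obs Act : Type)
  | next (κ : K) (f : V → Option B → V)
  | copy (κ κ' : K)
  | upd (f : V → Obs → V × Act)

abbrev PProg (K V B Obs Act : Type) := Prog (PPrim K V B Obs Act) (V → Obs → Prop)

section PointerMachine

variable {K V B Obs Act E : Type} [DecidableEq K]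

def PPrim.apply (π : Port Obs Act E) : PPrim K V B Obs Act → PState K V B E → PState K V B E
  | next κ f, s => { s with
      v := f s.v (s.ptr κ).head?
      ptr := Function.update s.ptr κ (s.ptr κ).tail }
  | copy κ κ', s => { s with ptr := Function.update s.ptr κ' (s.ptr κ) }
  | upd f, s => { s with v := (f s.v (π.obs s.ext)).1, ext := π.app (f s.v (π.obs s.ext)).2 s.ext }

def PSem (π : Port Obs Act E) :
    Sem (PPrim K V B Obs Act) (V → Obs → Prop) (PState K V B E) where
  prim a s s' := s' = a.apply π s
  test t s := t s.v (π.obs s.ext)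

end PointerMachine

/-! ### Pointers into the output of a transducer -/

section Emits

variable {A B : Type} {T : Transducer A B} (cd : Coding T) (x : List A) (N : ℕ)

/-- Started with the bank `β`, the transducer halts after writing `w`. -/
inductive Emits : (Slot T.k → ℕ) → List B → Prop
  | halt {β} (h : cd.instrs x β () = ∅) : Emits β []
  | step {β m w} (hm : m ∈ cd.instrs x β ()) (h : Emits (cd.stepB N x β m) w) :
      Emits β (m.act.toList ++ w)

variable {cd x N}

theorem emits_of_breach {p q : (Slot T.k → ℕ) × List B} (h : ReflTransGen (BMove cd (outPort B) N x) p q)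
    (hq : cd.instrs x q.1 () = ∅) : ∃ w, q.2 = p.2 ++ w ∧ Emits cd x N p.1 w := by
  induction h using ReflTransGen.head_induction_on with
  | refl => exact ⟨[], by simp, .halt hq⟩
  | head h _ ih =>
    obtain ⟨m, hm, rfl⟩ := h
    obtain ⟨w, h₁, h₂⟩ := ih
    exact ⟨_, by rw [h₁]; simp [outPort], .step hm h₂⟩

theorem emits_init {C : ℕ} {w : List B}
    (H : ∀ p, T.Reaches x p → p.1.WorkBounded (C * (Nat.log 2 x.length + 1)))
    (h : ∃ c : T.Cfg, T.Reaches x (c, w) ∧ T.enabled x c () = ∅) :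
    Emits cd x (cd.modulus C x.length) (fun _ => 0) w := by
  obtain ⟨c, h₁, h₂⟩ := h
  obtain ⟨β, h₃, h₄⟩ := breach_of_preach (π := outPort B) (cd := cd) (bound_le_modulus _) H h₁
  rw [h₄.rep.enabled] at h₂
  obtain ⟨w', h₅, h₆⟩ := emits_of_breach h₃ h₂
  simp only [List.nil_append] at h₅
  rwa [h₅]

end Emits

section Pointer

variable {A B K V Obs Act E : Type} [DecidableEq K] {T : Transducer A B} (cd : Coding T)
  (π : Port Obs Act E) (m₀ : Instr T.State T.Work T.k (Option B))

/-- Memory of the pointer machine, flags for the pointers that have reached the end, and the symbol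
that has been read; it is `some none` at the end. -/
abbrev PtrMem (K V B : Type) := V × (K → Bool) × Option (Option B)

open Classical in
noncomputable def emitFun : PtrMem K V B → T.State → InputCell A → (Fin T.k → T.Work) →
    PtrMem K V B × Instr T.State T.Work T.k (Option B) := fun u q a w =>
  if h : ∃ m, m ∈ T.trans q a w () then ((u.1, u.2.1, h.choose.act.map some), h.choose)
  else ((u.1, u.2.1, some none), m₀)

variable {cd m₀} in
omit [DecidableEq K] in
theorem emitFun_neg {u : PtrMem K V B} {q a w} (h : ¬ ∃ m, m ∈ T.trans q a w ()) :
    emitFun m₀ u q a w = ((u.1, u.2.1, some none), m₀) := dif_neg h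

variable {cd m₀} in
omit [DecidableEq K] in
theorem emitFun_pos (hT : T.Deterministic) {u : PtrMem K V B} {q a w m} (h : m ∈ T.trans q a w ()) :
    emitFun m₀ u q a w = ((u.1, u.2.1, m.act.map some), m) := by
  have h' : ∃ m, m ∈ T.trans q a w () := ⟨m, h⟩
  rw [emitFun, dif_pos h', hT _ _ _ _ h'.choose_spec h]

variable {cd}

/-- Continue the computation in a bank until it writes a symbol or halts. -/
noncomputable def emitLoop (κ : K) : SimProg cd (PtrMem K V B) K Obs Act :=
  .loop (fun w => w.v.2.u.2.2 = none) (simStep cd π κ (emitFun m₀))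

def updU (f : PtrMem K V B → PtrMem K V B) : SimProg cd (PtrMem K V B) K Obs Act :=
  upd π fun v => (v.1, { v.2 with u := f v.2.u })

/-- Set the flag of the pointer if the end has been reached. -/
def setFlag (κ : K) (d : K → Bool) : Option (Option B) → K → Bool
  | some none => Function.update d κ true
  | _ => d

/-- A pointer is a bank with a configuration of the transducer: what lies ahead of it is what the
transducer will still write. The end flag prevents resuming a halted transducer, since the step that
detects the halt executes the dummy instruction `m₀` on the bank. -/
noncomputable def PPrim.toR : PPrim K V B Obs Act → SimProg cd (PtrMem K V B) K Obs Act
  | .next κ f => .ite (fun w => w.v.2.u.2.1 κ = true)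
      (updU π fun u => (f u.1 none, u.2.1, none))
      (.seq (updU π fun u => (u.1, u.2.1, none)) (.seq (emitLoop π m₀ κ)
        (updU π fun u => (f u.1 u.2.2.join, setFlag κ u.2.1 u.2.2, none))))
  | .copy κ κ' => if κ = κ' then .skip else
      .seq (copyBank κ κ') (updU π fun u => (u.1, Function.update u.2.1 κ' (u.2.1 κ), u.2.2))
  | .upd f => .prim (.loc fun v _ o => ((v.1, { v.2 with u := ((f v.2.u.1 o).1, v.2.u.2) }), .stay,
      (f v.2.u.1 o).2))

def PTest.toR (t : V → Obs → Prop) : RView (SimMem cd (PtrMem K V B)) A (Reg K T.k) Obs → Prop :=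
  fun w => t w.v.2.u.1 w.obs

theorem PPrim.det_toR (a : PPrim K V B Obs Act) : (a.toR π m₀ : SimProg cd _ K Obs Act).Det := by
  cases a with
  | next κ f => exact ⟨trivial, trivial, det_simStep, trivial⟩
  | copy κ κ' =>
    rw [PPrim.toR]
    split_ifs
    · trivial
    · exact ⟨det_copyBank, trivial⟩
  | upd f => trivial

variable {π m₀} {x : List A} {N : ℕ}

theorem run_updU {f : PtrMem K V B → PtrMem K V B} {s : SimState cd (PtrMem K V B) K E} :
    (updU π f : SimProg cd (PtrMem K V B) K Obs Act).Run (RSem π x N) s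
      { s with v := (s.v.1, { s.v.2 with u := f s.v.2.u }) } := run_upd

/-- Induction on `Emits`, which records that the transducer halts and so makes the loop terminate.
Silent steps are absorbed by the induction hypothesis, and halting is reported as `some none`. -/
theorem run_emitLoop (hT : T.Deterministic) {κ : K} {β : Slot T.k → ℕ} {w : List B}
    (h : Emits cd x N β w) : ∀ s : SimState cd (PtrMem K V B) K E, s.Good N → s.bank κ = β →
      s.v.2.u.2.2 = none → ∃ s' : SimState cd (PtrMem K V B) K E,
        (emitLoop π m₀ κ).Run (RSem π x N) s s' ∧ s'.Good N ∧ s'.v.2.u.1 = s.v.2.u.1 ∧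
        s'.v.2.u.2.1 = s.v.2.u.2.1 ∧ (∀ κ' ≠ κ, s'.bank κ' = s.bank κ') ∧ s'.port = s.port ∧
        ((w = [] ∧ s'.v.2.u.2.2 = some none) ∨
          ∃ b w', w = b :: w' ∧ s'.v.2.u.2.2 = some (some b) ∧ Emits cd x N (s'.bank κ) w') := by
  induction h with
  | @halt β h =>
    intro s hs hβ hu
    obtain ⟨v, -, hv, hg, hr⟩ := run_simStep (π := π) (x := x) (κ := κ) hs (emitFun m₀)
    have h' : ¬ ∃ m, m ∈ T.trans (cd.state (s.bank κ)) (readInput x (s.bank κ .pos))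
        (cd.syms (s.bank κ)) () := by
      rw [hβ]
      exact Set.not_nonempty_iff_eq_empty.2 h
    rw [emitFun_neg h'] at hv hg hr
    refine ⟨_, Run.loop_cons hu hr (Run.loop_done ?_), hg, ?_, ?_, ?_, rfl, Or.inl ⟨rfl, ?_⟩⟩
    · show ¬ v.2.u.2.2 = none
      simp [hv]
    · simp [hv]
    · simp [hv]
    · intro κ' hκ
      funext j
      simp [SimState.bank, setBank, hκ]
    · simp [hv]
  | @step β m w hm hw ih =>
    intro s hs hβ hu
    obtain ⟨v, -, hv, hg, hr⟩ := run_simStep (π := π) (x := x) (κ := κ) hs (emitFun m₀)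
    have h' : m ∈ T.trans (cd.state (s.bank κ)) (readInput x (s.bank κ .pos))
        (cd.syms (s.bank κ)) () := by
      rw [hβ]
      exact hm
    rw [emitFun_pos hT h'] at hv hg hr
    have hκ : ∀ κ' ≠ κ, SimState.bank (⟨v, setBank s.reg κ (cd.stepB N x (s.bank κ) m), s.pos, s.port⟩ :
        SimState cd (PtrMem K V B) K E) κ' = s.bank κ' := by
      intro κ' hκ
      funext j
      simp [SimState.bank, setBank, hκ]
    cases ha : m.act with
    | none =>
      rw [ha] at hv
      obtain ⟨s', h₁, h₂, h₃, h₄, h₅, h₆, h₇⟩ := ih _ hg (by rw [setBank_bank, hβ]) (by simp [hv])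
      refine ⟨s', Run.loop_cons hu hr h₁, h₂, by simp [h₃, hv], by simp [h₄, hv],
        fun κ' h => (h₅ κ' h).trans (hκ κ' h), h₆, by simpa using h₇⟩
    | some b =>
      rw [ha] at hv
      refine ⟨_, Run.loop_cons hu hr (Run.loop_done ?_), hg, by simp [hv], by simp [hv], hκ, rfl,
        Or.inr ⟨b, w, by simp, by simp [hv], ?_⟩⟩
      · show ¬ v.2.u.2.2 = none
        simp [hv]
      · rw [setBank_bank, hβ]
        exact hw

variable (cd x N) in
/-- The state of a register machine represents a state of a pointer machine. -/
structure PtrRel (s : PState K V B E) (t : SimState cd (PtrMem K V B) K E) : Prop where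
  good : t.Good N
  mem : t.v.2.u.1 = s.v
  ext : t.port = s.ext
  ptr : ∀ κ, (t.v.2.u.2.1 κ = true ∧ s.ptr κ = []) ∨
    (t.v.2.u.2.1 κ = false ∧ Emits cd x N (t.bank κ) (s.ptr κ))

theorem PPrim.run_toR (hT : T.Deterministic) (a : PPrim K V B Obs Act) {s : PState K V B E}
    {t : SimState cd (PtrMem K V B) K E} (h : PtrRel cd x N s t) :
    ∃ t', (a.toR π m₀).Run (RSem π x N) t t' ∧ PtrRel cd x N (a.apply π s) t' := by
  cases a with
  | next κ f =>
    by_cases hd : t.v.2.u.2.1 κ = true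
    · have hs : s.ptr κ = [] := by
        rcases h.ptr κ with h' | h'
        · exact h'.2
        · rw [hd] at h'; simp at h'
      refine ⟨_, Run.ite_pos hd run_updU, h.good.congr (by exact h.good.dig), ?_, h.ext, fun κ' => ?_⟩
      · simp [PPrim.apply, h.mem, hs]
      · by_cases hκ : κ' = κ
        · subst hκ
          exact Or.inl ⟨hd, by simp [PPrim.apply, hs]⟩
        · simp only [PPrim.apply, Function.update_of_ne hκ]
          exact h.ptr κ'
    · have he := ((h.ptr κ).resolve_left fun h' => hd h'.1).2
      obtain ⟨s', h₁, h₂, h₃, h₄, h₅, h₆, h₇⟩ := run_emitLoop (π := π) (m₀ := m₀) hT he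
        { t with v := (t.v.1, { t.v.2 with u := (t.v.2.u.1, t.v.2.u.2.1, none) }) }
        (h.good.congr (by exact h.good.dig)) rfl rfl
      refine ⟨_, Run.ite_neg hd ⟨_, run_updU, _, h₁, run_updU⟩, h₂.congr (by exact h₂.dig), ?_,
        h₆.trans h.ext, fun κ' => ?_⟩
      · simp only [PPrim.apply, h₃, h.mem]
        rcases h₇ with ⟨hw, hu⟩ | ⟨b, w', hw, hu, -⟩
        · simp [hw, hu]
        · simp [hw, hu]
      · by_cases hκ : κ' = κ
        · subst hκ
          rcases h₇ with ⟨hw, hu⟩ | ⟨b, w', hw, hu, he'⟩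
          · exact Or.inl ⟨by simp [hu, setFlag], by simp [PPrim.apply, hw]⟩
          · refine Or.inr ⟨by simpa [hu, h₄, setFlag] using hd, ?_⟩
            simp only [PPrim.apply, Function.update_self, hw, List.tail_cons]
            exact he'
        · have hk := h.ptr κ'
          have hb : s'.bank κ' = t.bank κ' := h₅ κ' hκ
          have hf : setFlag κ s'.v.2.u.2.1 s'.v.2.u.2.2 κ' = t.v.2.u.2.1 κ' := by
            rw [h₄]
            rcases s'.v.2.u.2.2 with _ | _ | b
            · rfl
            · exact Function.update_of_ne hκ _ _
            · rfl
          rw [← hb, ← hf] at hk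
          simp only [PPrim.apply, Function.update_of_ne hκ]
          exact hk
  | copy κ κ' =>
    by_cases hκ : κ = κ'
    · subst hκ
      refine ⟨t, ?_, ?_⟩
      · rw [PPrim.toR, if_pos rfl]; rfl
      · simpa [PPrim.apply] using h
    · rw [PPrim.toR, if_neg hκ]
      have hg := h.good.setBank (κ := κ') (β := t.bank κ) (fun j => h.good.lt _) h.good.dig
        (e := t.port)
      refine ⟨_, ⟨_, run_copyBank h.good hκ, run_updU⟩, hg.congr (by exact h.good.dig), h.mem, h.ext,
        fun κ₁ => ?_⟩
      by_cases h₁ : κ₁ = κ'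
      · subst h₁
        simp only [PPrim.apply, Function.update_self, setBank_bank]
        exact h.ptr κ
      · have hb : SimState.bank (⟨t.v, setBank t.reg κ' (t.bank κ), t.pos, t.port⟩ :
            SimState cd (PtrMem K V B) K E) κ₁ = t.bank κ₁ := by
          funext j
          simp [SimState.bank, setBank, h₁]
        have hk := h.ptr κ₁
        rw [← hb] at hk
        simp only [PPrim.apply, Function.update_of_ne h₁]
        exact hk
  | upd f =>
    refine ⟨_, rfl, ⟨?_, h.good.aux, h.good.tmp, h.good.dig, h.good.lt⟩, ?_, ?_, h.ptr⟩
    · exact h.good.pos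
    · simp [PPrim.apply, h.mem, h.ext]
    · simp [PPrim.apply, h.mem, h.ext]

/-- A pointer program on the output of a transducer with an advice tape can be executed in
logarithmic space. -/
theorem adviceTM_of_pointer {A B K V Γ : Type} [Finite A] [Finite B] [Finite K] [DecidableEq K]
    [Finite V] {f : List A → List B} (hf : LogSpaceComputable f) (v₀ : V)
    (p : PProg K V B (Option Γ) Bool) :
    ∃ M : AdviceTM A Γ, (p.Det → TM.Deterministic M) ∧ ∀ F : Language Γ, M.LogSpace F ∧
      ∀ x, x ∈ M.language F ↔ ∃ y ∈ F, ∃ s, p.Run (PSem (advPort Γ)) ⟨v₀, fun _ => f x, y⟩ s ∧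
        s.ext = [] := by
  obtain ⟨T, hT, ⟨C, hC⟩, hc⟩ := hf
  obtain ⟨cd⟩ := Coding.exists T
  let m₀ : Instr T.State T.Work T.k (Option B) :=
    ⟨T.start, fun _ => T.blank, fun _ => .stay, .stay, none⟩
  obtain ⟨M, hM, h⟩ := adviceTM_of_run (Γ := Γ)
    ((cd.d + 2) ^ ((C + 1) * Nat.card (Slot T.k)) - 2)
    ((0, ⟨(v₀, fun _ => false, none), .leftEnd, T.start, fun _ => T.blank, m₀⟩) :
      SimMem cd (PtrMem K V B))
    (p.bind (PPrim.toR (advPort Γ) m₀) PTest.toR)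
  refine ⟨M, fun hp => hM (det_bind (PPrim.det_toR _ _) hp), fun F => ⟨(h F).1, fun x => ?_⟩⟩
  rw [(h F).2]
  refine exists_congr fun y => and_congr_right fun _ => ?_
  have h₀ : PtrRel cd x (cd.modulus C x.length) (⟨v₀, fun _ => f x, y⟩ : PState K V B (List Γ))
      (RState.init (0, ⟨(v₀, fun _ => false, none), .leftEnd, T.start, fun _ => T.blank, m₀⟩) y) :=
    ⟨⟨rfl, rfl, rfl, rfl, fun _ => by simp only [RState.init, Coding.modulus]; positivity⟩,
      rfl, rfl, fun κ => Or.inr ⟨rfl, emits_init (hC x) (hc x)⟩⟩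
  have hg : ∀ (b : V → Option Γ → Prop) (s : PState K V B (List Γ))
      (t : SimState cd (PtrMem K V B) K (List Γ)), PtrRel cd x (cd.modulus C x.length) s t →
      ((PSem (advPort Γ)).test b s ↔ (RSem (advPort Γ) x (cd.modulus C x.length)).test
        (PTest.toR b) t) := by
    intro b s t hR
    simp only [PSem, RSem, PTest.toR, RState.view, hR.mem, hR.ext]
  constructor
  · rintro ⟨t, ht, he⟩
    obtain ⟨s, h₁, h₂⟩ := run_bind_backward (S := PSem (advPort Γ))
      (R := PtrRel cd x (cd.modulus C x.length)) (fun a s t t' ht hR => by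
        obtain ⟨t'', h₁, h₂⟩ := a.run_toR (π := advPort Γ) (m₀ := m₀) hT hR
        obtain rfl := (PPrim.det_toR _ _ a).run_unique (RSem_functional _ _ _) h₁ ht
        exact ⟨_, rfl, h₂⟩) hg ht h₀
    exact ⟨s, h₁, by rw [← h₂.ext, he]⟩
  · rintro ⟨s, hs, he⟩
    obtain ⟨t, h₁, h₂⟩ := run_bind_forward (S := PSem (advPort Γ))
      (R := PtrRel cd x (cd.modulus C x.length)) (fun a s s' t ha hR => by
        obtain rfl := ha
        exact a.run_toR (π := advPort Γ) (m₀ := m₀) hT hR) hg hs h₀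
    exact ⟨t, h₁, by rw [h₂.ext, he]⟩

end Pointer

end RegReal

/-! ### Pointer programs that check and run a described automaton -/

namespace RegReal

open Relation Prog

/-! ### Total and partial correctness -/

/-- `p` terminates from `s` for some run, and all its runs end in states with `Q`. -/
def Sure {P T σ : Type} (S : Sem P T σ) (p : Prog P T) (s : σ) (Q : σ → Prop) : Prop :=
  (∃ s', p.Run S s s') ∧ ∀ s', p.Run S s s' → Q s'

namespace Sure

variable {P T σ : Type} {S : Sem P T σ} {p q : Prog P T} {s : σ} {Q R : σ → Prop} {t : T}

theorem exists_run (h : Sure S p s Q) : ∃ s', p.Run S s s' ∧ Q s' :=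
  h.1.imp fun s' hs => ⟨hs, h.2 s' hs⟩

theorem mono (h : Sure S p s Q) (hQ : ∀ s', Q s' → R s') : Sure S p s R :=
  ⟨h.1, fun s' hs => hQ s' (h.2 s' hs)⟩

theorem skip (h : Q s) : Sure S .skip s Q := ⟨⟨s, rfl⟩, by rintro _ rfl; exact h⟩

theorem seq (h : Sure S p s Q) (h' : ∀ m, Q m → Sure S q m R) : Sure S (.seq p q) s R := by
  obtain ⟨m, hm, hQ⟩ := h.exists_run
  refine ⟨(h' m hQ).1.imp fun s' hs => ⟨m, hm, hs⟩, ?_⟩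
  rintro s' ⟨m', h₁, h₂⟩
  exact (h' m' (h.2 m' h₁)).2 s' h₂

theorem ite_pos (ht : S.test t s) (h : Sure S p s Q) : Sure S (.ite t p q) s Q := by
  refine ⟨h.1.imp fun s' hs => Run.ite_pos ht hs, ?_⟩
  rintro s' (⟨-, hs⟩ | ⟨hn, -⟩)
  exacts [h.2 s' hs, absurd ht hn]

theorem ite_neg (ht : ¬ S.test t s) (h : Sure S q s Q) : Sure S (.ite t p q) s Q := by
  refine ⟨h.1.imp fun s' hs => Run.ite_neg ht hs, ?_⟩
  rintro s' (⟨hn, -⟩ | ⟨-, hs⟩)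
  exacts [absurd hn ht, h.2 s' hs]

theorem loop_done (ht : ¬ S.test t s) (h : Q s) : Sure S (.loop t p) s Q := by
  refine ⟨⟨s, Run.loop_done ht⟩, ?_⟩
  rintro s' ⟨hs, -⟩
  rcases hs.cases_head with rfl | ⟨m, hm, -⟩
  exacts [h, absurd hm.1 ht]

theorem loop_cons (ht : S.test t s) (h : Sure S p s fun m => Sure S (.loop t p) m Q) :
    Sure S (.loop t p) s Q := by
  obtain ⟨m, hm, ⟨s', hs'⟩, -⟩ := h.exists_run
  refine ⟨⟨s', Run.loop_cons ht hm hs'⟩, ?_⟩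
  rintro s' ⟨hs, hn⟩
  rcases hs.cases_head with rfl | ⟨m, hm, hs⟩
  · exact absurd ht hn
  · exact (h.2 m hm.2).2 s' ⟨hs, hn⟩

end Sure

/-! ### Pointer programs on descriptions of automata -/

/-- The pointers: the beginning of the word, the current state, two scanning pointers, and scratch
pointers. -/
inductive Ptr
  | org
  | cur
  | e
  | e'
  | s₁
  | s₂
  | s₃
  | s₄
  deriving DecidableEq

instance : Finite Ptr := by
  refine Finite.of_surjective (α := Fin 8)
    (fun i => [Ptr.org, .cur, .e, .e', .s₁, .s₂, .s₃, .s₄].get i) fun p => ?_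
  cases p
  exacts [⟨0, rfl⟩, ⟨1, rfl⟩, ⟨2, rfl⟩, ⟨3, rfl⟩, ⟨4, rfl⟩, ⟨5, rfl⟩, ⟨6, rfl⟩, ⟨7, rfl⟩]

/-- The memory: the symbols read last with the pointers, the state of the syntax check, the result of
the last comparison, a stored result, whether the automaton is not deterministic, and whether the
input is accepted. -/
structure ScanMem (Γ : Type) where
  tok : Ptr → Option (Tok Γ)
  st : Fin 5
  flag : Bool
  flag' : Bool
  bad : Bool
  done : Bool

instance (Γ : Type) [Finite Γ] : Finite (Tok Γ) := by
  refine Finite.of_surjective (α := Bool ⊕ Fin 3 ⊕ Option Γ)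
    (fun
      | .inl b => .bit b
      | .inr (.inl 0) => .startMark
      | .inr (.inl 1) => .acceptMark
      | .inr (.inl 2) => .edgeMark
      | .inr (.inr o) => .label o) ?_
  rintro (b | _ | _ | _ | o)
  exacts [⟨.inl b, rfl⟩, ⟨.inr (.inl 0), rfl⟩, ⟨.inr (.inl 1), rfl⟩, ⟨.inr (.inl 2), rfl⟩,
    ⟨.inr (.inr o), rfl⟩]

instance (Γ : Type) [Finite Γ] : Finite (ScanMem Γ) :=
  Finite.of_injective (fun v => (v.tok, v.st, v.flag, v.flag', v.bad, v.done)) (by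
    rintro ⟨⟩ ⟨⟩ h
    simpa using h)

abbrev ScanState (Γ : Type) := PState Ptr (ScanMem Γ) (Tok Γ) (List Γ)

abbrev ScanProg (Γ : Type) := PProg Ptr (ScanMem Γ) (Tok Γ) (Option Γ) Bool

namespace ScanProg

variable {Γ : Type}

/-- Read a symbol. -/
def adv (p : Ptr) : ScanProg Γ := .prim (.next p fun v b => { v with tok := Function.update v.tok p b })

def cpy (p q : Ptr) : ScanProg Γ := .prim (.copy p q)

def chg (f : ScanMem Γ → Option Γ → ScanMem Γ) : ScanProg Γ := .prim (.upd fun v o => (f v o, false))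

def IsBit : Option (Tok Γ) → Prop
  | some (.bit _) => True
  | _ => False

open Classical in
/-- Compare the binary words at two pointers. -/
noncomputable def cmp (p q : Ptr) : ScanProg Γ :=
  .seq (cpy p .s₁) (.seq (cpy q .s₂) (.seq (adv .s₁) (.seq (adv .s₂) (.seq
    (.loop (fun v _ => IsBit (v.tok .s₁) ∧ v.tok .s₁ = v.tok .s₂) (.seq (adv .s₁) (adv .s₂)))
    (chg fun v _ =>
      { v with flag := decide (¬ IsBit (v.tok .s₁) ∧ ¬ IsBit (v.tok .s₂)) })))))

/-- Skip a binary word and read the next symbol. -/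
def pass (p : Ptr) : ScanProg Γ := .seq (adv p) (.loop (fun v _ => IsBit (v.tok p)) (adv p))

/-- Execute `h` for all transitions. -/
def scan (p : Ptr) (h : ScanProg Γ) : ScanProg Γ :=
  .seq (cpy .org p) (.seq (adv p) (.loop (fun v _ => v.tok p ≠ none)
    (.seq (.ite (fun v _ => v.tok p = some .edgeMark) h .skip) (adv p))))

open Classical in
/-- Check whether two transitions violate determinism. -/
noncomputable def checkPair : ScanProg Γ :=
  .seq (cmp .e .e') (.seq (chg fun v _ => { v with flag' := v.flag })
  (.seq (cpy .e .s₃) (.seq (pass .s₃) (.seq (cpy .e' .s₄) (.seq (pass .s₄) (.seq (cmp .s₃ .s₄)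
  (chg fun v _ => { v with bad := decide (v.bad = true ∨
    (v.flag' = true ∧ v.tok .s₃ = v.tok .s₄ ∧ v.flag = false) ∨
      v.tok .s₃ = some (.label none)) })))))))

noncomputable def checkDet : ScanProg Γ := scan .e (scan .e' checkPair)

/-- The transition function of the syntax check. -/
def syntaxStep : Fin 5 → Tok Γ → Fin 5
  | 0, .startMark => 1
  | 1, .bit _ => 1
  | 1, .acceptMark => 1
  | 1, .edgeMark => 2
  | 2, .bit _ => 2
  | 2, .label _ => 3
  | 3, .bit _ => 3
  | 3, .edgeMark => 2
  | _, _ => 4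

def checkSyntax : ScanProg Γ :=
  .seq (cpy .org .e) (.seq (adv .e) (.loop (fun v _ => v.tok .e ≠ none)
    (.seq (chg fun v _ => { v with st := (v.tok .e).elim 4 (syntaxStep v.st) }) (adv .e))))

/-- Acceptance means finishing with empty advice, so an input is rejected by never finishing. -/
def diverge : ScanProg Γ := .loop (fun _ _ => True) .skip

/-- Follow the scanned transition. -/
noncomputable def take : ScanProg Γ := .seq (cpy .e .cur) (.prim (.upd fun v _ =>
  (v, open Classical in decide (v.tok .e ≠ some (.label none)))))

/-- One step of the simulation of an automaton. -/
noncomputable def simBody (nd : Bool) : ScanProg Γ :=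
  -- At the end of the description the scan starts again, so the transitions can be used in any
  -- order.
  .ite (fun v _ => v.tok .e = none) (.seq (cpy .org .e) (adv .e))
  (.ite (fun v _ => v.tok .e = some .acceptMark)
    (.seq (cmp .e .cur) (.seq (chg fun v o => { v with done := v.flag && o.isNone }) (adv .e)))
  (.ite (fun v _ => v.tok .e = some .edgeMark)
    (.seq (cmp .e .cur) (.seq (pass .e) (.seq
      -- If the advice is exhausted, then `o = none` and the second alternative is just the ε-label
      -- again.
      (.ite (fun v o => v.flag = true ∧ (v.tok .e = some (.label none) ∨ v.tok .e = some (.label o)))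
        (if nd then .choice take .skip else take) .skip)
      (adv .e))))
  (adv .e)))

noncomputable def simulate (nd : Bool) : ScanProg Γ :=
  .seq (cpy .org .cur) (.seq (adv .cur) (.seq (cpy .org .e) (.seq (adv .e)
    (.loop (fun v _ => v.done = false) (simBody nd)))))

/-- The program that decides whether the described automaton accepts the advice word. -/
noncomputable def main (nd : Bool) : ScanProg Γ :=
  .seq checkSyntax (.ite (fun v _ => v.st = 1 ∨ v.st = 3)
    (.seq (if nd then .skip else checkDet) (.ite (fun v _ => v.bad = true) diverge (simulate nd)))
    diverge)

theorem det_main : (main false : ScanProg Γ).Det := by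
  simp [main, checkSyntax, checkDet, scan, checkPair, cmp, pass, simulate, simBody, take, diverge, adv,
    cpy, chg, Det]

/-! ### Correctness of the subprograms -/

/-- What `cmp` and similar programs leave unchanged if they use the pointers in `Z`. -/
structure Frame (Z : Set Ptr) (s s' : ScanState Γ) : Prop where
  ptr : ∀ p ∉ Z, s'.ptr p = s.ptr p
  tok : ∀ p ∉ Z, s'.v.tok p = s.v.tok p
  ext : s'.ext = s.ext
  flag' : s'.v.flag' = s.v.flag'
  bad : s'.v.bad = s.v.bad
  done : s'.v.done = s.v.done

theorem Frame.trans {Z : Set Ptr} {s s' s'' : ScanState Γ} (h : Frame Z s s') (h' : Frame Z s' s'') :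
    Frame Z s s'' where
  ptr p hp := (h'.ptr p hp).trans (h.ptr p hp)
  tok p hp := (h'.tok p hp).trans (h.tok p hp)
  ext := h'.ext.trans h.ext
  flag' := h'.flag'.trans h.flag'
  bad := h'.bad.trans h.bad
  done := h'.done.trans h.done

theorem Frame.refl {Z : Set Ptr} (s : ScanState Γ) : Frame Z s s :=
  ⟨fun _ _ => rfl, fun _ _ => rfl, rfl, rfl, rfl, rfl⟩

/-- The word `t` starts with the symbol read last. -/
def At (s : ScanState Γ) (p : Ptr) (t : List (Tok Γ)) : Prop :=
  s.v.tok p = t.head? ∧ s.ptr p = t.tail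

theorem sure_adv {p : Ptr} {s : ScanState Γ} : Sure (PSem (advPort Γ)) (adv p) s fun s' =>
    Frame {p} s s' ∧ At s' p (s.ptr p) ∧ s'.v.flag = s.v.flag := by
  refine ⟨⟨_, rfl⟩, ?_⟩
  rintro _ rfl
  refine ⟨⟨fun q hq => ?_, fun q hq => ?_, rfl, rfl, rfl, rfl⟩, ⟨?_, ?_⟩, rfl⟩ <;>
    simp_all [PPrim.apply]

theorem sure_cpy {p q : Ptr} {s : ScanState Γ} : Sure (PSem (advPort Γ)) (cpy p q) s fun s' =>
    Frame {q} s s' ∧ s'.ptr q = s.ptr p ∧ s'.v = s.v := by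
  refine ⟨⟨_, rfl⟩, ?_⟩
  rintro _ rfl
  refine ⟨⟨fun q hq => ?_, fun q hq => ?_, rfl, rfl, rfl, rfl⟩, ?_, rfl⟩ <;>
    simp_all [PPrim.apply]

theorem sure_chg {f : ScanMem Γ → Option Γ → ScanMem Γ} {s : ScanState Γ} :
    Sure (PSem (advPort Γ)) (chg f) s fun s' => s' = { s with v := f s.v s.ext.head? } := by
  refine ⟨⟨_, rfl⟩, ?_⟩
  rintro _ rfl
  simp [PPrim.apply, advPort]

theorem isBit_head {r : List (Tok Γ)} (h : NoBit r) : ¬ IsBit r.head? := by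
  rcases r with _ | ⟨_ | _, _⟩ <;> simp_all [NoBit, IsBit]

/-- The loop stops at the first place where the two words do not have the same bit; they are equal
iff both have ended there. By `NoBit` the binary words extend exactly to the next symbol that is not
a bit. -/
theorem sure_cmpLoop {r r' : List (Tok Γ)} (hr : NoBit r) (hr' : NoBit r') :
    ∀ {u v : List Bool} {s : ScanState Γ}, At s .s₁ (u.map .bit ++ r) → At s .s₂ (v.map .bit ++ r') →
      Sure (PSem (advPort Γ)) (.loop (fun v _ => IsBit (v.tok .s₁) ∧ v.tok .s₁ = v.tok .s₂)
        (.seq (adv .s₁) (adv .s₂))) s fun s' => Frame {.s₁, .s₂} s s' ∧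
          ((¬ IsBit (s'.v.tok .s₁) ∧ ¬ IsBit (s'.v.tok .s₂)) ↔ u = v)
  | [], [], s, h₁, h₂ => by
    have h₁' := isBit_head hr
    have h₂' := isBit_head hr'
    simp only [List.map_nil, List.nil_append] at h₁ h₂
    rw [← h₁.1] at h₁'
    rw [← h₂.1] at h₂'
    exact Sure.loop_done (fun h => h₁' h.1) ⟨Frame.refl s, by simp [h₁', h₂']⟩
  | [], c :: v, s, h₁, h₂ => by
    have h₁' := isBit_head hr
    simp only [List.map_nil, List.nil_append] at h₁
    rw [← h₁.1] at h₁'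
    refine Sure.loop_done (fun h => h₁' h.1) ⟨Frame.refl s, ?_⟩
    rw [h₂.1]
    simp [IsBit]
  | b :: u, [], s, h₁, h₂ => by
    have h₂' := isBit_head hr'
    simp only [List.map_nil, List.nil_append] at h₂
    rw [← h₂.1] at h₂'
    refine Sure.loop_done (fun h => h₂' (h.2 ▸ h.1)) ⟨Frame.refl s, ?_⟩
    rw [h₁.1]
    simp [IsBit]
  | b :: u, c :: v, s, h₁, h₂ => by
    by_cases hbc : b = c
    · subst hbc
      refine Sure.loop_cons ?_ (sure_adv.seq fun m hm => sure_adv.mono fun m' hm' => ?_)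
      · show IsBit (s.v.tok .s₁) ∧ s.v.tok .s₁ = s.v.tok .s₂
        rw [h₁.1, h₂.1]
        simp [IsBit]
      · obtain ⟨f₁, a₁, -⟩ := hm
        obtain ⟨f₂, a₂, -⟩ := hm'
        rw [h₁.2] at a₁
        rw [f₁.ptr _ (by simp), h₂.2] at a₂
        have a₁' : At m' .s₁ (u.map .bit ++ r) :=
          ⟨(f₂.tok _ (by simp)).trans a₁.1, (f₂.ptr _ (by simp)).trans a₁.2⟩
        refine (sure_cmpLoop hr hr' a₁' a₂).mono fun s' ⟨h, h'⟩ => ⟨?_, by simpa using h'⟩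
        refine Frame.trans ?_ h
        refine ⟨fun p hp => ?_, fun p hp => ?_, f₂.ext.trans f₁.ext, f₂.flag'.trans f₁.flag',
          f₂.bad.trans f₁.bad, f₂.done.trans f₁.done⟩
        · simp only [Set.mem_insert_iff, Set.mem_singleton_iff, not_or] at hp
          rw [f₂.ptr _ (by simpa using hp.2), f₁.ptr _ (by simpa using hp.1)]
        · simp only [Set.mem_insert_iff, Set.mem_singleton_iff, not_or] at hp
          rw [f₂.tok _ (by simpa using hp.2), f₁.tok _ (by simpa using hp.1)]
    · refine Sure.loop_done ?_ ⟨Frame.refl s, ?_⟩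
      · rintro ⟨-, h⟩
        rw [h₁.1, h₂.1] at h
        simp [hbc] at h
      · rw [h₁.1]
        simp [IsBit, hbc]

theorem Frame.mono {Z Z' : Set Ptr} {s s' : ScanState Γ} (h : Frame Z s s') (hZ : Z ⊆ Z') :
    Frame Z' s s' :=
  ⟨fun p hp => h.ptr p fun h => hp (hZ h), fun p hp => h.tok p fun h => hp (hZ h), h.ext, h.flag',
    h.bad, h.done⟩

theorem sure_cmp {p q : Ptr} (hq : q ≠ .s₁ ∧ q ≠ .s₂) {s : ScanState Γ}
    {r r' : List (Tok Γ)} {u v : List Bool} (hr : NoBit r) (hr' : NoBit r')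
    (h₁ : s.ptr p = u.map .bit ++ r) (h₂ : s.ptr q = v.map .bit ++ r') :
    Sure (PSem (advPort Γ)) (cmp p q) s fun s' => Frame {.s₁, .s₂} s s' ∧
      (s'.v.flag = true ↔ u = v) := by
  refine sure_cpy.seq fun m₁ ⟨f₁, e₁, _⟩ => sure_cpy.seq fun m₂ ⟨f₂, e₂, _⟩ => sure_adv.seq
    fun m₃ ⟨f₃, a₁, _⟩ => sure_adv.seq fun m₄ ⟨f₄, a₂, _⟩ => ?_
  have a₁' : At m₄ .s₁ (u.map .bit ++ r) := by
    rw [← h₁, ← e₁, ← f₂.ptr .s₁ (by simp)]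
    exact ⟨(f₄.tok _ (by simp)).trans a₁.1, (f₄.ptr _ (by simp)).trans a₁.2⟩
  have a₂' : At m₄ .s₂ (v.map .bit ++ r') := by
    rw [← h₂, ← f₁.ptr q (by simpa using hq.1), ← e₂, ← f₃.ptr .s₂ (by simp)]
    exact a₂
  refine (sure_cmpLoop hr hr' a₁' a₂').seq fun m₅ ⟨f₅, h₅⟩ => sure_chg.mono ?_
  rintro s' rfl
  have f : Frame {.s₁, .s₂} s m₅ := (f₁.mono (by simp)).trans ((f₂.mono (by simp)).trans
    ((f₃.mono (by simp)).trans ((f₄.mono (by simp)).trans f₅)))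
  exact ⟨⟨f.ptr, f.tok, f.ext, f.flag', f.bad, f.done⟩, by simpa using h₅⟩

theorem sure_passLoop {p : Ptr} {t : List (Tok Γ)} (ht : NoBit t) : ∀ {u : List Bool}
    {s : ScanState Γ}, At s p (u.map .bit ++ t) →
      Sure (PSem (advPort Γ)) (.loop (fun v _ => IsBit (v.tok p)) (adv p)) s fun s' =>
        Frame {p} s s' ∧ At s' p t ∧ s'.v.flag = s.v.flag
  | [], s, a => by
    refine Sure.loop_done ?_ ⟨Frame.refl s, a, rfl⟩
    show ¬ IsBit (s.v.tok p)
    rw [a.1]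
    exact isBit_head ht
  | b :: u, s, a => by
    refine Sure.loop_cons ?_ (sure_adv.mono fun m ⟨f₁, a₁, e₁⟩ => ?_)
    · show IsBit (s.v.tok p)
      rw [a.1]
      trivial
    · rw [a.2] at a₁
      exact (sure_passLoop ht a₁).mono fun s' ⟨f₂, a₂, e₂⟩ => ⟨f₁.trans f₂, a₂, e₂.trans e₁⟩

theorem sure_pass {p : Ptr} {s : ScanState Γ} {t : List (Tok Γ)} {u : List Bool} (ht : NoBit t)
    (h : s.ptr p = u.map .bit ++ t) : Sure (PSem (advPort Γ)) (pass p) s fun s' =>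
      Frame {p} s s' ∧ At s' p t ∧ s'.v.flag = s.v.flag := by
  refine sure_adv.seq fun m ⟨f₁, a₁, e₁⟩ => ?_
  rw [h] at a₁
  exact (sure_passLoop ht a₁).mono fun s' ⟨f₂, a₂, e₂⟩ => ⟨f₁.trans f₂, a₂, e₂.trans e₁⟩

/-! ### The syntax check -/

/-- What may follow in the states of the syntax check. -/
def SyntaxOk : Fin 5 → List (Tok Γ) → Prop
  | 0, w => ∃ 𝒜 : FA Γ, w = 𝒜.encode
  | 1, w => ∃ (q : List Bool) (l : List (List Bool)) (es : List (Edge Γ)), w = q.map .bit ++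
      (l.flatMap (fun q => Tok.acceptMark :: q.map Tok.bit) ++ es.flatMap Edge.encode)
  | 2, w => ∃ (a : List Bool) (o : Option Γ) (b : List Bool) (es : List (Edge Γ)), w = a.map .bit ++
      (.label o :: (b.map .bit ++ es.flatMap Edge.encode))
  | 3, w => ∃ (b : List Bool) (es : List (Edge Γ)), w = b.map .bit ++ es.flatMap Edge.encode
  | 4, _ => False

theorem foldl_bits {i : Fin 5} (hi : i = 1 ∨ i = 2 ∨ i = 3) (u : List Bool) (w : List (Tok Γ)) :
    (u.map Tok.bit ++ w).foldl syntaxStep i = w.foldl syntaxStep i := by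
  induction u with
  | nil => rfl
  | cons b u ih =>
    rw [List.map_cons, List.cons_append, List.foldl_cons]
    have : syntaxStep i (.bit b : Tok Γ) = i := by rcases hi with rfl | rfl | rfl <;> rfl
    rw [this, ih]

theorem foldl_edges (es : List (Edge Γ)) : ∀ {i : Fin 5}, i = 1 ∨ i = 3 →
    (es.flatMap Edge.encode).foldl syntaxStep i = 1 ∨
      (es.flatMap Edge.encode).foldl syntaxStep i = 3 := by
  induction es with
  | nil => exact fun hi => hi
  | cons e es ih =>
    intro i hi
    have h₁ : syntaxStep i (.edgeMark : Tok Γ) = 2 := by rcases hi with rfl | rfl <;> rfl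
    have h₂ : syntaxStep 2 (.label e.label : Tok Γ) = 3 := rfl
    rw [List.flatMap_cons, Edge.encode, List.cons_append, List.foldl_cons, h₁, List.append_assoc,
      foldl_bits (by simp), List.cons_append, List.foldl_cons, h₂, foldl_bits (by simp)]
    exact ih (Or.inr rfl)

theorem foldl_encode (𝒜 : FA Γ) : 𝒜.encode.foldl syntaxStep 0 = 1 ∨
    𝒜.encode.foldl syntaxStep 0 = 3 := by
  have h₁ : syntaxStep 0 (.startMark : Tok Γ) = 1 := rfl
  have h₂ : syntaxStep 1 (.acceptMark : Tok Γ) = 1 := rfl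
  rw [FA.encode, List.foldl_cons, h₁, foldl_bits (by simp)]
  induction 𝒜.accept with
  | nil => exact foldl_edges _ (Or.inl rfl)
  | cons q l ih =>
    rw [List.flatMap_cons, List.cons_append, List.cons_append, List.foldl_cons, List.append_assoc,
      h₂, foldl_bits (by simp)]
    exact ih

/-- Descriptions form a regular language, because only the kind of the current binary word matters:
state `1` belongs to the initial and the accepting states, `2` to a source, `3` to a target, and `4`
is dead. A description may end in `1` or `3`. -/
theorem syntaxOk_of_foldl : ∀ {w : List (Tok Γ)} {i : Fin 5},
    w.foldl syntaxStep i = 1 ∨ w.foldl syntaxStep i = 3 → SyntaxOk i w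
  | [], i, h => by
    rcases h with rfl | rfl
    · exact ⟨[], [], [], rfl⟩
    · exact ⟨[], [], rfl⟩
  | b :: w, i, h => by
    have h := syntaxOk_of_foldl (w := w) (i := syntaxStep i b) h
    fin_cases i
    · cases b <;> try exact h.elim
      obtain ⟨q, l, es, rfl⟩ := h
      exact ⟨⟨q, l, es⟩, rfl⟩
    · cases b <;> try exact h.elim
      · obtain ⟨q, l, es, rfl⟩ := h
        exact ⟨_ :: q, l, es, rfl⟩
      · obtain ⟨q, l, es, rfl⟩ := h
        exact ⟨[], q :: l, es, by simp⟩
      · obtain ⟨a, o, c, es, rfl⟩ := h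
        exact ⟨[], [], ⟨a, o, c⟩ :: es, by simp [Edge.encode]⟩
    · cases b <;> try exact h.elim
      · obtain ⟨a, o, c, es, rfl⟩ := h
        exact ⟨_ :: a, o, c, es, rfl⟩
      · obtain ⟨c, es, rfl⟩ := h
        exact ⟨[], _, c, es, rfl⟩
    · cases b <;> try exact h.elim
      · obtain ⟨c, es, rfl⟩ := h
        exact ⟨_ :: c, es, rfl⟩
      · obtain ⟨a, o, c, es, rfl⟩ := h
        exact ⟨[], ⟨a, o, c⟩ :: es, by simp [Edge.encode]⟩
    · cases b <;> exact h.elim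

theorem foldl_syntax_iff {w : List (Tok Γ)} :
    (w.foldl syntaxStep 0 = 1 ∨ w.foldl syntaxStep 0 = 3) ↔ ∃ 𝒜 : FA Γ, w = 𝒜.encode :=
  ⟨fun h => syntaxOk_of_foldl h, by rintro ⟨𝒜, rfl⟩; exact foldl_encode 𝒜⟩

theorem sure_syntaxLoop : ∀ {t : List (Tok Γ)} {s : ScanState Γ}, At s .e t →
    Sure (PSem (advPort Γ)) (.loop (fun v _ => v.tok .e ≠ none)
      (.seq (chg fun v _ => { v with st := (v.tok .e).elim 4 (syntaxStep v.st) }) (adv .e))) s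
      fun s' => Frame {.e} s s' ∧ s'.v.st = t.foldl syntaxStep s.v.st
  | [], s, a => Sure.loop_done (fun h => h a.1) ⟨Frame.refl s, rfl⟩
  | b :: t, s, a => by
    refine Sure.loop_cons ?_ (sure_chg.seq ?_)
    · show s.v.tok .e ≠ none
      simp [a.1]
    · rintro _ rfl
      -- `Frame` does not record `st`, so the primitive is unfolded here instead of using
      -- `sure_adv`.
      refine Sure.mono ⟨⟨_, rfl⟩, fun s' hs => hs⟩ ?_
      rintro m rfl
      refine (sure_syntaxLoop (t := t) ?_).mono fun s' ⟨f, h⟩ => ⟨?_, ?_⟩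
      · exact ⟨by simp [PPrim.apply, a.2], by simp [PPrim.apply, a.2]⟩
      · refine Frame.trans ?_ f
        refine ⟨fun q hq => ?_, fun q hq => ?_, rfl, rfl, rfl, rfl⟩ <;> simp_all [PPrim.apply]
      · rw [h]
        simp [PPrim.apply, a.1]

theorem sure_checkSyntax {s : ScanState Γ} : Sure (PSem (advPort Γ)) checkSyntax s fun s' =>
    Frame {.e} s s' ∧ s'.v.st = (s.ptr .org).foldl syntaxStep s.v.st := by
  refine sure_cpy.seq fun m₁ ⟨f₁, e₁, h₁⟩ => ?_
  refine Sure.seq (Q := fun m => Frame {.e} m₁ m ∧ At m .e (m₁.ptr .e) ∧ m.v.st = m₁.v.st)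
    ⟨⟨_, rfl⟩, ?_⟩ fun m₂ ⟨f₂, a₂, e₂⟩ => ?_
  · rintro _ rfl
    refine ⟨⟨fun q hq => ?_, fun q hq => ?_, rfl, rfl, rfl, rfl⟩, ⟨?_, ?_⟩, rfl⟩ <;>
      simp_all [PPrim.apply]
  · refine (sure_syntaxLoop a₂).mono fun s' ⟨f₃, e₃⟩ => ⟨f₁.trans (f₂.trans f₃), ?_⟩
    rw [e₃, e₂, h₁, e₁]

end ScanProg

end RegReal

/-! ### Correctness of the determinism check -/

namespace RegReal

open Relation Prog

namespace ScanProg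

variable {Γ : Type}

/-! ### The determinism check -/

/-- What programs for the determinism check leave unchanged if they use the pointers in `Z`. -/
structure Keep (Z : Set Ptr) (s s' : ScanState Γ) : Prop where
  ptr : ∀ p ∉ Z, s'.ptr p = s.ptr p
  ext : s'.ext = s.ext
  done : s'.v.done = s.v.done

theorem Keep.trans {Z : Set Ptr} {s s' s'' : ScanState Γ} (h : Keep Z s s') (h' : Keep Z s' s'') :
    Keep Z s s'' where
  ptr p hp := (h'.ptr p hp).trans (h.ptr p hp)
  ext := h'.ext.trans h.ext
  done := h'.done.trans h.done

theorem Frame.keep {Z Z' : Set Ptr} {s s' : ScanState Γ} (h : Frame Z s s') (hZ : Z ⊆ Z') :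
    Keep Z' s s' :=
  ⟨fun p hp => h.ptr p fun h => hp (hZ h), h.ext, h.done⟩

theorem Keep.mono {Z Z' : Set Ptr} {s s' : ScanState Γ} (h : Keep Z s s') (hZ : Z ⊆ Z') :
    Keep Z' s s' :=
  ⟨fun p hp => h.ptr p fun h => hp (hZ h), h.ext, h.done⟩

theorem noBit_label (o : Option Γ) (t : List (Tok Γ)) : NoBit (.label o :: t) := trivial

/-- Two transitions contradict determinism. -/
def Viol (e f : Edge Γ) : Prop :=
  (e.src = f.src ∧ e.label = f.label ∧ e.dst ≠ f.dst) ∨ e.label = none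

/-- The description of a transition after its mark. -/
def body (e : Edge Γ) (t : List (Tok Γ)) : List (Tok Γ) :=
  e.src.map .bit ++ (.label e.label :: (e.dst.map .bit ++ t))

theorem encode_append (e : Edge Γ) (t : List (Tok Γ)) : e.encode ++ t = .edgeMark :: body e t := by
  simp [Edge.encode, body]

theorem sure_checkPair {s : ScanState Γ} {e f : Edge Γ} {r r' : List (Tok Γ)} (hr : NoBit r)
    (hr' : NoBit r') (h : s.ptr .e = body e r) (h' : s.ptr .e' = body f r') :
    Sure (PSem (advPort Γ)) checkPair s fun s' => Keep {.s₁, .s₂, .s₃, .s₄} s s' ∧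
      (s'.v.bad = true ↔ s.v.bad = true ∨ Viol e f) := by
  refine (sure_cmp (by simp) (noBit_label _ _) (noBit_label _ _) h h').seq
    fun m₁ ⟨f₁, c₁⟩ => sure_chg.seq ?_
  rintro m₂ rfl
  refine sure_cpy.seq fun m₃ ⟨f₃, p₃, v₃⟩ => ?_
  have p₃ : m₃.ptr .s₃ = body e r := p₃.trans ((f₁.ptr .e (by simp)).trans h)
  refine (sure_pass (noBit_label _ _) p₃).seq fun m₄ ⟨f₄, a₄, _⟩ =>
    sure_cpy.seq fun m₅ ⟨f₅, p₅, v₅⟩ => ?_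
  have p₅ : m₅.ptr .s₄ = body f r' := p₅.trans ((f₄.ptr .e' (by simp)).trans
    ((f₃.ptr .e' (by simp)).trans ((f₁.ptr .e' (by simp)).trans h')))
  refine (sure_pass (noBit_label _ _) p₅).seq fun m₆ ⟨f₆, a₆, _⟩ => ?_
  have q₃ : m₆.ptr .s₃ = e.dst.map .bit ++ r :=
    (f₆.ptr .s₃ (by simp)).trans ((f₅.ptr .s₃ (by simp)).trans a₄.2)
  refine (sure_cmp (by simp) hr hr' q₃ a₆.2).seq fun m₇ ⟨f₇, c₇⟩ => sure_chg.mono ?_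
  rintro _ rfl
  have t₃ : m₇.v.tok .s₃ = some (.label e.label) :=
    (f₇.tok .s₃ (by simp)).trans ((f₆.tok .s₃ (by simp)).trans ((f₅.tok .s₃ (by simp)).trans a₄.1))
  have t₄ : m₇.v.tok .s₄ = some (.label f.label) := (f₇.tok .s₄ (by simp)).trans a₆.1
  have f := (f₃.mono (Z' := {.s₁, .s₂, .s₃, .s₄}) (by simp)).trans ((f₄.mono (by simp)).trans
    ((f₅.mono (by simp)).trans ((f₆.mono (by simp)).trans (f₇.mono (by simp [Set.insert_subset_iff])))))
  have hk := f.keep subset_rfl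
  have hk₁ := f₁.keep (Z' := {.s₁, .s₂, .s₃, .s₄}) (by simp [Set.insert_subset_iff])
  refine ⟨⟨fun p hp => (hk.ptr p hp).trans (hk₁.ptr p hp), hk.ext.trans hk₁.ext,
    hk.done.trans hk₁.done⟩, ?_⟩
  have hb : m₇.v.bad = s.v.bad := f.bad.trans f₁.bad
  have hf : m₇.v.flag' = m₁.v.flag := f.flag'
  simp only [decide_eq_true_eq, t₃, t₄, hb, hf, Viol, c₁, Option.some.injEq, Tok.label.injEq,
    ← Bool.not_eq_true, c₇]

section Scan

variable {p : Ptr} {h : ScanProg Γ} {I : List (Edge Γ) → ScanState Γ → Prop}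

/-- The loop of `scan`. -/
def scanLoop (p : Ptr) (h : ScanProg Γ) : ScanProg Γ := .loop (fun v _ => v.tok p ≠ none)
    (.seq (.ite (fun v _ => v.tok p = some .edgeMark) h .skip) (adv p))

/-- Up to the next transition mark the loop only reads on. The continuation `H` is a parameter
because this is used both for the beginning of the description and for the body of a transition that
has been handled. -/
theorem sure_scanLoop_pre {Q : ScanState Γ → Prop} {l : List (Edge Γ)} {t : List (Tok Γ)}
    (hI : ∀ s s', Frame {p} s s' → I l s → I l s')
    (H : ∀ s, At s p t → I l s → Sure (PSem (advPort Γ)) (scanLoop p h) s Q) :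
    ∀ {u : List (Tok Γ)} {s : ScanState Γ}, .edgeMark ∉ u → At s p (u ++ t) → I l s →
      Sure (PSem (advPort Γ)) (scanLoop p h) s Q
  | [], s, _, a, hl => H s a hl
  | b :: u, s, hu, a, hl => by
    simp only [List.mem_cons, not_or] at hu
    refine Sure.loop_cons ?_ ((Sure.ite_neg ?_ (Sure.skip (Q := fun s' => s' = s) rfl)).seq ?_)
    · show s.v.tok p ≠ none
      simp [a.1]
    · show ¬ s.v.tok p = some .edgeMark
      rw [a.1]
      simpa using Ne.symm hu.1
    · rintro _ rfl
      refine sure_adv.mono fun m ⟨f, a', _⟩ => ?_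
      rw [a.2] at a'
      exact sure_scanLoop_pre hI H hu.2 a' (hI _ _ f hl)

theorem edgeMark_not_mem_body {e : Edge Γ} : (.edgeMark : Tok Γ) ∉ body e [] := by simp [body]

/-- The handler inspects a transition while the pointer `p` itself remains just behind the mark; the
loop then passes over the body by itself. -/
theorem sure_scanLoop (hI : ∀ l s s', Frame {p} s s' → I l s → I l s')
    (hh : ∀ l e r s, NoBit r → I l s → s.ptr p = body e r →
      Sure (PSem (advPort Γ)) h s fun s' => s'.ptr p = s.ptr p ∧ I (l ++ [e]) s') :
    ∀ {es l : List (Edge Γ)} {s : ScanState Γ}, At s p (es.flatMap Edge.encode) → I l s →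
      Sure (PSem (advPort Γ)) (scanLoop p h) s (I (l ++ es))
  | [], l, s, a, hl => Sure.loop_done (fun h => h a.1) (by simpa using hl)
  | e :: es, l, s, a, hl => by
    rw [List.flatMap_cons, encode_append] at a
    refine Sure.loop_cons ?_ ((Sure.ite_pos ?_ (hh l e _ s (noBit_edges es) hl a.2)).seq ?_)
    · show s.v.tok p ≠ none
      simp [a.1]
    · exact a.1
    · rintro m ⟨h₁, h₂⟩
      refine sure_adv.mono fun m' ⟨f, a', _⟩ => ?_
      rw [h₁, a.2] at a'
      have : body e (es.flatMap Edge.encode) = body e [] ++ es.flatMap Edge.encode := by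
        simp [body]
      rw [List.tail_cons, this] at a'
      refine sure_scanLoop_pre (hI _) (fun s a hl => ?_) edgeMark_not_mem_body a' (hI _ _ _ f h₂)
      have := sure_scanLoop hI hh a hl
      rwa [List.append_assoc] at this

theorem sure_scan (hI : ∀ l s s', Frame {p} s s' → I l s → I l s')
    (hh : ∀ l e r s, NoBit r → I l s → s.ptr p = body e r →
      Sure (PSem (advPort Γ)) h s fun s' => s'.ptr p = s.ptr p ∧ I (l ++ [e]) s')
    {s : ScanState Γ} {u : List (Tok Γ)} {es : List (Edge Γ)} (hu : .edgeMark ∉ u)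
    (hw : s.ptr .org = u ++ es.flatMap Edge.encode) (h₀ : I [] s) :
    Sure (PSem (advPort Γ)) (scan p h) s (I es) := by
  refine sure_cpy.seq fun m₁ ⟨f₁, e₁, _⟩ => sure_adv.seq fun m₂ ⟨f₂, a₂, _⟩ => ?_
  rw [e₁, hw] at a₂
  exact sure_scanLoop_pre (hI _) (fun s a hl => sure_scanLoop hI hh a hl) hu a₂
    (hI _ _ _ f₂ (hI _ _ _ f₁ h₀))

end Scan

theorem encode_eq_append (𝒜 : FA Γ) : ∃ u : List (Tok Γ), .edgeMark ∉ u ∧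
    𝒜.encode = u ++ 𝒜.edges.flatMap Edge.encode :=
  ⟨.startMark :: (𝒜.start.map .bit ++ 𝒜.accept.flatMap (fun q => Tok.acceptMark :: q.map Tok.bit)),
    by simp, by simp [FA.encode]⟩

/-- Every transition is compared with every transition, itself included, so an ε-label is detected
even if there is only one transition. Only the pointer `org` has to survive the check. -/
theorem sure_checkDet {s : ScanState Γ} {𝒜 : FA Γ} (hw : s.ptr .org = 𝒜.encode) :
    Sure (PSem (advPort Γ)) checkDet s fun s' => Keep {.org}ᶜ s s' ∧
      (s'.v.bad = true ↔ s.v.bad = true ∨ ¬ 𝒜.IsDFA) := by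
  obtain ⟨u, hu, hu'⟩ := encode_eq_append 𝒜
  rw [hu'] at hw
  have h₁ := sure_scan (p := .e) (h := scan .e' checkPair) (s := s) (es := 𝒜.edges)
    (I := fun l s' => Keep {.org}ᶜ s s' ∧
      (s'.v.bad = true ↔ s.v.bad = true ∨ ∃ e ∈ l, ∃ f ∈ 𝒜.edges, Viol e f))
    (fun l m m' f h => ⟨h.1.trans (f.keep (by simp)), by rw [f.bad, h.2]⟩)
    (fun l e r m hr hl hm => ?_) hu hw ⟨⟨fun _ _ => rfl, rfl, rfl⟩, by simp⟩
  · refine h₁.mono fun s' ⟨h₂, h₃⟩ => ⟨h₂, h₃.trans (or_congr_right ?_)⟩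
    simp only [FA.IsDFA, Viol]
    constructor
    · rintro ⟨e, he, f, hf, h | h⟩ ⟨h₄, h₅⟩
      exacts [h.2.2 (h₅ e he f hf h.1 h.2.1), h₄ e he h]
    · intro h
      by_contra h'
      push Not at h'
      exact h ⟨fun e he => (h' e he e he).2, fun e he f hf => (h' e he f hf).1⟩
  · have h₂ := sure_scan (p := .e') (h := checkPair) (s := m) (es := 𝒜.edges)
      (I := fun l s' => Keep {.e', .s₁, .s₂, .s₃, .s₄} m s' ∧
        (s'.v.bad = true ↔ m.v.bad = true ∨ ∃ f ∈ l, Viol e f))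
      (fun l m m' f h => ⟨h.1.trans (f.keep (by simp)), by rw [f.bad, h.2]⟩)
      (fun l f r' m' hr' hl' hm' => ?_) hu ((hl.1.ptr _ (by simp)).trans hw)
      ⟨⟨fun _ _ => rfl, rfl, rfl⟩, by simp⟩
    · refine h₂.mono fun s' ⟨h₃, h₄⟩ => ⟨h₃.ptr _ (by simp), hl.1.trans (h₃.mono ?_), ?_⟩
      · rintro _ (rfl | rfl | rfl | rfl | rfl) <;> simp
      · rw [h₄, hl.2]
        simp only [List.mem_append, List.mem_singleton, or_and_right, exists_or, exists_eq_left,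
          or_assoc]
    · refine (sure_checkPair hr hr' ((hl'.1.ptr .e (by simp)).trans hm) hm').mono
        fun s' ⟨h₃, h₄⟩ => ⟨h₃.ptr _ (by simp), hl'.1.trans (h₃.mono (by simp)), ?_⟩
      rw [h₄, hl'.2]
      simp only [List.mem_append, List.mem_singleton, or_and_right, exists_or, exists_eq_left,
        or_assoc]

end ScanProg

end RegReal

/-! ### Correctness of the simulation, and the theorem -/

namespace RegReal

open Relation Prog

namespace ScanProg

variable {Γ : Type}

/-! ### The simulation of an automaton -/

/-- The simulation is at `t` in the description `w`, in the state `q`, with the advice `y` left. -/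
structure View (w t : List (Tok Γ)) (q : List Bool) (y : List Γ) (s : ScanState Γ) : Prop where
  org : s.ptr .org = w
  pos : At s .e t
  cur : ∃ r, NoBit r ∧ s.ptr .cur = q.map .bit ++ r
  ext : s.ext = y
  done : s.v.done = false

variable {w t : List (Tok Γ)} {q : List Bool} {y : List Γ} {s : ScanState Γ} {nd : Bool}

theorem View.frame {Z : Set Ptr} {s' : ScanState Γ} {t' : List (Tok Γ)} (h : View w t q y s)
    (hf : Frame Z s s') (ho : .org ∉ Z) (hc : .cur ∉ Z) (ha : At s' .e t') : View w t' q y s' := by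
  obtain ⟨r, hr, hr'⟩ := h.cur
  exact ⟨(hf.ptr _ ho).trans h.org, ha, ⟨r, hr, (hf.ptr _ hc).trans hr'⟩, hf.ext.trans h.ext,
    hf.done.trans h.done⟩

theorem View.sure_adv (h : View w t q y s) :
    Sure (PSem (advPort Γ)) (adv .e) s (View w t.tail q y) := by
  refine ScanProg.sure_adv.mono fun m ⟨f, a, _⟩ => h.frame f (by simp) (by simp) ?_
  rwa [h.pos.2] at a

theorem sure_simBody_nil (h : View w [] q y s) :
    Sure (PSem (advPort Γ)) (simBody nd) s (View w w q y) := by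
  refine Sure.ite_pos h.pos.1 (sure_cpy.seq fun m ⟨f, e, _⟩ => ScanProg.sure_adv.mono
    fun m' ⟨f', a, _⟩ => h.frame (f.trans f') (by simp) (by simp) ?_)
  rwa [e, h.org] at a

theorem sure_simBody_other {b : Tok Γ} (h : View w (b :: t) q y s) (hb : b ≠ .acceptMark)
    (hb' : b ≠ .edgeMark) : Sure (PSem (advPort Γ)) (simBody nd) s (View w t q y) := by
  have ht := h.pos.1
  refine Sure.ite_neg ?_ (Sure.ite_neg ?_ (Sure.ite_neg ?_ h.sure_adv)) <;>
    simp [PSem, ht, hb, hb']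

theorem sure_simBody_accept {a : List Bool} (ht : NoBit t)
    (h : View w (.acceptMark :: (a.map .bit ++ t)) q y s) :
    Sure (PSem (advPort Γ)) (simBody nd) s fun s' => (a = q ∧ y = [] ∧ s'.v.done = true ∧ s'.ext = y)
      ∨ (¬ (a = q ∧ y = []) ∧ View w (a.map .bit ++ t) q y s') := by
  have hp := h.pos.1
  refine Sure.ite_neg (by simp [PSem, hp]) (Sure.ite_pos hp ?_)
  obtain ⟨r, hr, hr'⟩ := h.cur
  refine (sure_cmp (by simp) ht hr h.pos.2 hr').seq fun m ⟨f, hf⟩ => sure_chg.seq ?_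
  rintro _ rfl
  have hm := h.frame f (by simp) (by simp)
    ⟨(f.tok _ (by simp)).trans h.pos.1, (f.ptr _ (by simp)).trans h.pos.2⟩
  refine ScanProg.sure_adv.mono fun m' ⟨f', a', _⟩ => ?_
  have hd : m'.v.done = (m.v.flag && m.ext.head?.isNone) := f'.done
  have hx : m'.ext = m.ext := f'.ext
  have hy : m.ext.head?.isNone = true ↔ y = [] := by simp [hm.ext]
  by_cases hc : a = q ∧ y = []
  · refine .inl ⟨hc.1, hc.2, ?_, hx.trans hm.ext⟩
    rw [hd, hf.2 hc.1, hy.2 hc.2, Bool.and_self]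
  · refine .inr ⟨hc, (f'.ptr .org (by simp)).trans hm.org, ?_, ⟨r, hr, ?_⟩, hx.trans hm.ext, ?_⟩
    · have := hm.pos.2
      rw [List.tail_cons] at this
      change At m' .e (m.ptr .e) at a'
      rwa [this] at a'
    · exact (f'.ptr .cur (by simp)).trans ((f.ptr .cur (by simp)).trans hr')
    · rw [hd, ← Bool.not_eq_true, Bool.and_eq_true, hf, hy]
      exact hc

/-- The part of the simulation that deals with transitions. -/
noncomputable def edgeBody (X : ScanProg Γ) : ScanProg Γ :=
  .seq (cmp .e .cur) (.seq (pass .e) (.seq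
    (.ite (fun v o => v.flag = true ∧ (v.tok .e = some (.label none) ∨ v.tok .e = some (.label o)))
      X .skip)
    (adv .e)))

theorem run_simBody_edge {s' : ScanState Γ} (h : s.v.tok .e = some .edgeMark) :
    (simBody nd).Run (PSem (advPort Γ)) s s' ↔
      (edgeBody (if nd then .choice take .skip else take)).Run (PSem (advPort Γ)) s s' := by
  constructor
  · rintro (⟨h', -⟩ | ⟨-, ⟨h', -⟩ | ⟨-, ⟨-, h'⟩ | ⟨h', -⟩⟩⟩)
    · exact absurd (h.symm.trans h') (by simp)
    · exact absurd (h.symm.trans h') (by simp)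
    · exact h'
    · exact absurd h h'
  · intro h'
    exact .inr ⟨by simp [PSem, h], .inr ⟨by simp [PSem, h], .inl ⟨h, h'⟩⟩⟩

/-- Moves the choice from inside the test to the outside, where each alternative is covered by a
`Sure` lemma; these could not describe the nondeterministic body by a single resulting `View`. -/
theorem run_edgeBody_choice {X Y : ScanProg Γ} {s' : ScanState Γ} :
    (edgeBody (.choice X Y)).Run (PSem (advPort Γ)) s s' ↔
      (edgeBody X).Run (PSem (advPort Γ)) s s' ∨ (edgeBody Y).Run (PSem (advPort Γ)) s s' := by
  constructor
  · rintro ⟨m, h, m', h', n, ⟨hc, hx | hy⟩ | hn, h''⟩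
    exacts [.inl ⟨m, h, m', h', n, .inl ⟨hc, hx⟩, h''⟩, .inr ⟨m, h, m', h', n, .inl ⟨hc, hy⟩, h''⟩,
      .inl ⟨m, h, m', h', n, .inr hn, h''⟩]
  · rintro (⟨m, h, m', h', n, ⟨hc, hx⟩ | hn, h''⟩ | ⟨m, h, m', h', n, ⟨hc, hx⟩ | hn, h''⟩)
    exacts [⟨m, h, m', h', n, .inl ⟨hc, .inl hx⟩, h''⟩, ⟨m, h, m', h', n, .inr hn, h''⟩,
      ⟨m, h, m', h', n, .inl ⟨hc, .inr hx⟩, h''⟩, ⟨m, h, m', h', n, .inr hn, h''⟩]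

variable {e : Edge Γ}

theorem sure_edgeBody {X : ScanProg Γ} {Q : ScanState Γ → Prop}
    (h : View w (.edgeMark :: body e t) q y s)
    (H : ∀ m : ScanState Γ, (m.v.flag = true ↔ e.src = q) →
      View w (.label e.label :: (e.dst.map .bit ++ t)) q y m → Sure (PSem (advPort Γ)) (.seq (.ite
        (fun v o => v.flag = true ∧ (v.tok .e = some (.label none) ∨ v.tok .e = some (.label o)))
          X .skip) (adv .e)) m Q) :
    Sure (PSem (advPort Γ)) (edgeBody X) s Q := by
  obtain ⟨r, hr, hr'⟩ := h.cur
  refine (sure_cmp (by simp) (noBit_label _ _) hr h.pos.2 hr').seq fun m ⟨f, hf⟩ =>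
    (sure_pass (noBit_label _ _) ((f.ptr .e (by simp)).trans h.pos.2)).seq fun m' ⟨f', a, e'⟩ =>
      H m' (by rw [e', hf]) ?_
  exact h.frame ((f.mono (Z' := {.s₁, .s₂, .e}) (by simp [Set.insert_subset_iff])).trans
    (f'.mono (by simp))) (by simp) (by simp) a

theorem label_test {m : ScanState Γ} (hf : m.v.flag = true ↔ e.src = q)
    (h : View w (.label e.label :: (e.dst.map .bit ++ t)) q y m) :
    (PSem (Act := Bool) (K := Ptr) (V := ScanMem Γ) (B := Tok Γ) (advPort Γ)).test
      (fun v o => v.flag = true ∧ (v.tok .e = some (.label none) ∨ v.tok .e = some (.label o))) m ↔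
      e.src = q ∧ ∃ y', y = e.label.toList ++ y' := by
  have hp := h.pos.1
  show _ ∧ (_ ∨ _ = some (Tok.label m.ext.head?)) ↔ _
  rw [hf, hp, h.ext]
  refine and_congr_right fun _ => ?_
  rcases e.label with _ | c
  · simp
  · rcases y with _ | ⟨d, y⟩
    · simp
    · simp [eq_comm]

theorem sure_edgeBody_skip (h : View w (.edgeMark :: body e t) q y s) :
    Sure (PSem (advPort Γ)) (edgeBody .skip) s (View w (e.dst.map .bit ++ t) q y) := by
  refine sure_edgeBody h fun m _ hm => Sure.seq (Q := fun m' => m' = m) ?_ ?_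
  · by_cases hc : (PSem (Act := Bool) (K := Ptr) (V := ScanMem Γ) (B := Tok Γ) (advPort Γ)).test
      (fun v o => v.flag = true ∧ (v.tok .e = some (.label none) ∨ v.tok .e = some (.label o))) m
    · exact Sure.ite_pos hc (Sure.skip rfl)
    · exact Sure.ite_neg hc (Sure.skip rfl)
  · rintro _ rfl
    exact hm.sure_adv

theorem sure_edgeBody_neg {X : ScanProg Γ} (h : View w (.edgeMark :: body e t) q y s)
    (hn : ¬ (e.src = q ∧ ∃ y', y = e.label.toList ++ y')) :
    Sure (PSem (advPort Γ)) (edgeBody X) s (View w (e.dst.map .bit ++ t) q y) := by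
  refine sure_edgeBody h fun m hf hm => (Sure.ite_neg ((label_test hf hm).not.2 hn)
    (Sure.skip (Q := fun m' => m' = m) rfl)).seq ?_
  rintro _ rfl
  exact hm.sure_adv

/-- `cur` is set to the name of the target, which stands right behind the label just read; so
remembering the new state takes only a pointer. -/
theorem sure_edgeBody_take {y' : List Γ} (ht : NoBit t) (h : View w (.edgeMark :: body e t) q y s)
    (hq : e.src = q) (hy : y = e.label.toList ++ y') :
    Sure (PSem (advPort Γ)) (edgeBody take) s (View w (e.dst.map .bit ++ t) e.dst y') := by
  refine sure_edgeBody h fun m hf hm => (Sure.ite_pos ((label_test hf hm).2 ⟨hq, y', hy⟩)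
    (sure_cpy.seq (R := View w (.label e.label :: (e.dst.map Tok.bit ++ t)) e.dst y')
      fun m₁ ⟨f₁, e₁, v₁⟩ => ⟨⟨_, rfl⟩, ?_⟩)).seq fun m' hm' => hm'.sure_adv
  rintro _ rfl
  refine ⟨(f₁.ptr .org (by simp)).trans hm.org, ⟨(f₁.tok .e (by simp)).trans hm.pos.1,
    (f₁.ptr .e (by simp)).trans hm.pos.2⟩, ⟨t, ht, e₁.trans hm.pos.2⟩, ?_, f₁.done.trans hm.done⟩
  have h₁ : m₁.v.tok .e = some (.label e.label) := (f₁.tok .e (by simp)).trans hm.pos.1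
  have h₂ : m₁.ext = e.label.toList ++ y' := f₁.ext.trans (hm.ext.trans hy)
  simp only [PPrim.apply, advPort, h₁, h₂]
  rcases hl : e.label with _ | c <;> simp [h₁, hl]

/-- The word `t` is the rest of a description, in which the accepting states `as` and the transitions
`es` have not been scanned. -/
inductive Pos : List (List Bool) → List (Edge Γ) → List (Tok Γ) → Prop
  | nil : Pos [] [] []
  | other {as es b t} (hb : b ≠ .acceptMark) (hb' : b ≠ .edgeMark) (h : Pos as es t) :
    Pos as es (b :: t)
  | accept {a as es t} (ht : NoBit t) (h : Pos as es (a.map .bit ++ t)) :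
    Pos (a :: as) es (.acceptMark :: (a.map .bit ++ t))
  | edge {as e es t} (ht : NoBit t) (h : Pos as es (e.dst.map .bit ++ t)) :
    Pos as (e :: es) (.edgeMark :: body e t)

variable {as : List (List Bool)} {es : List (Edge Γ)}

theorem Pos.bits (h : Pos as es t) : ∀ u : List Bool, Pos as es (u.map .bit ++ t)
  | [] => h
  | _ :: u => .other (by simp) (by simp) (h.bits u)

theorem pos_edges : ∀ es : List (Edge Γ), Pos [] es (es.flatMap Edge.encode)
  | [] => .nil
  | e :: es => by
    rw [List.flatMap_cons, encode_append]
    exact .edge (noBit_edges es) ((pos_edges es).bits _)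

theorem pos_encode (𝒜 : FA Γ) : Pos 𝒜.accept 𝒜.edges 𝒜.encode := by
  refine .other (by simp) (by simp) (Pos.bits ?_ _)
  induction 𝒜.accept with
  | nil => exact pos_edges _
  | cons q l ih =>
    rw [List.flatMap_cons, List.cons_append, List.cons_append, List.append_assoc]
    exact .accept (noBit_tail _ _) (ih.bits _)

/-- The loop of the simulation. -/
noncomputable def simLoop (nd : Bool) : ScanProg Γ := .loop (fun v _ => v.done = false) (simBody nd)

variable {𝒜 : FA Γ}

/-- Soundness as a loop invariant: acceptance from the current state on the remaining advice implies
acceptance of `y₀` from the start. `Pos` ensures that the scanned items are transitions and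
accepting states of `𝒜`. -/
theorem acc_of_simLoop {y₀ : List Γ} {s' : ScanState Γ} (h : View 𝒜.encode t q y s)
    (ht : Pos as es t) (has : as ⊆ 𝒜.accept) (hes : es ⊆ 𝒜.edges)
    (hq : 𝒜.Acc q y → 𝒜.Acc 𝒜.start y₀) (hr : (simLoop nd).Run (PSem (advPort Γ)) s s') :
    𝒜.Acc 𝒜.start y₀ := by
  refine ((Run.loop_inv (fun s : ScanState Γ => s.v.done = true ∧ 𝒜.Acc 𝒜.start y₀ ∨
    ∃ as es t q y, Pos as es t ∧ as ⊆ 𝒜.accept ∧ es ⊆ 𝒜.edges ∧ View 𝒜.encode t q y s ∧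
      (𝒜.Acc q y → 𝒜.Acc 𝒜.start y₀)) ?_ hr (.inr ⟨as, es, t, q, y, ht, has, hes, h, hq⟩))).elim ?_
  · clear h ht has hes hq hr
    rintro s s' (⟨hd, -⟩ | ⟨as, es, t, q, y, ht, has, hes, h, hq⟩) hd' hr
    · exact absurd (hd.symm.trans hd') (by simp)
    cases ht with
    | nil =>
      exact .inr ⟨_, _, _, q, y, pos_encode 𝒜, List.Subset.refl _, List.Subset.refl _, (sure_simBody_nil h).2 _ hr, hq⟩
    | other hb hb' ht =>
      exact .inr ⟨_, _, _, q, y, ht, has, hes, (sure_simBody_other h hb hb').2 _ hr, hq⟩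
    | @accept a as es t hn ht =>
      rcases (sure_simBody_accept hn h).2 _ hr with ⟨rfl, rfl, hd, -⟩ | ⟨-, h'⟩
      · exact .inl ⟨hd, hq (.nil (has (by simp)))⟩
      · exact .inr ⟨_, _, _, q, y, ht, fun _ h => has (by simp [h]), hes, h', hq⟩
    | @edge as e es t hn ht =>
      have hes' : es ⊆ 𝒜.edges := fun _ h => hes (by simp [h])
      rw [run_simBody_edge h.pos.1] at hr
      have key : (edgeBody take).Run (PSem (advPort Γ)) s s' ∨
          (edgeBody .skip).Run (PSem (advPort Γ)) s s' := by
        cases nd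
        · exact .inl hr
        · exact run_edgeBody_choice.1 hr
      rcases key with hr | hr
      · by_cases hm : e.src = q ∧ ∃ y', y = e.label.toList ++ y'
        · obtain ⟨hs, y', hy⟩ := hm
          refine .inr ⟨_, _, _, e.dst, y', ht, has, hes', (sure_edgeBody_take hn h hs hy).2 _ hr,
            fun ha => hq ?_⟩
          rw [hy]
          refine .cons (q := q) (r := e.dst) ?_ ha
          rw [← hs]
          exact hes (by simp)
        · exact .inr ⟨_, _, _, q, y, ht, has, hes', (sure_edgeBody_neg h hm).2 _ hr, hq⟩
      · exact .inr ⟨_, _, _, q, y, ht, has, hes', (sure_edgeBody_skip h).2 _ hr, hq⟩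
  · rintro (⟨-, h⟩ | ⟨as, es, t, q, y, -, -, -, h, -⟩) hd
    · exact h
    · exact absurd h.done hd

/-- Some run of the simulation accepts. -/
def Wins (nd : Bool) (s : ScanState Γ) : Prop :=
  ∃ s', (simLoop nd).Run (PSem (advPort Γ)) s s' ∧ s'.ext = []

theorem Wins.step {s' : ScanState Γ} (h : Wins nd s') (hd : s.v.done = false)
    (hr : (simBody nd).Run (PSem (advPort Γ)) s s') : Wins nd s :=
  h.imp fun _ h => ⟨Run.loop_cons hd hr h.1, h.2⟩

/-- The simulation can accept from the state `q` with the advice `y` left, at all positions in the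
description. -/
def WinsFrom (𝒜 : FA Γ) (nd : Bool) (q : List Bool) (y : List Γ) : Prop :=
  ∀ as es t, Pos as es t → as ⊆ 𝒜.accept → es ⊆ 𝒜.edges → ∀ s, View 𝒜.encode t q y s → Wins nd s

/-- `G` lists the reasons for winning: the right accepting state or a useful transition lies ahead
in the current pass, or the next pass wins. `H` serves the deterministic simulation, which takes
every matching transition it meets, so that all of these must lead to a win. The induction follows
the position in the description. -/
theorem wins_of_pos (ht : Pos as es t)
    (H : nd = true ∨ ∀ e ∈ 𝒜.edges, ∀ y', e.src = q → y = e.label.toList ++ y' →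
      WinsFrom 𝒜 nd e.dst y')
    (G : (y = [] ∧ q ∈ as) ∨ (∃ e ∈ es, ∃ y', e.src = q ∧ y = e.label.toList ++ y' ∧
      WinsFrom 𝒜 nd e.dst y') ∨ ∀ s, View 𝒜.encode 𝒜.encode q y s → Wins nd s)
    (has : as ⊆ 𝒜.accept) (hes : es ⊆ 𝒜.edges) (h : View 𝒜.encode t q y s) : Wins nd s := by
  induction ht generalizing s with
  | nil =>
    obtain ⟨m, hr, hm⟩ := (sure_simBody_nil (nd := nd) h).exists_run
    exact Wins.step ((by simpa using G : ∀ s, View 𝒜.encode 𝒜.encode q y s → Wins nd s) m hm) h.done hr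
  | other hb hb' _ ih =>
    obtain ⟨m, hr, hm⟩ := (sure_simBody_other (nd := nd) h hb hb').exists_run
    exact (ih G has hes hm).step h.done hr
  | @accept a as es t hn ht ih =>
    obtain ⟨m, hr, hm⟩ := (sure_simBody_accept (nd := nd) hn h).exists_run
    rcases hm with ⟨-, hy, hd, hx⟩ | ⟨hn, hm⟩
    · refine Wins.step ⟨m, Run.loop_done ?_, hx.trans hy⟩ h.done hr
      show ¬ m.v.done = false
      simp [hd]
    · refine (ih ?_ (fun _ h => has (by simp [h])) hes hm).step h.done hr
      refine G.imp_left fun ⟨hy, hq⟩ => ⟨hy, ?_⟩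
      exact (List.mem_cons.1 hq).resolve_left fun hq => hn ⟨hq.symm, hy⟩
  | @edge as e es t hn ht ih =>
    have hes' : es ⊆ 𝒜.edges := fun _ h => hes (by simp [h])
    have hwin : ∀ y', e.src = q → y = e.label.toList ++ y' → WinsFrom 𝒜 nd e.dst y' → Wins nd s := by
      intro y' hs hy hw
      obtain ⟨m, hr, hm⟩ := (sure_edgeBody_take hn h hs hy).exists_run
      refine (hw _ _ _ ht has hes' _ hm).step h.done ((run_simBody_edge h.pos.1).2 ?_)
      cases nd
      exacts [hr, run_edgeBody_choice.2 (.inl hr)]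
    -- A transition that leads to a win is taken. Any other has to be passed: by choice if `nd`
    -- holds, and otherwise because by `H` it does not match.
    by_cases hm : ∃ y', e.src = q ∧ y = e.label.toList ++ y' ∧ WinsFrom 𝒜 nd e.dst y'
    · obtain ⟨y', hs, hy, hw⟩ := hm
      exact hwin y' hs hy hw
    have key : Sure (PSem (advPort Γ)) (edgeBody (if nd then .skip else take)) s
        (View 𝒜.encode (e.dst.map .bit ++ t) q y) := by
      cases nd
      · refine sure_edgeBody_neg h ?_
        rintro ⟨hs, y', hy⟩
        exact hm ⟨y', hs, hy, (H.resolve_left (by simp)) e (hes (by simp)) y' hs hy⟩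
      · exact sure_edgeBody_skip h
    obtain ⟨m, hr, hm'⟩ := key.exists_run
    refine (ih ?_ has hes' hm').step h.done ((run_simBody_edge h.pos.1).2 ?_)
    · refine G.imp_right fun G => G.imp_left ?_
      rintro ⟨f, hf, y', hs, hy, hw⟩
      rcases List.mem_cons.1 hf with rfl | hf
      · exact absurd ⟨y', hs, hy, hw⟩ hm
      · exact ⟨f, hf, y', hs, hy, hw⟩
    · cases nd
      exacts [hr, run_edgeBody_choice.2 (.inr hr)]

/-- A scan that starts in the middle may have missed the decisive item, but after one return to the
beginning everything lies ahead; hence `wins_of_pos` is applied twice. In a DFA no transition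
matches the exhausted advice, and those that match the current state and the next letter share their
target. -/
theorem winsFrom_of_acc (hd : nd = true ∨ 𝒜.IsDFA) (h : 𝒜.Acc q y) : WinsFrom 𝒜 nd q y := by
  induction h with
  | @nil q hq =>
    have H : nd = true ∨ ∀ e ∈ 𝒜.edges, ∀ y', e.src = q → [] = e.label.toList ++ y' →
        WinsFrom 𝒜 nd e.dst y' := by
      refine hd.imp_right fun hd e he y' _ hy => absurd ?_ (hd.1 e he)
      have := (List.append_eq_nil_iff.1 hy.symm).1
      simpa using this
    intro as es t ht has hes s hs
    refine wins_of_pos ht H (.inr (.inr fun s hs => ?_)) has hes hs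
    exact wins_of_pos (pos_encode 𝒜) H (.inl ⟨rfl, hq⟩) (List.Subset.refl _) (List.Subset.refl _) hs
  | @cons q o r v he _ ih =>
    have H : nd = true ∨ ∀ e ∈ 𝒜.edges, ∀ y', e.src = q → o.toList ++ v = e.label.toList ++ y' →
        WinsFrom 𝒜 nd e.dst y' := by
      refine hd.imp_right fun hd e he' y' hs hy => ?_
      obtain ⟨c, hc⟩ := Option.ne_none_iff_exists'.1 (hd.1 _ he)
      obtain ⟨d, hd'⟩ := Option.ne_none_iff_exists'.1 (hd.1 _ he')
      dsimp only at hc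
      rw [hc, hd'] at hy
      simp only [Option.toList_some, List.cons_append, List.nil_append, List.cons.injEq] at hy
      obtain ⟨rfl, rfl⟩ := hy
      rw [hd.2 _ he' _ he hs (hd'.trans hc.symm)]
      exact ih
    intro as es t ht has hes s hs
    refine wins_of_pos ht H (.inr (.inr fun s hs => ?_)) has hes hs
    exact wins_of_pos (pos_encode 𝒜) H (.inr (.inl ⟨_, he, v, rfl, rfl, ih⟩)) (List.Subset.refl _) (List.Subset.refl _) hs

theorem run_simulate (hw : s.ptr .org = 𝒜.encode) (hd : s.v.done = false) :
    ∃ m, View 𝒜.encode 𝒜.encode 𝒜.start s.ext m ∧ ∀ s',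
      (simulate nd).Run (PSem (advPort Γ)) s s' ↔ (simLoop nd).Run (PSem (advPort Γ)) m s' := by
  refine ⟨_, ?_, fun s' => ⟨?_, fun h => ⟨_, rfl, _, rfl, _, rfl, _, rfl, h⟩⟩⟩
  · refine ⟨by simp [PPrim.apply, hw], ⟨by simp [PPrim.apply, hw], by simp [PPrim.apply, hw]⟩,
      ⟨_, noBit_tail 𝒜.accept 𝒜.edges, by simp [PPrim.apply, hw, FA.encode]⟩, rfl, hd⟩
  · rintro ⟨_, rfl, _, rfl, _, rfl, _, rfl, h⟩
    exact h

/-! ### The whole program -/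

theorem not_run_diverge {s' : ScanState Γ} : ¬ diverge.Run (PSem (advPort Γ)) s s' :=
  fun h => h.2 trivial

/-- The initial memory. -/
def mem₀ : ScanMem Γ := ⟨fun _ => none, 0, false, false, false, false⟩

/-- The checks are `Sure`, so they neither block a correct description nor let an incorrect one
pass; the only choices are those of the simulation. For `nd = true` the determinism check is
omitted. -/
theorem run_main_iff : (∃ s, (main nd).Run (PSem (advPort Γ)) ⟨mem₀, fun _ => w, y⟩ s ∧ s.ext = []) ↔
    ∃ 𝒜 : FA Γ, w = 𝒜.encode ∧ (nd = true ∨ 𝒜.IsDFA) ∧ 𝒜.Acc 𝒜.start y := by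
  obtain ⟨⟨m₁, hm₁⟩, hs₁⟩ := sure_checkSyntax (s := (⟨mem₀, fun _ => w, y⟩ : ScanState Γ))
  have hdet : ∀ (𝒜 : FA Γ) (m : ScanState Γ), m.ptr .org = 𝒜.encode → m.v.bad = false →
      Sure (PSem (advPort Γ)) (if nd then .skip else checkDet) m fun m' => Keep {.org}ᶜ m m' ∧
        (m'.v.bad = true ↔ nd = false ∧ ¬ 𝒜.IsDFA) := by
    intro 𝒜 m hm hb
    cases nd
    · exact (sure_checkDet hm).mono fun m' h => ⟨h.1, by simp [h.2, hb]⟩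
    · exact Sure.skip ⟨⟨fun _ _ => rfl, rfl, rfl⟩, by simp [hb]⟩
  constructor
  · rintro ⟨s, ⟨m, h₁, ⟨hst, m', h₂, h₃⟩ | ⟨-, h⟩⟩, hs⟩
    · obtain ⟨f, hf⟩ := hs₁ m h₁
      change m.v.st = 1 ∨ m.v.st = 3 at hst
      rw [hf] at hst
      obtain ⟨𝒜, rfl⟩ := foldl_syntax_iff.1 hst
      obtain ⟨k, hb⟩ := (hdet 𝒜 m (f.ptr _ (by simp)) f.bad).2 m' h₂
      rcases h₃ with ⟨-, h₃⟩ | ⟨hb', h₃⟩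
      · exact absurd h₃ not_run_diverge
      · obtain ⟨m'', hv, hr⟩ := run_simulate (nd := nd) (𝒜 := 𝒜) ((k.ptr _ (by simp)).trans
          (f.ptr _ (by simp))) (k.done.trans f.done)
        have he : m'.ext = y := k.ext.trans f.ext
        rw [he] at hv
        refine ⟨𝒜, rfl, ?_, acc_of_simLoop hv (pos_encode 𝒜) (List.Subset.refl _)
          (List.Subset.refl _) id ((hr s).1 h₃)⟩
        cases nd
        · exact .inr (by_contra fun hn => hb' (hb.2 ⟨rfl, hn⟩))
        · exact .inl rfl
    · exact absurd h not_run_diverge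
  · rintro ⟨𝒜, rfl, hd, ha⟩
    obtain ⟨f, hf⟩ := hs₁ m₁ hm₁
    obtain ⟨m', h₂, k, hb⟩ := (hdet 𝒜 m₁ (f.ptr _ (by simp)) f.bad).exists_run
    obtain ⟨m'', hv, hr⟩ := run_simulate (nd := nd) (𝒜 := 𝒜) ((k.ptr _ (by simp)).trans
      (f.ptr _ (by simp))) (k.done.trans f.done)
    have he : m'.ext = y := k.ext.trans f.ext
    rw [he] at hv
    obtain ⟨s, h₃, hs⟩ := winsFrom_of_acc hd ha _ _ _ (pos_encode 𝒜) (List.Subset.refl _)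
      (List.Subset.refl _) _ hv
    refine ⟨s, ⟨m₁, hm₁, .inl ⟨?_, m', h₂, .inr ⟨?_, (hr s).2 h₃⟩⟩⟩, hs⟩
    · show m₁.v.st = 1 ∨ m₁.v.st = 3
      rw [hf]
      exact foldl_syntax_iff.2 ⟨𝒜, rfl⟩
    · intro hb'
      obtain ⟨rfl, hn⟩ := hb.1 hb'
      exact hn (hd.resolve_left (by simp))

end ScanProg

open ScanProg

theorem adviceTM_of_logReduces {A Γ : Type} [Finite A] [Finite Γ] {f : List A → List (Tok Γ)}
    (hf : LogSpaceComputable f) (nd : Bool) : ∃ M : AdviceTM A Γ,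
      (nd = false → TM.Deterministic M) ∧ ∀ F, M.LogSpace F ∧ ∀ x, x ∈ M.language F ↔
        ∃ y ∈ F, ∃ 𝒜 : FA Γ, f x = 𝒜.encode ∧ (nd = true ∨ 𝒜.IsDFA) ∧ y ∈ 𝒜.language := by
  obtain ⟨M, hd, hM⟩ := adviceTM_of_pointer hf mem₀ (main nd)
  refine ⟨M, ?_, fun F => ⟨(hM F).1, fun x => ?_⟩⟩
  · rintro rfl
    exact hd det_main
  · simp only [(hM F).2 x, FA.mem_language, run_main_iff]

theorem mem_CLNA_of_logReduces {A Γ : Type} [Finite A] [Finite Γ] {F : Language Γ} {L : Language A}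
    (h : LogReduces L (NRR F)) : L ∈ CLNA A F := by
  obtain ⟨f, hf, hL⟩ := h
  obtain ⟨M, -, hM⟩ := adviceTM_of_logReduces hf true
  refine ⟨M, (hM F).1, Set.ext fun x => ((hM F).2 x).trans (Iff.trans ?_ (hL x).symm)⟩
  constructor
  · rintro ⟨y, hy, 𝒜, h₁, -, h₂⟩
    exact ⟨𝒜, h₁, y, hy, h₂⟩
  · rintro ⟨𝒜, h₁, y, hy, h₂⟩
    exact ⟨y, hy, 𝒜, h₁, .inl rfl, h₂⟩

theorem mem_CLDA_of_logReduces {A Γ : Type} [Finite A] [Finite Γ] {F : Language Γ} {L : Language A}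
    (h : LogReduces L (RR F)) : L ∈ CLDA A F := by
  obtain ⟨f, hf, hL⟩ := h
  obtain ⟨M, hd, hM⟩ := adviceTM_of_logReduces hf false
  refine ⟨M, hd rfl, (hM F).1, Set.ext fun x => ((hM F).2 x).trans (Iff.trans ?_ (hL x).symm)⟩
  constructor
  · rintro ⟨y, hy, 𝒜, h₁, h, h₂⟩
    exact ⟨𝒜, h.resolve_left (by simp), h₁, y, hy, h₂⟩
  · rintro ⟨𝒜, h, h₁, y, hy, h₂⟩
    exact ⟨y, hy, 𝒜, h₁, .inr h, h₂⟩

end RegReal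

theorem mainTheorem6 (Γ : Type) [Finite Γ] (F : Language Γ) (A : Type) [Finite A] :
    RegReal.CLNA A F = {L : Language A | RegReal.LogReduces L (RegReal.NRR F)} ∧
      RegReal.CLDA A F = {L : Language A | RegReal.LogReduces L (RegReal.RR F)} := by
  refine ⟨Set.ext fun L => ⟨?_, RegReal.mem_CLNA_of_logReduces⟩,
    Set.ext fun L => ⟨?_, RegReal.mem_CLDA_of_logReduces⟩⟩
  · rintro ⟨M, hM, rfl⟩
    exact RegReal.logReduces_NRR hM
  · rintro ⟨M, hd, hM, rfl⟩
    exact RegReal.logReduces_RR hd hM
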